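/- Theorem 6. Let $n$ be a positive integer, let $R$ be a commutative ring and let $\beta\in R$. For $v\in\mathbb{Z}^n$ and $1\le i<n$ let $vs_i$ be $v$ with the components $v_i,v_{i+1}$ exchanged, let $vs_n=[v_1,\dots,v_{n-1},-v_n]$ and, for $n\ge 2$, $v\tau_n=[v_1,\dots,v_{n-2},-v_n,-v_{n-1}]$. These maps act linearly on Laurent polynomials over $R$ in $n$ indeterminates $x_1,\dots,x_n$ through $(x^v)^s=x^{vs}$. Define the isobaric divided differences $$f\pi_i=\frac{x_if-x_{i+1}f^{s_i}}{x_i-x_{i+1}}\ (1\le i<n),\qquad f\pi_n^{BC}=\frac{(x_n+\beta)f-(x_n^{-1}+\beta)f^{s_n}}{x_n-x_n^{-1}},\qquad f\pi_n^{D}=\frac{f-x_{n-1}^{-1}x_n^{-1}f^{\tau_n}}{1-x_{n-1}^{-1}x_n^{-1}}\ (n\ge 2),$$ and $\widehat\pi_i=\pi_i-1$. For every partition $\lambda=(\lambda_1\ge\dots\ge\lambda_n\ge 0)$ put $K_\lambda=\widehat K_\lambda=K^{BC}_\lambda=K^{D}_\lambda=x^\lambda$. The other key polynomials are defined recursively by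 $$K_{vs_i}=K_v\pi_i,\quad \widehat K_{vs_i}=\widehat K_v\widehat\pi_i\qquad (v\in\mathbb{N}^n,\ i<n,\ v_i>v_{i+1}),$$ $$K^{BC}_{vs_i}=K^{BC}_v\pi_i\ \ (v\in\mathbb{Z}^n,\ i<n,\ v_i>v_{i+1}),\qquad K^{BC}_{vs_n}=K^{BC}_v\pi_n^{BC}\ \ (v\in\mathbb{Z}^n,\ v_n>0),$$ $$K^{D}_{vs_i}=K^{D}_v\pi_i\ \ (i<n,\ v_i>v_{i+1}),\qquad K^{D}_{v\tau_n}=K^{D}_v\pi_n^{D}\ \ (n\ge 2,\ v_{n-1}+v_n>0),$$ where $v$ ranges in the last line over the orbits of partitions under the group generated by $s_1,\dots,s_{n-1}$ and, when $n\ge 2$, $\tau_n$. For $v\in\mathbb{N}^n$ write $v\omega=[v_n,\dots,v_1]$, and let $$\Omega^A=\prod_{i+j\le n+1}\frac1{1-x_iy_j},\qquad \Omega^{BC}=\frac{\prod_{i<j}(1-x_ix_j)\prod_i(1+\beta x_i)}{\prod_i\prod_j(1-x_iy_j)\prod_{i\le j}(1-x_i/y_j)},\qquad \Omega^{D}=\frac{\prod_{i\le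 j}(1-x_ix_j)}{\prod_i\prod_j(1-x_iy_j)\prod_{i\le j}(1-x_i/y_j)},$$ with all indices running from $1$ to $n$. Then, as formal power series in $x_1,\dots,x_n$ whose coefficients are Laurent polynomials in $y_1,\dots,y_n$ over $R$, $$\Omega^A=\sum_{v\in\mathbb{N}^n}\widehat K_v(\mathbf x)\,K_{v\omega}(\mathbf y),\qquad \Omega^{BC}=\sum_{v\in\mathbb{N}^n}\widehat K_v(\mathbf x)\,K^{BC}_{-v}(\mathbf y),$$ and, after specializing $x_n$ to $0$ on both sides, $$\Omega^{D}\big|_{x_n=0}=\sum_{v\in\mathbb{N}^n,\ v_n=0}\widehat K_v(\mathbf x)\big|_{x_n=0}\,K^{D}_{-v}(\mathbf y).$$ In each sum, a given monomial in $\mathbf x$ occurs in only finitely many of the terms. -/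

import Mathlib

open scoped AddMonoidAlgebra

noncomputable section

namespace CauchyKernels

/-! ## Divided differences -/

/-- The exact quotient `a / b` in a commutative ring. It is used only where `b` is a non-zero-divisor
that divides `a`, so that the quotient exists and is unique. -/
def exactQuot {S : Type*} [CommRing S] (a b : S) : S :=
  open Classical in if h : ∃ g, g * b = a then h.choose else 0

section Poly

variable {R : Type*} [CommRing R] {n : ℕ}

/-- The action of the transposition of `i` and `j` on polynomials: it exchanges the indeterminates
`x_i` and `x_j`. -/
def swapPoly (i j : Fin n) (f : MvPolynomial (Fin n) R) : MvPolynomial (Fin n) R :=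
  MvPolynomial.rename (Equiv.swap i j) f

/-- The isobaric divided difference `f ↦ (x_i f - x_j f^s) / (x_i - x_j)`, where `s` exchanges `x_i` and
`x_j`. It is used with `j = i + 1`. -/
def piPoly (i j : Fin n) (f : MvPolynomial (Fin n) R) : MvPolynomial (Fin n) R :=
  exactQuot (MvPolynomial.X i * f - MvPolynomial.X j * swapPoly i j f)
    (MvPolynomial.X i - MvPolynomial.X j)

/-- The second family of isobaric divided differences, `π̂ = π - 1`. -/
def piHatPoly (i j : Fin n) (f : MvPolynomial (Fin n) R) : MvPolynomial (Fin n) R :=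
  piPoly i j f - f

end Poly

/-- Laurent polynomials in `n` indeterminates over `R`: the group algebra of `ℤ^n`. -/
abbrev Laurent (R : Type*) [CommRing R] (n : ℕ) : Type _ := R[Fin n → ℤ]

section LaurentOps

variable {R : Type*} [CommRing R] {n : ℕ}

/-- The Laurent monomial `x^v`. -/
def mono (v : Fin n → ℤ) : Laurent R n := AddMonoidAlgebra.single v 1

/-- The indeterminate `x_i`. -/
def var (i : Fin n) : Laurent R n := mono (Pi.single i 1)

/-- The inverse `x_i⁻¹` of the indeterminate `x_i`. -/
def varInv (i : Fin n) : Laurent R n := mono (Pi.single i (-1))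

/-- The vector `v s`, with `s` the transposition of the components `i` and `j`. -/
def vecSwap {A : Type*} (i j : Fin n) (v : Fin n → A) : Fin n → A := fun k => v (Equiv.swap i j k)

/-- The vector `v` with the sign of the component `i` changed. -/
def vecNeg (i : Fin n) (v : Fin n → ℤ) : Fin n → ℤ := fun k => if k = i then -v i else v k

/-- The vector `v τ`: the components `v_i, v_j` are replaced by `-v_j, -v_i`. -/
def vecTau (i j : Fin n) (v : Fin n → ℤ) : Fin n → ℤ :=
  fun k => if k = i then -v j else if k = j then -v i else v k

/-- The linear extension to Laurent polynomials of a map on exponents. -/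
def act (s : (Fin n → ℤ) → (Fin n → ℤ)) (f : Laurent R n) : Laurent R n :=
  AddMonoidAlgebra.mapDomain s f

/-- The operator `f ↦ (x_i f - x_j f^s) / (x_i - x_j)` on Laurent polynomials, used with `j = i + 1`. -/
def piA (i j : Fin n) (f : Laurent R n) : Laurent R n :=
  exactQuot (var i * f - var j * act (vecSwap i j) f) (var i - var j)

/-- The operator `f ↦ ((x_i + β) f - (x_i⁻¹ + β) f^s) / (x_i - x_i⁻¹)`, where `s` inverts `x_i`. It is
used for the last index `i = n`. -/
def piBC (β : R) (i : Fin n) (f : Laurent R n) : Laurent R n :=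
  exactQuot
    ((var i + algebraMap R (Laurent R n) β) * f
      - (varInv i + algebraMap R (Laurent R n) β) * act (vecNeg i) f)
    (var i - varInv i)

/-- The operator `f ↦ (f - x_i⁻¹ x_j⁻¹ f^τ) / (1 - x_i⁻¹ x_j⁻¹)`, where `τ` sends `x_i` to `x_j⁻¹` and
`x_j` to `x_i⁻¹`. It is used for the last two indices `i = n - 1`, `j = n`. -/
def piD (i j : Fin n) (f : Laurent R n) : Laurent R n :=
  exactQuot (f - varInv i * varInv j * act (vecTau i j) f) (1 - varInv i * varInv j)

end LaurentOps

/-! ## Key polynomials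

Each family starts with the dominant monomials `x^λ`, with `λ` a partition (a weakly decreasing vector of
natural numbers), and is generated from them by divided differences. -/

section Keys

variable {R : Type*} [CommRing R] {n : ℕ}

/-- `IsKeyPoly d v f`: the polynomial `f` is obtained at the vector `v ∈ ℕ^n`, starting from a dominant
monomial, by the recursion `K_v d_i = K_{v s_i}` when `v_i > v_{i+1}`. -/
inductive IsKeyPoly (d : Fin n → Fin n → MvPolynomial (Fin n) R → MvPolynomial (Fin n) R) :
    (Fin n → ℕ) → MvPolynomial (Fin n) R → Prop
  | dominant (l : Fin n → ℕ) (hl : Antitone l) :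
      IsKeyPoly d l (∏ i, MvPolynomial.X i ^ l i)
  | step (v : Fin n → ℕ) (f : MvPolynomial (Fin n) R) (i j : Fin n) (hij : (i : ℕ) + 1 = j)
      (hv : v j < v i) (hf : IsKeyPoly d v f) : IsKeyPoly d (vecSwap i j v) (d i j f)

/-- The recursion of type `BC` on vectors of `ℤ^n`: `K_v π_i = K_{v s_i}` when `i < n` and
`v_i > v_{i+1}`, and `K_v π_n^{BC} = K_{v s_n}` when `v_n > 0`. -/
inductive IsKeyBC (β : R) : (Fin n → ℤ) → Laurent R n → Prop
  | dominant (l : Fin n → ℕ) (hl : Antitone l) : IsKeyBC β (fun i => (l i : ℤ)) (mono fun i => (l i : ℤ))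
  | step (v : Fin n → ℤ) (f : Laurent R n) (i j : Fin n) (hij : (i : ℕ) + 1 = j)
      (hv : v j < v i) (hf : IsKeyBC β v f) : IsKeyBC β (vecSwap i j v) (piA i j f)
  | last (v : Fin n → ℤ) (f : Laurent R n) (i : Fin n) (hi : (i : ℕ) + 1 = n)
      (hv : 0 < v i) (hf : IsKeyBC β v f) : IsKeyBC β (vecNeg i v) (piBC β i f)

/-- The recursion of type `D` on vectors of `ℤ^n`: `K_v π_i = K_{v s_i}` when `i < n` and
`v_i > v_{i+1}`, and `K_v π_n^D = K_{v τ_n}` when `τ_n` increases the length of `v`, that is, when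
`v_{n-1} + v_n > 0`. -/
inductive IsKeyD : (Fin n → ℤ) → Laurent R n → Prop
  | dominant (l : Fin n → ℕ) (hl : Antitone l) : IsKeyD (fun i => (l i : ℤ)) (mono fun i => (l i : ℤ))
  | step (v : Fin n → ℤ) (f : Laurent R n) (i j : Fin n) (hij : (i : ℕ) + 1 = j)
      (hv : v j < v i) (hf : IsKeyD v f) : IsKeyD (vecSwap i j v) (piA i j f)
  | last (v : Fin n → ℤ) (f : Laurent R n) (i j : Fin n) (hij : (i : ℕ) + 1 = j) (hj : (j : ℕ) + 1 = n)
      (hv : 0 < v i + v j) (hf : IsKeyD v f) : IsKeyD (vecTau i j v) (piD i j f)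

/-- The unique element with the property `P` (and `0` if there is no such element, or more than one). -/
def theUnique {S : Type*} [Zero S] (P : S → Prop) : S :=
  open Classical in if h : ∃! f, P f then h.choose else 0

/-- The key polynomial `K_v`, for `v ∈ ℕ^n`. -/
def key (R : Type*) [CommRing R] {n : ℕ} (v : Fin n → ℕ) : MvPolynomial (Fin n) R :=
  theUnique (IsKeyPoly piPoly v)

/-- The key polynomial `K̂_v`, for `v ∈ ℕ^n`. -/
def keyHat (R : Type*) [CommRing R] {n : ℕ} (v : Fin n → ℕ) : MvPolynomial (Fin n) R :=
  theUnique (IsKeyPoly piHatPoly v)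

/-- The key polynomial `K_v^{BC}`, for `v ∈ ℤ^n`. -/
def keyBC (β : R) (v : Fin n → ℤ) : Laurent R n := theUnique (IsKeyBC β v)

/-- The key polynomial `K_v^D`, for a vector `v ∈ ℤ^n` in the orbit of a partition under the group of
type `D_n`. -/
def keyD (R : Type*) [CommRing R] {n : ℕ} (v : Fin n → ℤ) : Laurent R n := theUnique (IsKeyD v)

end Keys

/-! ## Kernels

The kernels are the given rational functions, evaluated at elements `x_i`, `y_i` and `y'_i = y_i⁻¹` of a
commutative ring in which the denominators are invertible. -/

section Kernels

variable {S : Type*} [CommRing S] {n : ℕ}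

/-- `Ω^A = ∏_{i+j ≤ n+1} (1 - x_i y_j)⁻¹`; the indices in `Fin n` start from `0`. -/
def omegaA (x y : Fin n → S) : S :=
  Ring.inverse (∏ p : Fin n × Fin n with (p.1 : ℕ) + 1 + ((p.2 : ℕ) + 1) ≤ n + 1, (1 - x p.1 * y p.2))

/-- The common denominator `∏_i ∏_j (1 - x_i y_j) ∏_{i ≤ j} (1 - x_i / y_j)` of the other kernels. -/
def omegaDen (x y y' : Fin n → S) : S :=
  (∏ i, ∏ j, (1 - x i * y j)) * ∏ p : Fin n × Fin n with p.1 ≤ p.2, (1 - x p.1 * y' p.2)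

/-- The kernel `Ω^{BC}`. -/
def omegaBC (β : S) (x y y' : Fin n → S) : S :=
  (∏ p : Fin n × Fin n with p.1 < p.2, (1 - x p.1 * x p.2)) * (∏ i, (1 + β * x i))
    * Ring.inverse (omegaDen x y y')

/-- The kernel `Ω^D`. -/
def omegaD (x y y' : Fin n → S) : S :=
  (∏ p : Fin n × Fin n with p.1 ≤ p.2, (1 - x p.1 * x p.2)) * Ring.inverse (omegaDen x y y')

end Kernels

/-! ## Formal expansions -/

section Series

/-- The ring in which the identities hold: formal power series in `x_1, …, x_n` whose coefficients are
Laurent polynomials in `y_1, …, y_n` over `R`. -/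
abbrev Series (R : Type*) [CommRing R] (n : ℕ) : Type _ := MvPowerSeries (Fin n) (Laurent R n)

variable (R : Type*) [CommRing R] (n : ℕ)

/-- The indeterminates `x_i`. -/
def xs : Fin n → Series R n := fun i => MvPowerSeries.X i

/-- The indeterminates `x_i`, with the last one, `x_n`, specialized to `0`. -/
def xsZero : Fin n → Series R n := fun i => if (i : ℕ) + 1 = n then 0 else MvPowerSeries.X i

/-- A Laurent polynomial in `y`, as a constant series in `x`. -/
def inY {R : Type*} [CommRing R] {n : ℕ} (f : Laurent R n) : Series R n := MvPowerSeries.C f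

/-- The indeterminates `y_i`. -/
def ys : Fin n → Series R n := fun i => inY (var i)

/-- The inverses `y_i⁻¹` of the indeterminates `y_i`. -/
def ysInv : Fin n → Series R n := fun i => inY (varInv i)

/-- `s` is the sum of the family `a` of formal power series: for each monomial, only finitely many
members of the family have a non-zero coefficient, and these coefficients add up to the one of `s`. -/
def IsFormalSum {σ A ι : Type*} [CommRing A] (a : ι → MvPowerSeries σ A) (s : MvPowerSeries σ A) : Prop :=
  ∀ e : σ →₀ ℕ, {v | MvPowerSeries.coeff e (a v) ≠ 0}.Finite ∧
    MvPowerSeries.coeff e s = ∑ᶠ v, MvPowerSeries.coeff e (a v)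

end Series

end CauchyKernels

end

/-!
The expansions rest on a duality. For the bilinear form `CT (f g ∏_{i<j} (1 - x_i / x_j))`, where `CT` is
the constant term, the operators `π_i` are self-adjoint (`ctForm_piA`), and the polynomials `K̂_u` are dual
to the polynomials `K_{-v}`, the latter obtained from the monomials at weakly decreasing integer vectors
by the recursion of type `A` (`ctForm_isKeyPoly`). The duality comes from a comparison of norms: the
exponents of `K_w` are not longer than `w`, those of the same length are rearrangements of `w`, and `w`
is the only increasing one that can occur among them. Hence every power series `Ω(x)`, with coefficients
in any `R`-algebra, is the formal sum of the products of `K̂_v(x)` and the pairing of `Ω` with `K_{-v}`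
(`isFormalSum_keyHat`), and it remains to compute these pairings for the three kernels.

Pairing with `Ω^A` substitutes `y_{n+1-i}` for `x_i⁻¹` (`pairing_kernelA`): the variables `x_j` are
eliminated one by one, each by a residue computation with a geometric series. This turns `K_{-v}(x)` into
`K_{vω}(y)`.

For the other kernels, the pairings are shown to satisfy the recursions of `K^{BC}_{-v}(y)` and
`K^D_{-v}(y)`. If `v` is weakly increasing, then `K_{-v}` is a monomial and its pairing with `Ω^A` is the
monomial `y^λ`, with `λ` the reverse of `v`. A chain of operators in `y` leads from `λ` to `-v` by moving
each component to the last position, changing its sign there, and leaving it behind the others. The same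
chain leads from `Ω^A` to the kernel in question: each operator acts on one or two factors of the
product, with the effect of adding the factors for a further pair of indices (`pairing_kern_step`,
`pairing_kern_step_BC`, `pairing_kern_step_D`, `key_stage`). The other vectors `v` are reached from these
by the operators `π_i`; the kernel is symmetric enough for `π_i` in `x` and `π_i` in `y` to agree on it
(`pairing_kern_piA`), and the former can be moved to the other argument of the pairing.

The recursions have to be shown consistent as well, because the key polynomials are defined as the unique
solutions. For types `A`, `BC` and `D` this is confluence of the steps, by the braid relations
(`existsUnique_keyRel`, `diamond_stepBC`, `diamond_stepD`), and for the polynomials `K̂_v` it follows from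
the duality (`isKeyPoly_piHatPoly_unique`).
-/

noncomputable section

namespace CauchyKernels

/-! ### Laurent polynomials and exact quotients -/

section ExactQuot

variable {S : Type*} [CommRing S]

theorem exactQuot_mul {a b : S} (h : b ∣ a) : exactQuot a b * b = a := by
  have hex : ∃ g, g * b = a := by
    obtain ⟨c, rfl⟩ := h
    exact ⟨c, mul_comm _ _⟩
  unfold exactQuot
  rw [dif_pos hex]
  exact hex.choose_spec

end ExactQuot

section LaurentBasics

variable {R : Type*} [CommRing R] {n : ℕ}

theorem mono_mul (u v : Fin n → ℤ) : (mono u : Laurent R n) * mono v = mono (u + v) := by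
  simp [mono, AddMonoidAlgebra.single_mul_single]

theorem mono_zero : (mono 0 : Laurent R n) = 1 := rfl

theorem single_eq_smul_mono (v : Fin n → ℤ) (r : R) :
    (AddMonoidAlgebra.single v r : Laurent R n) = r • mono v := by
  simp [mono]

theorem mono_neg_mul (v : Fin n → ℤ) : (mono (-v) : Laurent R n) * mono v = 1 := by
  rw [mono_mul, neg_add_cancel, mono_zero]

theorem mono_pow (v : Fin n → ℤ) (k : ℕ) : (mono v : Laurent R n) ^ k = mono (k • v) := by
  simp [mono, AddMonoidAlgebra.single_pow]

theorem isUnit_mono (v : Fin n → ℤ) : IsUnit (mono v : Laurent R n) :=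
  IsUnit.of_mul_eq_one (mono (-v)) (by rw [mul_comm, mono_neg_mul])

theorem coeff_mono (v w : Fin n → ℤ) [Decidable (v = w)] :
    (mono v : Laurent R n).coeff w = if v = w then 1 else 0 := by
  unfold mono
  rw [AddMonoidAlgebra.coeff_single, Finsupp.single_apply]

theorem coeff_mono_mul (v w : Fin n → ℤ) (f : Laurent R n) :
    (mono v * f).coeff w = f.coeff (w - v) := by
  unfold mono
  rw [AddMonoidAlgebra.coeff_single_mul_apply, one_mul, neg_add_eq_sub]

theorem laurent_ext {f g : Laurent R n} (h : ∀ v, f.coeff v = g.coeff v) : f = g :=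
  AddMonoidAlgebra.coeff_injective (Finsupp.ext h)

/-- A Laurent polynomial has only finitely many exponents on a line `w + ℤ u`. -/
theorem exists_coeff_add_smul_eq_zero (f : Laurent R n) (w : Fin n → ℤ) {u : Fin n → ℤ}
    (hu : u ≠ 0) : ∃ k : ℕ, f.coeff (w + (k : ℤ) • u) = 0 := by
  by_contra! h
  have hinj : Function.Injective fun k : ℕ => w + (k : ℤ) • u := by
    intro a b hab
    obtain ⟨i, hi⟩ := Function.ne_iff.1 hu
    have := congrFun hab i
    simp only [Pi.add_apply, Pi.smul_apply, smul_eq_mul, add_right_inj] at this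
    exact_mod_cast mul_right_cancel₀ hi this
  exact Set.infinite_of_injective_forall_mem (s := (f.coeff.support : Set (Fin n → ℤ))) hinj
    (fun k => by simpa using h k) (Finset.finite_toSet _)

theorem isRegular_one_sub_mono {u : Fin n → ℤ} (hu : u ≠ 0) :
    IsRegular (1 - mono u : Laurent R n) := by
  rw [← isLeftRegular_iff_isRegular, isLeftRegular_iff_right_eq_zero_of_mul]
  intro f hf
  have hf' : f = mono u * f := by linear_combination hf
  have hstep : ∀ w, f.coeff (w + u) = f.coeff w := by
    intro w
    conv_lhs => rw [hf', coeff_mono_mul, add_sub_cancel_right]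
  refine laurent_ext fun w => ?_
  obtain ⟨k, hk⟩ := exists_coeff_add_smul_eq_zero f w hu
  have : ∀ k : ℕ, f.coeff (w + (k : ℤ) • u) = f.coeff w := by
    intro k
    induction k with
    | zero => simp
    | succ k ih => rw [← ih, ← hstep (w + (k : ℤ) • u), add_assoc, Nat.cast_succ, add_smul, one_smul]
  rw [← this k, hk]
  simp

theorem one_sub_mono_dvd (u v : Fin n → ℤ) (k : ℤ) :
    (1 - mono u : Laurent R n) ∣ mono v - mono (v + k • u) := by
  have key : ∀ (v : Fin n → ℤ) (k : ℕ), (1 - mono u : Laurent R n) ∣ mono v - mono (v + (k : ℤ) • u) := by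
    intro v k
    have h1 : (mono v - mono (v + (k : ℤ) • u) : Laurent R n) = mono v * (1 - mono u ^ k) := by
      rw [mono_pow, mul_sub, mul_one, mono_mul, natCast_zsmul]
    rw [h1]
    exact Dvd.dvd.mul_left (one_sub_dvd_one_sub_pow _ _) _
  obtain ⟨m, rfl | rfl⟩ := k.eq_nat_or_neg
  · exact key v m
  · have := key (v + (-(m : ℤ)) • u) m
    rw [add_assoc, ← add_smul, neg_add_cancel, zero_smul, add_zero] at this
    simpa using this.neg_right

/-- Linear extension of an additive map on exponents, as an algebra homomorphism. -/
def actHom (s : (Fin n → ℤ) →+ (Fin n → ℤ)) : Laurent R n →ₐ[R] Laurent R n :=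
  AddMonoidAlgebra.mapDomainAlgHom R R s

theorem actHom_mono (s : (Fin n → ℤ) →+ (Fin n → ℤ)) (v : Fin n → ℤ) :
    actHom s (mono v : Laurent R n) = mono (s v) := by
  simp [actHom, mono]

theorem actHom_actHom (s t : (Fin n → ℤ) →+ (Fin n → ℤ)) (f : Laurent R n) :
    actHom s (actHom t f) = actHom (s.comp t) f := by
  have h : (actHom s).comp (actHom t) = (actHom (s.comp t) : Laurent R n →ₐ[R] Laurent R n) := by
    unfold actHom
    rw [AddMonoidAlgebra.mapDomainAlgHom_comp]
  exact DFunLike.congr_fun h f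

theorem actHom_eq_self (s : (Fin n → ℤ) →+ (Fin n → ℤ)) (h : ∀ v, s v = v) (f : Laurent R n) :
    actHom s f = f := by
  induction f using AddMonoidAlgebra.induction_linear with
  | zero => simp
  | add f g hf hg => simp [hf, hg]
  | single v r => rw [single_eq_smul_mono, map_smul, actHom_mono, h]

/-- The exchange of two components, as an additive map. -/
def swapHom (i j : Fin n) : (Fin n → ℤ) →+ (Fin n → ℤ) where
  toFun := vecSwap i j
  map_zero' := rfl
  map_add' _ _ := rfl

/-- The change of the sign of one component, as an additive map. -/
def negHom (i : Fin n) : (Fin n → ℤ) →+ (Fin n → ℤ) where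
  toFun := vecNeg i
  map_zero' := by ext k; simp [vecNeg]
  map_add' u v := by
    ext k
    by_cases h : k = i
    · simp [vecNeg, h]; ring
    · simp [vecNeg, h]

/-- The map replacing two components by the opposites of each other, as an additive map. -/
def tauHom (i j : Fin n) : (Fin n → ℤ) →+ (Fin n → ℤ) where
  toFun := vecTau i j
  map_zero' := by ext k; simp [vecTau]
  map_add' u v := by
    ext k
    by_cases h : k = i
    · simp [vecTau, h]; ring
    · by_cases h' : k = j
      · subst h'; simp [vecTau, h]; ring
      · simp [vecTau, h, h']

@[simp] theorem swapHom_apply (i j : Fin n) (v : Fin n → ℤ) : swapHom i j v = vecSwap i j v := rfl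
@[simp] theorem negHom_apply (i : Fin n) (v : Fin n → ℤ) : negHom i v = vecNeg i v := rfl
@[simp] theorem tauHom_apply (i j : Fin n) (v : Fin n → ℤ) : tauHom i j v = vecTau i j v := rfl

theorem act_vecSwap (i j : Fin n) (f : Laurent R n) : act (vecSwap i j) f = actHom (swapHom i j) f :=
  rfl
theorem act_vecNeg (i : Fin n) (f : Laurent R n) : act (vecNeg i) f = actHom (negHom i) f := rfl
theorem act_vecTau (i j : Fin n) (f : Laurent R n) : act (vecTau i j) f = actHom (tauHom i j) f :=
  rfl

theorem vecSwap_left {A : Type*} (i j : Fin n) (v : Fin n → A) : vecSwap i j v i = v j := by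
  simp [vecSwap]
theorem vecSwap_right {A : Type*} (i j : Fin n) (v : Fin n → A) : vecSwap i j v j = v i := by
  simp [vecSwap]
theorem vecSwap_of_ne {A : Type*} {i j k : Fin n} (hi : k ≠ i) (hj : k ≠ j) (v : Fin n → A) :
    vecSwap i j v k = v k := by
  simp [vecSwap, Equiv.swap_apply_of_ne_of_ne hi hj]
theorem vecSwap_vecSwap {A : Type*} (i j : Fin n) (v : Fin n → A) :
    vecSwap i j (vecSwap i j v) = v := by
  ext k; simp [vecSwap]
theorem vecNeg_vecNeg (i : Fin n) (v : Fin n → ℤ) : vecNeg i (vecNeg i v) = v := by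
  ext k
  by_cases h : k = i <;> simp [vecNeg, h]
theorem vecTau_vecTau {i j : Fin n} (hij : i ≠ j) (v : Fin n → ℤ) :
    vecTau i j (vecTau i j v) = v := by
  ext k
  by_cases h : k = i
  · subst h; simp [vecTau, hij.symm]
  · by_cases h' : k = j
    · subst h'; simp [vecTau, h]
    · simp [vecTau, h, h']

/-- The root `x_j / x_i` of the transposition of `i` and `j`. -/
def rootA (i j : Fin n) : Fin n → ℤ := Pi.single j 1 - Pi.single i 1

/-- The root `x_i⁻¹ x_j⁻¹`. -/
def rootD (i j : Fin n) : Fin n → ℤ := Pi.single i (-1) + Pi.single j (-1)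

theorem rootA_ne_zero {i j : Fin n} (h : i ≠ j) : rootA i j ≠ 0 := by
  intro h0
  have := congrFun h0 i
  simp [rootA, h] at this

theorem rootD_ne_zero {i j : Fin n} (h : i ≠ j) : rootD i j ≠ 0 := by
  intro h0
  have := congrFun h0 i
  simp [rootD, h] at this

theorem single_neg_one_add_self_ne_zero (i : Fin n) :
    (Pi.single i (-1) + Pi.single i (-1) : Fin n → ℤ) ≠ 0 := by
  intro h0
  have := congrFun h0 i
  simp at this

theorem vecSwap_eq_add {i j : Fin n} (hij : i ≠ j) (v : Fin n → ℤ) :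
    vecSwap i j v = v + (v i - v j) • rootA i j := by
  ext k
  by_cases h : k = i
  · subst h; simp [vecSwap, rootA, hij]
  · by_cases h' : k = j
    · subst h'; simp [vecSwap, rootA, h]
    · simp [vecSwap_of_ne h h', rootA, h, h']

theorem vecNeg_eq_add (i : Fin n) (v : Fin n → ℤ) :
    vecNeg i v = v + v i • (Pi.single i (-1) + Pi.single i (-1)) := by
  ext k
  by_cases h : k = i
  · subst h; simp [vecNeg]
  · simp [vecNeg, h]

theorem vecTau_eq_add {i j : Fin n} (hij : i ≠ j) (v : Fin n → ℤ) :
    vecTau i j v = v + (v i + v j) • rootD i j := by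
  ext k
  by_cases h : k = i
  · subst h; simp [vecTau, rootD, hij]
  · by_cases h' : k = j
    · subst h'; simp [vecTau, rootD, h]
    · simp [vecTau, rootD, h, h']

theorem var_mul_mono_rootA (i j : Fin n) : (var i : Laurent R n) * mono (rootA i j) = var j := by
  unfold var rootA
  rw [mono_mul]; congr 1; abel

theorem var_mul_varInv (i : Fin n) : (var i : Laurent R n) * varInv i = 1 := by
  unfold var varInv
  rw [mono_mul, ← Pi.single_add, add_neg_cancel, Pi.single_zero, mono_zero]

theorem varInv_mul_varInv (i j : Fin n) : (varInv i : Laurent R n) * varInv j = mono (rootD i j) := by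
  unfold varInv rootD
  rw [mono_mul]

theorem varInv_mul_self (i : Fin n) : (varInv i : Laurent R n) * varInv i =
    mono (Pi.single i (-1) + Pi.single i (-1)) := by
  unfold varInv
  rw [mono_mul]

/-- Divisibility of a linear expression in `f` can be checked on monomials. -/
theorem dvd_of_mono {d : Laurent R n} (T : Laurent R n →ₗ[R] Laurent R n)
    (h : ∀ v, d ∣ T (mono v)) (f : Laurent R n) : d ∣ T f := by
  induction f using AddMonoidAlgebra.induction_linear with
  | zero => simp
  | add f g hf hg => rw [map_add]; exact dvd_add hf hg
  | single v r =>
    rw [single_eq_smul_mono, map_smul]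
    exact (h v).trans (Dvd.intro_left (algebraMap R _ r) (Algebra.smul_def r _).symm)

end LaurentBasics

/-! ### Braid relations for divided differences -/

section Braid

variable {S : Type*} [CommRing S]

/-- Two operators of the form `f ↦ (p f - q f^σ) / d` commute if the reflections commute and each fixes
the elements `p`, `q`, `d` of the other operator. -/
theorem divDiff_comm (σ σ' : S →+* S) (A B : S → S) {p q d p' q' d' : S} (hd : IsRegular d)
    (hd' : IsRegular d') (hA : ∀ f, d * A f = p * f - q * σ f)
    (hB : ∀ f, d' * B f = p' * f - q' * σ' f) (hp : σ' p = p) (hq : σ' q = q) (hdσ : σ' d = d)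
    (hp' : σ p' = p') (hq' : σ q' = q') (hdσ' : σ d' = d') (hσ : ∀ f, σ (σ' f) = σ' (σ f)) (f : S) :
    A (B f) = B (A f) := by
  have h1 : d' * σ (B f) = p' * σ f - q' * σ (σ' f) := by
    have := congrArg σ (hB f)
    simpa [hp', hq', hdσ'] using this
  have h2 : d * σ' (A f) = p * σ' f - q * σ (σ' f) := by
    have := congrArg σ' (hA f)
    simpa [hp, hq, hdσ, ← hσ] using this
  refine (hd.mul hd').left ?_
  dsimp only
  linear_combination d' * hA (B f) + p * hB f - q * h1 - d * hB (A f) - p' * hA f + q' * h2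

section LongElements

variable {σ τ : S →+* S} {A B : S → S} {t u : S}

/-- The isobaric divided difference of the longest element of type `A_2`, as an alternating sum. -/
theorem divDiff_three_formula (ht : IsRegular (1 - t))
    (hA : ∀ f, (1 - t) * A f = f - t * σ f) (hB : ∀ f, (1 - u) * B f = f - u * τ f)
    (hσσ : ∀ f, σ (σ f) = f) (hσt : t * σ t = 1) (hσu : σ u = t * u) (hτt : τ t = t * u) (f : S) :
    (1 - t) * (1 - u) * (1 - t * u) * A (B (A f)) =
      f - t * σ f - u * τ f + t * u ^ 2 * τ (σ f) + t ^ 2 * u * σ (τ f)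
        - t ^ 2 * u ^ 2 * σ (τ (σ f)) := by
  have e1 : (1 - t * u) * τ (A f) = τ f - t * u * τ (σ f) := by
    simpa [hτt] using congrArg τ (hA f)
  have e2 : (1 - t) * (1 - u) * (1 - t * u) * B (A f) =
      (1 - t * u) * (f - t * σ f) - u * (1 - t) * (τ f - t * u * τ (σ f)) := by
    linear_combination (1 - t) * (1 - t * u) * hB (A f) + (1 - t * u) * hA f - u * (1 - t) * e1
  have hs : σ t * (t * u) = u := by linear_combination u * hσt
  have e3 := congrArg σ e2
  simp only [map_mul, map_sub, map_one, hσu, hs, hσσ] at e3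
  have e4 : -((1 - t) * (1 - u) * (1 - t * u) * σ (B (A f))) =
      (1 - u) * (t * σ f - f) + t * u * (1 - t) * (σ (τ f) - u * σ (τ (σ f))) := by
    linear_combination t * e3 + ((1 - t * u) * (1 - u) * σ (B (A f)) - (1 - u) * f
      + t * u * (σ (τ f) - u * σ (τ (σ f)))) * hσt
  refine ht.left ?_
  dsimp only
  linear_combination (1 - t) * (1 - u) * (1 - t * u) * hA (B (A f)) + e2 + t * e4

theorem divDiff_three_braid (ht : IsRegular (1 - t)) (hu : IsRegular (1 - u))
    (htu : IsRegular (1 - t * u))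
    (hA : ∀ f, (1 - t) * A f = f - t * σ f) (hB : ∀ f, (1 - u) * B f = f - u * τ f)
    (hσσ : ∀ f, σ (σ f) = f) (hττ : ∀ f, τ (τ f) = f) (hbr : ∀ f, σ (τ (σ f)) = τ (σ (τ f)))
    (hσt : t * σ t = 1) (hσu : σ u = t * u) (hτt : τ t = t * u) (hτu : u * τ u = 1) (f : S) :
    A (B (A f)) = B (A (B f)) := by
  refine ((ht.mul hu).mul htu).left ?_
  dsimp only
  have h1 := divDiff_three_formula ht hA hB hσσ hσt hσu hτt f
  have h2 := divDiff_three_formula hu hB hA hττ hτu (hτt.trans (mul_comm _ _))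
    (hσu.trans (mul_comm _ _)) f
  rw [← hbr] at h2
  linear_combination h1 - h2

variable {β : S}

/-- The isobaric divided difference of the longest element of type `B_2`, as an alternating sum, from
the factorization that starts with the short root. -/
theorem divDiff_four_formula (ht : IsRegular (1 - t)) (hu : IsRegular (1 - u ^ 2))
    (hA : ∀ f, (1 - t) * A f = f - t * σ f)
    (hB : ∀ f, (1 - u ^ 2) * B f = (1 + β * u) * f - (u ^ 2 + β * u) * τ f)
    (hσσ : ∀ f, σ (σ f) = f) (hττ : ∀ f, τ (τ f) = f)
    (hσβ : σ β = β) (hτβ : τ β = β)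
    (hσt : t * σ t = 1) (hσu : σ u = t * u) (hτt : τ t = t * u ^ 2) (hτu : u * τ u = 1) (f : S) :
    (1 - t) * (1 - u ^ 2) * (1 - (t * u) ^ 2) * (1 - t * u ^ 2) * A (B (A (B f))) =
      (1 + β * u) * (1 + β * (t * u)) * (f - t * σ f)
      - (u ^ 2 + β * u) * (1 + β * (t * u)) * (τ f - t * u ^ 2 * τ (σ f))
      + t * ((t * u) ^ 2 + β * (t * u)) * (1 + β * u) * (σ (τ f) - t * u ^ 2 * σ (τ (σ f)))
      - (u ^ 2 + β * u) * ((t * u) ^ 2 + β * (t * u)) * (t * u ^ 2) *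
        (τ (σ (τ f)) - t * σ (τ (σ (τ f)))) := by
  have s1 := congrArg σ (hB f)
  simp only [map_mul, map_sub, map_add, map_pow, map_one, hσu, hσβ] at s1
  have a2 : (1 - t) * (1 - u ^ 2) * (1 - (t * u) ^ 2) * A (B f) =
      (1 - (t * u) ^ 2) * ((1 + β * u) * f - (u ^ 2 + β * u) * τ f)
      - t * (1 - u ^ 2) * ((1 + β * (t * u)) * σ f - ((t * u) ^ 2 + β * (t * u)) * σ (τ f)) := by
    linear_combination (1 - u ^ 2) * (1 - (t * u) ^ 2) * hA (B f) + (1 - (t * u) ^ 2) * hB f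
      - t * (1 - u ^ 2) * s1
  have hv : t * u ^ 2 * τ u = t * u := by linear_combination t * u * hτu
  have s2 := congrArg τ a2
  simp only [map_mul, map_sub, map_add, map_pow, map_one, hτt, hτβ, hv, hττ] at s2
  have s2' : -((1 - t * u ^ 2) * (1 - u ^ 2) * (1 - (t * u) ^ 2) * τ (A (B f))) =
      (1 - (t * u) ^ 2) * ((u ^ 2 + β * u) * τ f - (1 + β * u) * f)
      + t * u ^ 2 * (1 - u ^ 2) *
        ((1 + β * (t * u)) * τ (σ f) - ((t * u) ^ 2 + β * (t * u)) * τ (σ (τ f))) := by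
    linear_combination u ^ 2 * s2 + ((1 - t * u ^ 2) * (1 - (t * u) ^ 2) * τ (A (B f)) * (u * τ u + 1)
      - ((1 - (t * u) ^ 2) * (-(β * u * τ f) + ((u * τ u + 1) + β * u) * f)
        - t * u ^ 2 * (u * τ u + 1) *
          ((1 + β * (t * u)) * τ (σ f) - ((t * u) ^ 2 + β * (t * u)) * τ (σ (τ f))))) * hτu
  have a3 : (1 - t) * (1 - u ^ 2) * (1 - (t * u) ^ 2) * (1 - t * u ^ 2) * B (A (B f)) =
      (1 + β * (t * u)) * (1 - (t * u) ^ 2) * ((1 + β * u) * f - (u ^ 2 + β * u) * τ f)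
      - (1 + β * u) * (1 - t * u ^ 2) * t *
        ((1 + β * (t * u)) * σ f - ((t * u) ^ 2 + β * (t * u)) * σ (τ f))
      + (u ^ 2 + β * u) * (1 - t) * (t * u ^ 2) *
        ((1 + β * (t * u)) * τ (σ f) - ((t * u) ^ 2 + β * (t * u)) * τ (σ (τ f))) := by
    refine hu.left ?_
    dsimp only
    linear_combination (1 - t) * (1 - u ^ 2) * (1 - (t * u) ^ 2) * (1 - t * u ^ 2) * hB (A (B f))
      + (1 + β * u) * (1 - t * u ^ 2) * a2 + (u ^ 2 + β * u) * (1 - t) * s2'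
  have hs1 : σ t * (t * u) = u := by linear_combination u * hσt
  have hs2 : σ t * (t * u) ^ 2 = t * u ^ 2 := by linear_combination t * u ^ 2 * hσt
  have s3 := congrArg σ a3
  simp only [map_mul, map_sub, map_add, map_pow, map_one, hσu, hσβ, hs1, hs2, hσσ] at s3
  have s3' : -((1 - t) * (1 - u ^ 2) * (1 - (t * u) ^ 2) * (1 - t * u ^ 2) * σ (B (A (B f)))) =
      (1 + β * u) * (1 - u ^ 2) * t *
        ((1 + β * (t * u)) * σ f - ((t * u) ^ 2 + β * (t * u)) * σ (τ f))
      - (1 + β * (t * u)) * (1 - t * u ^ 2) * ((1 + β * u) * f - (u ^ 2 + β * u) * τ f)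
      - ((t * u) ^ 2 + β * (t * u)) * (1 - t) * (t * u ^ 2) *
        ((1 + β * u) * σ (τ (σ f)) - (u ^ 2 + β * u) * σ (τ (σ (τ f)))) := by
    linear_combination t * s3 + ((1 - u ^ 2) * (1 - (t * u) ^ 2) * (1 - t * u ^ 2) * σ (B (A (B f)))
      - (1 + β * (t * u)) * (1 - t * u ^ 2) * ((1 + β * u) * f - (u ^ 2 + β * u) * τ f)
      - ((t * u) ^ 2 + β * (t * u)) * (t * u ^ 2) *
        ((1 + β * u) * σ (τ (σ f)) - (u ^ 2 + β * u) * σ (τ (σ (τ f))))) * hσt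
  refine ht.left ?_
  dsimp only
  linear_combination (1 - t) * (1 - u ^ 2) * (1 - (t * u) ^ 2) * (1 - t * u ^ 2) * hA (B (A (B f)))
    + a3 + t * s3'

/-- The same alternating sum, from the factorization that starts with the long root. -/
theorem divDiff_four_formula' (ht : IsRegular (1 - t)) (hu : IsRegular (1 - u ^ 2))
    (hA : ∀ f, (1 - t) * A f = f - t * σ f)
    (hB : ∀ f, (1 - u ^ 2) * B f = (1 + β * u) * f - (u ^ 2 + β * u) * τ f)
    (hσσ : ∀ f, σ (σ f) = f) (hττ : ∀ f, τ (τ f) = f)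
    (hσβ : σ β = β) (hτβ : τ β = β)
    (hσt : t * σ t = 1) (hσu : σ u = t * u) (hτt : τ t = t * u ^ 2) (hτu : u * τ u = 1) (f : S) :
    (1 - t) * (1 - u ^ 2) * (1 - (t * u) ^ 2) * (1 - t * u ^ 2) * B (A (B (A f))) =
      (1 + β * u) * (1 + β * (t * u)) * (f - t * σ f)
      - (u ^ 2 + β * u) * (1 + β * (t * u)) * (τ f - t * u ^ 2 * τ (σ f))
      + t * ((t * u) ^ 2 + β * (t * u)) * (1 + β * u) * (σ (τ f) - t * u ^ 2 * σ (τ (σ f)))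
      - (u ^ 2 + β * u) * ((t * u) ^ 2 + β * (t * u)) * (t * u ^ 2) *
        (τ (σ (τ f)) - t * τ (σ (τ (σ f)))) := by
  have s1 := congrArg τ (hA f)
  simp only [map_mul, map_sub, map_one, hτt] at s1
  have a2 : (1 - t) * (1 - u ^ 2) * (1 - t * u ^ 2) * B (A f) =
      (1 + β * u) * (1 - t * u ^ 2) * (f - t * σ f)
      - (u ^ 2 + β * u) * (1 - t) * (τ f - t * u ^ 2 * τ (σ f)) := by
    linear_combination (1 - t) * (1 - t * u ^ 2) * hB (A f)
      + (1 + β * u) * (1 - t * u ^ 2) * hA f - (u ^ 2 + β * u) * (1 - t) * s1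
  have hs2 : σ t * (t * u) ^ 2 = t * u ^ 2 := by linear_combination t * u ^ 2 * hσt
  have s2 := congrArg σ a2
  simp only [map_mul, map_sub, map_add, map_pow, map_one, hσu, hσβ, hs2, hσσ] at s2
  have s2' : -((1 - t) * (1 - (t * u) ^ 2) * (1 - t * u ^ 2) * σ (B (A f))) =
      (1 + β * (t * u)) * (1 - t * u ^ 2) * (t * σ f - f)
      + ((t * u) ^ 2 + β * (t * u)) * (1 - t) * (σ (τ f) - t * u ^ 2 * σ (τ (σ f))) := by
    linear_combination t * s2 + ((1 - (t * u) ^ 2) * (1 - t * u ^ 2) * σ (B (A f))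
      - (1 + β * (t * u)) * (1 - t * u ^ 2) * f
      + ((t * u) ^ 2 + β * (t * u)) * (σ (τ f) - t * u ^ 2 * σ (τ (σ f)))) * hσt
  have a3 : (1 - t) * (1 - u ^ 2) * (1 - (t * u) ^ 2) * (1 - t * u ^ 2) * A (B (A f)) =
      (1 - t * u ^ 2) * (1 + β * u + β * (t * u) + t * u ^ 2) * (f - t * σ f)
      - (1 - (t * u) ^ 2) * (u ^ 2 + β * u) * (τ f - t * u ^ 2 * τ (σ f))
      + t * (1 - u ^ 2) * ((t * u) ^ 2 + β * (t * u)) * (σ (τ f) - t * u ^ 2 * σ (τ (σ f))) := by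
    refine ht.left ?_
    dsimp only
    linear_combination (1 - t) * (1 - u ^ 2) * (1 - (t * u) ^ 2) * (1 - t * u ^ 2) * hA (B (A f))
      + (1 - (t * u) ^ 2) * a2 + t * (1 - u ^ 2) * s2'
  have hv : t * u ^ 2 * τ u = t * u := by linear_combination t * u * hτu
  have hv2 : t * u ^ 2 * τ u ^ 2 = t := by linear_combination (t * u * τ u + t) * hτu
  have s3 := congrArg τ a3
  simp only [map_mul, map_sub, map_add, map_pow, map_one, hτt, hτβ, hv, hv2, hττ] at s3
  have s3' : -((1 - t) * (1 - u ^ 2) * (1 - (t * u) ^ 2) * (1 - t * u ^ 2) * τ (A (B (A f)))) =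
      (1 - t) * (u ^ 2 + β * u + β * (t * u) * u ^ 2 + t * u ^ 2) * (τ f - t * u ^ 2 * τ (σ f))
      - (1 - (t * u) ^ 2) * (1 + β * u) * (f - t * σ f)
      - t * u ^ 2 * (1 - u ^ 2) * ((t * u) ^ 2 + β * (t * u)) *
        (τ (σ (τ f)) - t * τ (σ (τ (σ f)))) := by
    linear_combination u ^ 2 * s3 + ((1 - t) * (1 - (t * u) ^ 2) * (1 - t * u ^ 2) * τ (A (B (A f)))
        * (u * τ u + 1)
      + (1 - t) * (β * u) * (τ f - t * u ^ 2 * τ (σ f))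
      - (1 - (t * u) ^ 2) * (u * τ u + 1 + β * u) * (f - t * σ f)
      - t * u ^ 2 * (u * τ u + 1) * ((t * u) ^ 2 + β * (t * u)) *
        (τ (σ (τ f)) - t * τ (σ (τ (σ f))))) * hτu
  refine hu.left ?_
  dsimp only
  linear_combination (1 - t) * (1 - u ^ 2) * (1 - (t * u) ^ 2) * (1 - t * u ^ 2) * hB (A (B (A f)))
    + (1 + β * u) * a3 + (u ^ 2 + β * u) * s3'

theorem divDiff_four_braid (ht : IsRegular (1 - t)) (hu : IsRegular (1 - u ^ 2))
    (htu : IsRegular (1 - (t * u) ^ 2)) (htuu : IsRegular (1 - t * u ^ 2))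
    (hA : ∀ f, (1 - t) * A f = f - t * σ f)
    (hB : ∀ f, (1 - u ^ 2) * B f = (1 + β * u) * f - (u ^ 2 + β * u) * τ f)
    (hσσ : ∀ f, σ (σ f) = f) (hττ : ∀ f, τ (τ f) = f)
    (hbr : ∀ f, σ (τ (σ (τ f))) = τ (σ (τ (σ f)))) (hσβ : σ β = β) (hτβ : τ β = β)
    (hσt : t * σ t = 1) (hσu : σ u = t * u) (hτt : τ t = t * u ^ 2) (hτu : u * τ u = 1) (f : S) :
    A (B (A (B f))) = B (A (B (A f))) := by
  refine (((ht.mul hu).mul htu).mul htuu).left ?_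
  dsimp only
  rw [divDiff_four_formula ht hu hA hB hσσ hττ hσβ hτβ hσt hσu hτt hτu f,
    divDiff_four_formula' ht hu hA hB hσσ hττ hσβ hτβ hσt hσu hτt hτu f, hbr]

end LongElements

end Braid

/-! ### The divided differences of types `A`, `BC` and `D` -/

section Operators

variable {R : Type*} [CommRing R] {n : ℕ}

theorem piA_spec {i j : Fin n} (hij : i ≠ j) (f : Laurent R n) :
    (1 - mono (rootA i j)) * piA i j f = f - mono (rootA i j) * actHom (swapHom i j) f := by
  have hdvd : (1 - mono (rootA i j)) ∣ f - mono (rootA i j) * actHom (swapHom i j) f := by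
    refine dvd_of_mono (LinearMap.id - (LinearMap.mulLeft R (mono (rootA i j))) ∘ₗ
      (actHom (swapHom i j)).toLinearMap) (fun v => ?_) f
    simp only [LinearMap.sub_apply, LinearMap.id_apply, LinearMap.comp_apply,
      AlgHom.toLinearMap_apply, LinearMap.mulLeft_apply, actHom_mono, mono_mul, swapHom_apply]
    convert! one_sub_mono_dvd (R := R) (rootA i j) v (v i - v j + 1) using 3
    rw [vecSwap_eq_add hij, add_smul, one_smul]; abel
  have h1 : (var i - var j : Laurent R n) = var i * (1 - mono (rootA i j)) := by
    rw [mul_sub, mul_one, var_mul_mono_rootA]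
  have h2 : var i * f - var j * act (vecSwap i j) f =
      var i * (f - mono (rootA i j) * actHom (swapHom i j) f) := by
    rw [← var_mul_mono_rootA i j, act_vecSwap]; ring
  have h3 := exactQuot_mul (mul_dvd_mul_left (var i) hdvd)
  rw [← h1, ← h2, h1, h2] at h3
  have h4 : var i * ((1 - mono (rootA i j)) * piA i j f) =
      var i * (f - mono (rootA i j) * actHom (swapHom i j) f) := by
    rw [← h3, piA, h1, h2]; ring
  exact (isUnit_mono _).isRegular.left h4

theorem piA_eq {i j : Fin n} (hij : i ≠ j) {f g : Laurent R n}
    (h : (1 - mono (rootA i j)) * g = f - mono (rootA i j) * actHom (swapHom i j) f) :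
    piA i j f = g :=
  (isRegular_one_sub_mono (rootA_ne_zero hij)).left ((piA_spec hij f).trans h.symm)

theorem piA_eq' {i j : Fin n} (hij : i ≠ j) {f g : Laurent R n}
    (h : (var i - var j) * g = var i * f - var j * actHom (swapHom i j) f) :
    piA i j f = g := by
  refine piA_eq hij ((isUnit_mono (Pi.single i 1)).isRegular.left ?_)
  have := var_mul_mono_rootA (R := R) i j
  change var i * _ = var i * _
  linear_combination h + (actHom (swapHom i j) f - g) * this

theorem piBC_spec (β : R) (i : Fin n) (f : Laurent R n) :
    (1 - varInv i ^ 2) * piBC β i f = (1 + algebraMap R (Laurent R n) β * varInv i) * f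
      - (varInv i ^ 2 + algebraMap R (Laurent R n) β * varInv i) * actHom (negHom i) f := by
  have hdvd : (1 - varInv i ^ 2) ∣ (1 + algebraMap R (Laurent R n) β * varInv i) * f
      - (varInv i ^ 2 + algebraMap R (Laurent R n) β * varInv i) * actHom (negHom i) f := by
    refine dvd_of_mono (LinearMap.mulLeft R (1 + algebraMap R (Laurent R n) β * varInv i)
      - (LinearMap.mulLeft R (varInv i ^ 2 + algebraMap R (Laurent R n) β * varInv i)) ∘ₗ
      (actHom (negHom i)).toLinearMap) (fun v => ?_) f
    simp only [LinearMap.sub_apply, LinearMap.comp_apply,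
      AlgHom.toLinearMap_apply, LinearMap.mulLeft_apply, actHom_mono, negHom_apply]
    rw [sq, varInv_mul_self]
    have h1 := one_sub_mono_dvd (R := R) (Pi.single i (-1) + Pi.single i (-1)) v (v i + 1)
    have h2 := one_sub_mono_dvd (R := R) (Pi.single i (-1) + Pi.single i (-1))
      (Pi.single i (-1) + v) (v i)
    rw [add_smul, one_smul, ← add_assoc, ← vecNeg_eq_add, add_comm (vecNeg i v), ← mono_mul] at h1
    rw [add_assoc, ← vecNeg_eq_add, ← mono_mul, ← mono_mul] at h2
    have h3 := dvd_add h1 (h2.mul_left (algebraMap R (Laurent R n) β))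
    convert! h3 using 1
    · rw [mono_mul]
    · simp only [varInv, ← mono_mul]
      ring
  have h0 := var_mul_varInv (R := R) i
  have h1 : (var i - varInv i : Laurent R n) = var i * (1 - varInv i ^ 2) := by
    linear_combination varInv i * h0
  have h2 : (var i + algebraMap R (Laurent R n) β) * f
        - (varInv i + algebraMap R (Laurent R n) β) * act (vecNeg i) f =
      var i * ((1 + algebraMap R (Laurent R n) β * varInv i) * f
      - (varInv i ^ 2 + algebraMap R (Laurent R n) β * varInv i) * actHom (negHom i) f) := by
    rw [act_vecNeg]
    linear_combination (-(algebraMap R (Laurent R n) β) * f + (varInv i + algebraMap R _ β)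
      * actHom (negHom i) f) * h0
  have h3 := exactQuot_mul (mul_dvd_mul_left (var i) hdvd)
  have h4 : var i * ((1 - varInv i ^ 2) * piBC β i f) = var i *
      ((1 + algebraMap R (Laurent R n) β * varInv i) * f
      - (varInv i ^ 2 + algebraMap R (Laurent R n) β * varInv i) * actHom (negHom i) f) := by
    rw [← h3, piBC, h1, h2]; ring
  exact (isUnit_mono _).isRegular.left h4

theorem isRegular_one_sub_varInv_sq (i : Fin n) : IsRegular (1 - varInv i ^ 2 : Laurent R n) := by
  rw [sq, varInv_mul_self]
  exact isRegular_one_sub_mono (single_neg_one_add_self_ne_zero i)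

theorem piBC_eq' (β : R) {i : Fin n} {f g : Laurent R n}
    (h : (var i - varInv i) * g = (var i + algebraMap R (Laurent R n) β) * f
        - (varInv i + algebraMap R (Laurent R n) β) * actHom (negHom i) f) :
    piBC β i f = g := by
  refine (isRegular_one_sub_varInv_sq i).left ((piBC_spec β i f).trans ?_)
  refine (isUnit_mono (Pi.single i 1)).isRegular.left ?_
  have h0 := var_mul_varInv (R := R) i
  change var i * _ = var i * _
  linear_combination -h + (algebraMap R (Laurent R n) β * f + varInv i * g
    - (varInv i + algebraMap R _ β) * actHom (negHom i) f) * h0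

theorem piD_spec {i j : Fin n} (hij : i ≠ j) (f : Laurent R n) :
    (1 - mono (rootD i j)) * piD i j f = f - mono (rootD i j) * actHom (tauHom i j) f := by
  have hdvd : (1 - mono (rootD i j)) ∣ f - mono (rootD i j) * actHom (tauHom i j) f := by
    refine dvd_of_mono (LinearMap.id - (LinearMap.mulLeft R (mono (rootD i j))) ∘ₗ
      (actHom (tauHom i j)).toLinearMap) (fun v => ?_) f
    simp only [LinearMap.sub_apply, LinearMap.id_apply, LinearMap.comp_apply,
      AlgHom.toLinearMap_apply, LinearMap.mulLeft_apply, actHom_mono, mono_mul, tauHom_apply]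
    convert! one_sub_mono_dvd (R := R) (rootD i j) v (v i + v j + 1) using 3
    rw [vecTau_eq_add hij, add_smul _ (1 : ℤ), one_smul]; abel
  have h3 := exactQuot_mul hdvd
  rw [← h3, piD, varInv_mul_varInv, act_vecTau, mul_comm]

theorem piD_eq {i j : Fin n} (hij : i ≠ j) {f g : Laurent R n}
    (h : (1 - mono (rootD i j)) * g = f - mono (rootD i j) * actHom (tauHom i j) f) :
    piD i j f = g :=
  (isRegular_one_sub_mono (rootD_ne_zero hij)).left ((piD_spec hij f).trans h.symm)

theorem actHom_swap_swap (i j : Fin n) (f : Laurent R n) :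
    actHom (swapHom i j) (actHom (swapHom i j) f) = f := by
  rw [actHom_actHom]
  exact actHom_eq_self _ (fun v => vecSwap_vecSwap i j v) f

theorem actHom_neg_neg (i : Fin n) (f : Laurent R n) :
    actHom (negHom i) (actHom (negHom i) f) = f := by
  rw [actHom_actHom]
  exact actHom_eq_self _ (fun v => vecNeg_vecNeg i v) f

theorem actHom_tau_tau {i j : Fin n} (hij : i ≠ j) (f : Laurent R n) :
    actHom (tauHom i j) (actHom (tauHom i j) f) = f := by
  rw [actHom_actHom]
  exact actHom_eq_self _ (fun v => vecTau_vecTau hij v) f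

theorem actHom_congr {s t : (Fin n → ℤ) →+ (Fin n → ℤ)} (h : ∀ v, s v = t v) (f : Laurent R n) :
    actHom s f = actHom t f := by
  rw [DFunLike.ext s t h]

theorem actHom_mono_fixed {s : (Fin n → ℤ) →+ (Fin n → ℤ)} {v : Fin n → ℤ} (h : s v = v) :
    actHom s (mono v : Laurent R n) = mono v := by
  rw [actHom_mono, h]

theorem vecSwap_braid {i j k : Fin n} (hij : i ≠ j) (hjk : j ≠ k) (hik : i ≠ k) {A : Type*}
    (v : Fin n → A) :
    vecSwap i j (vecSwap j k (vecSwap i j v)) = vecSwap j k (vecSwap i j (vecSwap j k v)) := by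
  ext m
  simp only [vecSwap, Equiv.swap_apply_def]
  split_ifs <;> simp_all

theorem vecSwap_comm {i j k l : Fin n} (hik : i ≠ k) (hil : i ≠ l) (hjk : j ≠ k) (hjl : j ≠ l)
    {A : Type*} (v : Fin n → A) : vecSwap i j (vecSwap k l v) = vecSwap k l (vecSwap i j v) := by
  ext m
  simp only [vecSwap, Equiv.swap_apply_def]
  split_ifs <;> simp_all

theorem vecSwap_vecNeg_comm {i j k : Fin n} (hik : i ≠ k) (hjk : j ≠ k) (v : Fin n → ℤ) :
    vecSwap i j (vecNeg k v) = vecNeg k (vecSwap i j v) := by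
  ext m
  simp only [vecSwap, vecNeg, Equiv.swap_apply_def]
  split_ifs <;> simp_all

theorem vecSwap_vecTau_comm {i j k l : Fin n} (hik : i ≠ k) (hil : i ≠ l) (hjk : j ≠ k)
    (hjl : j ≠ l) (v : Fin n → ℤ) : vecSwap i j (vecTau k l v) = vecTau k l (vecSwap i j v) := by
  ext m
  simp only [vecSwap, vecTau, Equiv.swap_apply_def]
  split_ifs <;> simp_all

theorem vecSwap_vecTau_self (i j : Fin n) (v : Fin n → ℤ) :
    vecSwap i j (vecTau i j v) = vecTau i j (vecSwap i j v) := by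
  ext m
  simp only [vecSwap, vecTau, Equiv.swap_apply_def]
  split_ifs <;> simp_all

theorem vecSwap_vecTau_braid {i j k : Fin n} (hij : i ≠ j) (hjk : j ≠ k) (hik : i ≠ k)
    (v : Fin n → ℤ) :
    vecSwap i j (vecTau j k (vecSwap i j v)) = vecTau j k (vecSwap i j (vecTau j k v)) := by
  ext m
  simp only [vecSwap, vecTau, Equiv.swap_apply_def]
  split_ifs <;> simp_all

theorem vecSwap_vecNeg_braid {i j : Fin n} (hij : i ≠ j) (v : Fin n → ℤ) :
    vecSwap i j (vecNeg j (vecSwap i j (vecNeg j v))) =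
      vecNeg j (vecSwap i j (vecNeg j (vecSwap i j v))) := by
  ext m
  simp only [vecSwap, vecNeg, Equiv.swap_apply_def]
  split_ifs <;> simp_all

theorem vecSwap_rootA {i j : Fin n} (hij : i ≠ j) : vecSwap i j (rootA i j) = -rootA i j := by
  rw [vecSwap_eq_add hij]
  have h1 : rootA i j i - rootA i j j = -2 := by simp [rootA, hij, hij.symm]
  rw [h1, neg_smul, two_smul]; abel

theorem vecTau_rootD {i j : Fin n} (hij : i ≠ j) : vecTau i j (rootD i j) = -rootD i j := by
  rw [vecTau_eq_add hij]
  have h1 : rootD i j i + rootD i j j = -2 := by simp [rootD, hij, hij.symm]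
  rw [h1, neg_smul, two_smul]; abel

theorem piA_comm {i j k l : Fin n} (hij : i ≠ j) (hkl : k ≠ l) (hik : i ≠ k) (hil : i ≠ l)
    (hjk : j ≠ k) (hjl : j ≠ l) (f : Laurent R n) :
    piA i j (piA k l f) = piA k l (piA i j f) := by
  have h1 : vecSwap k l (rootA i j) = rootA i j := by
    rw [vecSwap_eq_add hkl]; simp [rootA, hik.symm, hil.symm, hjk.symm, hjl.symm]
  have h2 : vecSwap i j (rootA k l) = rootA k l := by
    rw [vecSwap_eq_add hij]; simp [rootA, hik, hil, hjk, hjl]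
  refine divDiff_comm (actHom (swapHom i j) : Laurent R n →ₐ[R] Laurent R n).toRingHom
    (actHom (swapHom k l) : Laurent R n →ₐ[R] Laurent R n).toRingHom _ _ (p := 1) (p' := 1)
    (isRegular_one_sub_mono (rootA_ne_zero hij)) (isRegular_one_sub_mono (rootA_ne_zero hkl))
    (fun f => (piA_spec hij f).trans (by rw [one_mul]; rfl))
    (fun f => (piA_spec hkl f).trans (by rw [one_mul]; rfl))
    (map_one _) (by simp [actHom_mono, h1]) (by simp [actHom_mono, h1])
    (map_one _) (by simp [actHom_mono, h2]) (by simp [actHom_mono, h2]) (fun f => ?_) f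
  simp only [AlgHom.toRingHom_eq_coe, RingHom.coe_coe, actHom_actHom]
  exact actHom_congr (fun v => vecSwap_comm hik hil hjk hjl v) f

theorem piA_piBC_comm (β : R) {i j k : Fin n} (hij : i ≠ j) (hik : i ≠ k) (hjk : j ≠ k)
    (f : Laurent R n) : piA i j (piBC β k f) = piBC β k (piA i j f) := by
  have h1 : vecNeg k (rootA i j) = rootA i j := by
    rw [vecNeg_eq_add]; simp [rootA, hik.symm, hjk.symm]
  have h2 : vecSwap i j (Pi.single k (-1) : Fin n → ℤ) = Pi.single k (-1) := by
    rw [vecSwap_eq_add hij]; simp [hik, hjk]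
  have h3 : actHom (swapHom i j) (varInv k : Laurent R n) = varInv k := by
    unfold varInv; rw [actHom_mono, swapHom_apply, h2]
  refine divDiff_comm (actHom (swapHom i j) : Laurent R n →ₐ[R] Laurent R n).toRingHom
    (actHom (negHom k) : Laurent R n →ₐ[R] Laurent R n).toRingHom _ _ (p := 1)
    (isRegular_one_sub_mono (rootA_ne_zero hij)) (isRegular_one_sub_varInv_sq k)
    (fun f => (piA_spec hij f).trans (by rw [one_mul]; rfl))
    (fun f => piBC_spec β k f)
    (map_one _) (by simp [actHom_mono, h1]) (by simp [actHom_mono, h1])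
    (by simp only [AlgHom.toRingHom_eq_coe, RingHom.coe_coe, map_add, map_mul, map_one, h3,
      AlgHom.commutes])
    (by simp only [AlgHom.toRingHom_eq_coe, RingHom.coe_coe, map_add, map_mul, map_pow, h3,
      AlgHom.commutes]) (by simp [h3]) (fun f => ?_) f
  simp only [AlgHom.toRingHom_eq_coe, RingHom.coe_coe, actHom_actHom]
  exact actHom_congr (fun v => vecSwap_vecNeg_comm hik hjk v) f

theorem piA_piD_comm {i j k l : Fin n} (hij : i ≠ j) (hkl : k ≠ l) (hik : i ≠ k) (hil : i ≠ l)
    (hjk : j ≠ k) (hjl : j ≠ l) (f : Laurent R n) :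
    piA i j (piD k l f) = piD k l (piA i j f) := by
  have h1 : vecTau k l (rootA i j) = rootA i j := by
    rw [vecTau_eq_add hkl]; simp [rootA, hik.symm, hil.symm, hjk.symm, hjl.symm]
  have h2 : vecSwap i j (rootD k l) = rootD k l := by
    rw [vecSwap_eq_add hij]; simp [rootD, hik, hil, hjk, hjl]
  refine divDiff_comm (actHom (swapHom i j) : Laurent R n →ₐ[R] Laurent R n).toRingHom
    (actHom (tauHom k l) : Laurent R n →ₐ[R] Laurent R n).toRingHom _ _ (p := 1) (p' := 1)
    (isRegular_one_sub_mono (rootA_ne_zero hij)) (isRegular_one_sub_mono (rootD_ne_zero hkl))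
    (fun f => (piA_spec hij f).trans (by rw [one_mul]; rfl))
    (fun f => (piD_spec hkl f).trans (by rw [one_mul]; rfl))
    (map_one _) (by simp [actHom_mono, h1]) (by simp [actHom_mono, h1])
    (map_one _) (by simp [actHom_mono, h2]) (by simp [actHom_mono, h2]) (fun f => ?_) f
  simp only [AlgHom.toRingHom_eq_coe, RingHom.coe_coe, actHom_actHom]
  exact actHom_congr (fun v => vecSwap_vecTau_comm hik hil hjk hjl v) f

theorem piA_piD_self_comm {i j : Fin n} (hij : i ≠ j) (f : Laurent R n) :
    piA i j (piD i j f) = piD i j (piA i j f) := by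
  have h1 : vecTau i j (rootA i j) = rootA i j := by
    rw [vecTau_eq_add hij]; simp [rootA, hij, hij.symm]
  have h2 : vecSwap i j (rootD i j) = rootD i j := by
    rw [vecSwap_eq_add hij]; simp [rootD, hij, hij.symm]
  refine divDiff_comm (actHom (swapHom i j) : Laurent R n →ₐ[R] Laurent R n).toRingHom
    (actHom (tauHom i j) : Laurent R n →ₐ[R] Laurent R n).toRingHom _ _ (p := 1) (p' := 1)
    (isRegular_one_sub_mono (rootA_ne_zero hij)) (isRegular_one_sub_mono (rootD_ne_zero hij))
    (fun f => (piA_spec hij f).trans (by rw [one_mul]; rfl))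
    (fun f => (piD_spec hij f).trans (by rw [one_mul]; rfl))
    (map_one _) (by simp [actHom_mono, h1]) (by simp [actHom_mono, h1])
    (map_one _) (by simp [actHom_mono, h2]) (by simp [actHom_mono, h2]) (fun f => ?_) f
  simp only [AlgHom.toRingHom_eq_coe, RingHom.coe_coe, actHom_actHom]
  exact actHom_congr (fun v => vecSwap_vecTau_self i j v) f

theorem mono_mul_mono_neg (v : Fin n → ℤ) : (mono v : Laurent R n) * mono (-v) = 1 := by
  rw [mul_comm, mono_neg_mul]

theorem piA_braid {i j k : Fin n} (hij : i ≠ j) (hjk : j ≠ k) (hik : i ≠ k) (f : Laurent R n) :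
    piA i j (piA j k (piA i j f)) = piA j k (piA i j (piA j k f)) := by
  have hsum : rootA i j + rootA j k = rootA i k := by unfold rootA; abel
  have h1 : vecSwap i j (rootA j k) = rootA i j + rootA j k := by
    rw [vecSwap_eq_add hij]; simp [rootA, hij, hik, hjk, add_comm]
  have h2 : vecSwap j k (rootA i j) = rootA i j + rootA j k := by
    rw [vecSwap_eq_add hjk]; simp [rootA, hij.symm, hik.symm, hjk.symm]
  refine divDiff_three_braid (σ := (actHom (swapHom i j) : Laurent R n →ₐ[R] Laurent R n).toRingHom)
    (τ := (actHom (swapHom j k) : Laurent R n →ₐ[R] Laurent R n).toRingHom)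
    (isRegular_one_sub_mono (rootA_ne_zero hij)) (isRegular_one_sub_mono (rootA_ne_zero hjk))
    (by rw [mono_mul, hsum]; exact isRegular_one_sub_mono (rootA_ne_zero hik))
    (piA_spec hij) (piA_spec hjk) (actHom_swap_swap i j) (actHom_swap_swap j k) (fun f => ?_)
    ?_ ?_ ?_ ?_ f
  · simp only [AlgHom.toRingHom_eq_coe, RingHom.coe_coe, actHom_actHom]
    exact actHom_congr (fun v => vecSwap_braid hij hjk hik v) f
  · simp only [AlgHom.toRingHom_eq_coe, RingHom.coe_coe, actHom_mono, swapHom_apply,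
      vecSwap_rootA hij, mono_mul_mono_neg]
  · simp only [AlgHom.toRingHom_eq_coe, RingHom.coe_coe, actHom_mono, swapHom_apply, h1, mono_mul]
  · simp only [AlgHom.toRingHom_eq_coe, RingHom.coe_coe, actHom_mono, swapHom_apply, h2, mono_mul]
  · simp only [AlgHom.toRingHom_eq_coe, RingHom.coe_coe, actHom_mono, swapHom_apply,
      vecSwap_rootA hjk, mono_mul_mono_neg]

theorem piA_piD_braid {i j k : Fin n} (hij : i ≠ j) (hjk : j ≠ k) (hik : i ≠ k)
    (f : Laurent R n) :
    piA i j (piD j k (piA i j f)) = piD j k (piA i j (piD j k f)) := by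
  have hsum : rootA i j + rootD j k = rootD i k := by
    ext m; simp only [rootA, rootD, Pi.add_apply, Pi.sub_apply, Pi.single_apply]
    split_ifs <;> simp
  have h1 : vecSwap i j (rootD j k) = rootA i j + rootD j k := by
    rw [vecSwap_eq_add hij]; simp [rootD, hij, hik, hjk, add_comm]
  have h2 : vecTau j k (rootA i j) = rootA i j + rootD j k := by
    rw [vecTau_eq_add hjk]; simp [rootA, hij.symm, hik.symm, hjk.symm]
  refine divDiff_three_braid (σ := (actHom (swapHom i j) : Laurent R n →ₐ[R] Laurent R n).toRingHom)
    (τ := (actHom (tauHom j k) : Laurent R n →ₐ[R] Laurent R n).toRingHom)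
    (isRegular_one_sub_mono (rootA_ne_zero hij)) (isRegular_one_sub_mono (rootD_ne_zero hjk))
    (by rw [mono_mul, hsum]; exact isRegular_one_sub_mono (rootD_ne_zero hik))
    (piA_spec hij) (piD_spec hjk) (actHom_swap_swap i j) (actHom_tau_tau hjk) (fun f => ?_)
    ?_ ?_ ?_ ?_ f
  · simp only [AlgHom.toRingHom_eq_coe, RingHom.coe_coe, actHom_actHom]
    exact actHom_congr (fun v => vecSwap_vecTau_braid hij hjk hik v) f
  · simp only [AlgHom.toRingHom_eq_coe, RingHom.coe_coe, actHom_mono, swapHom_apply,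
      vecSwap_rootA hij, mono_mul_mono_neg]
  · simp only [AlgHom.toRingHom_eq_coe, RingHom.coe_coe, actHom_mono, swapHom_apply, h1, mono_mul]
  · simp only [AlgHom.toRingHom_eq_coe, RingHom.coe_coe, actHom_mono, tauHom_apply, h2, mono_mul]
  · simp only [AlgHom.toRingHom_eq_coe, RingHom.coe_coe, actHom_mono, tauHom_apply,
      vecTau_rootD hjk, mono_mul_mono_neg]

theorem piA_piBC_braid (β : R) {i j : Fin n} (hij : i ≠ j) (f : Laurent R n) :
    piA i j (piBC β j (piA i j (piBC β j f))) = piBC β j (piA i j (piBC β j (piA i j f))) := by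
  have hsum1 : mono (rootA i j) * varInv j = (varInv i : Laurent R n) := by
    unfold rootA varInv; rw [mono_mul]; congr 1
    ext m; simp only [Pi.add_apply, Pi.sub_apply, Pi.single_apply]; split_ifs <;> simp
  have hsum2 : mono (rootA i j) * varInv j ^ 2 = (mono (rootD i j) : Laurent R n) := by
    rw [sq, ← mul_assoc, hsum1, varInv_mul_varInv]
  have h1 : vecSwap i j (Pi.single j (-1)) = rootA i j + Pi.single j (-1) := by
    rw [vecSwap_eq_add hij]; simp [hij, add_comm]
  have h2 : vecNeg j (rootA i j) = rootA i j + (Pi.single j (-1) + Pi.single j (-1)) := by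
    rw [vecNeg_eq_add]; simp [rootA, hij.symm]
  have h3 : vecNeg j (Pi.single j (-1)) = -(Pi.single j (-1) : Fin n → ℤ) := by
    rw [vecNeg_eq_add]; simp
  refine divDiff_four_braid (σ := (actHom (swapHom i j) : Laurent R n →ₐ[R] Laurent R n).toRingHom)
    (τ := (actHom (negHom j) : Laurent R n →ₐ[R] Laurent R n).toRingHom)
    (β := algebraMap R (Laurent R n) β)
    (isRegular_one_sub_mono (rootA_ne_zero hij)) (isRegular_one_sub_varInv_sq j)
    (by rw [hsum1]; exact isRegular_one_sub_varInv_sq i)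
    (by rw [hsum2]; exact isRegular_one_sub_mono (rootD_ne_zero hij))
    (piA_spec hij) (piBC_spec β j) (actHom_swap_swap i j) (actHom_neg_neg j) (fun f => ?_)
    (AlgHom.commutes _ _) (AlgHom.commutes _ _) ?_ ?_ ?_ ?_ f
  · simp only [AlgHom.toRingHom_eq_coe, RingHom.coe_coe, actHom_actHom]
    exact actHom_congr (fun v => vecSwap_vecNeg_braid hij v) f
  · simp only [AlgHom.toRingHom_eq_coe, RingHom.coe_coe, actHom_mono, swapHom_apply,
      vecSwap_rootA hij, mono_mul_mono_neg]
  · simp only [varInv, AlgHom.toRingHom_eq_coe, RingHom.coe_coe, actHom_mono, swapHom_apply, h1,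
      mono_mul]
  · rw [sq, varInv_mul_self]
    simp only [AlgHom.toRingHom_eq_coe, RingHom.coe_coe, actHom_mono, negHom_apply, h2, mono_mul]
  · simp only [varInv, AlgHom.toRingHom_eq_coe, RingHom.coe_coe, actHom_mono, negHom_apply, h3,
      mono_mul_mono_neg]

/-- The value of an isobaric divided difference is fixed by the reflection. -/
theorem actHom_piA {i j : Fin n} (hij : i ≠ j) (f : Laurent R n) :
    actHom (swapHom i j) (piA i j f) = piA i j f := by
  have h1 := congrArg (actHom (swapHom i j)) (piA_spec hij f)
  simp only [map_mul, map_sub, map_one, actHom_mono, swapHom_apply, vecSwap_rootA hij,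
    actHom_swap_swap] at h1
  have h2 := mono_mul_mono_neg (R := R) (rootA i j)
  refine (isRegular_one_sub_mono (rootA_ne_zero hij)).left ?_
  dsimp only
  linear_combination -mono (rootA i j) * h1 - piA_spec hij f + (f - actHom (swapHom i j) (piA i j f)) * h2

theorem piA_eq_self {i j : Fin n} (hij : i ≠ j) {f : Laurent R n}
    (h : actHom (swapHom i j) f = f) : piA i j f = f := by
  refine piA_eq hij ?_
  rw [h]; ring

theorem piA_piA {i j : Fin n} (hij : i ≠ j) (f : Laurent R n) :
    piA i j (piA i j f) = piA i j f :=
  piA_eq_self hij (actHom_piA hij f)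

end Operators

/-! ### Confluence of the recursions -/

section Confluence

variable {X M : Type*}

/-- The family generated from the values `m₀` at the vectors which no step reaches, by applying the
operator `T` along each step `Step u v T` from `u` to `v`. -/
inductive KeyRel (Step : X → X → (M → M) → Prop) (m₀ : X → M) : X → M → Prop
  | base (v : X) (h : ∀ u T, ¬ Step u v T) : KeyRel Step m₀ v (m₀ v)
  | step (u v : X) (T : M → M) (f : M) (h : Step u v T) (hf : KeyRel Step m₀ u f) :
      KeyRel Step m₀ v (T f)

/-- `Path Step u v P`: the operator `P` is the composite of the operators along a chain of steps from
`u` to `v`. -/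
inductive Path (Step : X → X → (M → M) → Prop) : X → X → (M → M) → Prop
  | refl (u : X) : Path Step u u id
  | tail (u v w : X) (P T : M → M) (hP : Path Step u v P) (hT : Step v w T) :
      Path Step u w fun f => T (P f)

/-- Any two last steps to the same vector can be completed to two chains with the same start and with
the same composite. -/
def Diamond (Step : X → X → (M → M) → Prop) : Prop :=
  ∀ u u' v T T', Step u v T → Step u' v T' →
    ∃ w P P', Path Step w u P ∧ Path Step w u' P' ∧ ∀ f, T (P f) = T' (P' f)

variable {Step : X → X → (M → M) → Prop} {m₀ : X → M}

theorem Path.keyRel {u v : X} {P : M → M} (h : Path Step u v P) {f : M}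
    (hf : KeyRel Step m₀ u f) : KeyRel Step m₀ v (P f) := by
  induction h with
  | refl => exact hf
  | tail v w P T _ hT ih => exact .step _ _ _ _ hT ih

theorem Path.height_le {ht : X → ℕ} (hh : ∀ u v T, Step u v T → ht u < ht v) {u v : X} {P : M → M}
    (h : Path Step u v P) : ht u ≤ ht v := by
  induction h with
  | refl => exact le_rfl
  | tail v w P T _ hT ih => exact ih.trans (hh _ _ _ hT).le

theorem Path.single {u v : X} {T : M → M} (h : Step u v T) : Path Step u v T :=
  Path.tail u u v id T (Path.refl u) h

/-- If every step increases the height, then the diamond property makes the family well defined: the chains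
that start at the common vector `w` of a diamond reduce the claim for `v` to vectors of smaller height. -/
theorem existsUnique_keyRel (ht : X → ℕ) (hh : ∀ u v T, Step u v T → ht u < ht v)
    (hd : Diamond Step) (v : X) : ∃! f, KeyRel Step m₀ v f := by
  induction hv : ht v using Nat.strong_induction_on generalizing v with
  | _ N ih =>
    subst hv
    by_cases hbase : ∀ u T, ¬ Step u v T
    · refine ⟨m₀ v, .base v hbase, fun f hf => ?_⟩
      cases hf with
      | base => rfl
      | step u _ T f h => exact absurd h (hbase _ _)
    · push Not at hbase
      obtain ⟨u, T, hT⟩ := hbase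
      obtain ⟨g, hg, hgu⟩ := ih _ (hh _ _ _ hT) u rfl
      refine ⟨T g, .step _ _ _ _ hT hg, fun f hf => ?_⟩
      cases hf with
      | base _ hb => exact absurd hT (hb _ _)
      | step u' _ T' f' hT' hf' =>
        obtain ⟨w, P, P', hP, hP', heq⟩ := hd _ _ _ _ _ hT hT'
        obtain ⟨k, hk, -⟩ := ih _ ((hP.height_le hh).trans_lt (hh _ _ _ hT)) w rfl
        have h1 : P k = g := hgu _ (hP.keyRel hk)
        have h2 : f' = P' k :=
          (ih _ (hh _ _ _ hT') u' rfl).unique hf' (hP'.keyRel hk)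
        rw [h2, ← h1, heq]

end Confluence

/-! ### The steps of types `A`, `BC` and `D` -/

section Steps

variable {R : Type*} [CommRing R] {n : ℕ}

/-- The steps of type `A`. -/
inductive StepA (R : Type*) [CommRing R] {n : ℕ} :
    (Fin n → ℤ) → (Fin n → ℤ) → (Laurent R n → Laurent R n) → Prop
  | swap (v : Fin n → ℤ) (i j : Fin n) (hij : (i : ℕ) + 1 = j) (hv : v j < v i) :
      StepA R v (vecSwap i j v) (piA i j)

/-- The steps of type `BC`. -/
inductive StepBC (β : R) : (Fin n → ℤ) → (Fin n → ℤ) → (Laurent R n → Laurent R n) → Prop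
  | swap (v : Fin n → ℤ) (i j : Fin n) (hij : (i : ℕ) + 1 = j) (hv : v j < v i) :
      StepBC β v (vecSwap i j v) (piA i j)
  | last (v : Fin n → ℤ) (i : Fin n) (hi : (i : ℕ) + 1 = n) (hv : 0 < v i) :
      StepBC β v (vecNeg i v) (piBC β i)

/-- The steps of type `D`. -/
inductive StepD (R : Type*) [CommRing R] {n : ℕ} :
    (Fin n → ℤ) → (Fin n → ℤ) → (Laurent R n → Laurent R n) → Prop
  | swap (v : Fin n → ℤ) (i j : Fin n) (hij : (i : ℕ) + 1 = j) (hv : v j < v i) :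
      StepD R v (vecSwap i j v) (piA i j)
  | last (v : Fin n → ℤ) (i j : Fin n) (hij : (i : ℕ) + 1 = j) (hj : (j : ℕ) + 1 = n)
      (hv : 0 < v i + v j) : StepD R v (vecTau i j v) (piD i j)

theorem fin_ne_of_succ {i j : Fin n} (hij : (i : ℕ) + 1 = j) : i ≠ j := by
  rintro rfl; omega

/-- The linear form `∑ (n - k) v_k`, which decreases along every step. -/
def weight (v : Fin n → ℤ) : ℤ := ∑ k : Fin n, ((n : ℤ) - k) * v k

theorem weight_add_smul (v r : Fin n → ℤ) (a : ℤ) : weight (v + a • r) = weight v + a * weight r := by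
  unfold weight
  rw [Finset.mul_sum, ← Finset.sum_add_distrib]
  refine Finset.sum_congr rfl fun k _ => ?_
  simp only [Pi.add_apply, Pi.smul_apply, smul_eq_mul]; ring

theorem weight_add (v r : Fin n → ℤ) : weight (v + r) = weight v + weight r := by
  simpa using weight_add_smul v r 1

theorem weight_single (i : Fin n) (a : ℤ) : weight (Pi.single i a) = ((n : ℤ) - i) * a := by
  unfold weight
  rw [Finset.sum_eq_single i (fun b _ hb => by simp [hb]) (by simp)]
  simp

theorem weight_rootA {i j : Fin n} (hij : (i : ℕ) + 1 = j) : weight (rootA i j) = -1 := by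
  have h := weight_add (rootA i j) (Pi.single i 1)
  rw [rootA, sub_add_cancel, weight_single, weight_single] at h
  rw [rootA]
  have : (j : ℤ) = i + 1 := by exact_mod_cast hij.symm
  rw [this] at h
  linarith

/-- A nonnegative measure of the distance to the dominant vectors. -/
def height (v : Fin n → ℤ) : ℕ :=
  (∑ k : Fin n, ((n : ℤ) - k) * ((∑ l, |v l|) - v k)).toNat

theorem height_lt {u v : Fin n → ℤ} (habs : ∑ l, |u l| = ∑ l, |v l|) (hw : weight v < weight u) :
    height u < height v := by
  unfold height
  rw [habs]
  have hc : ∀ k : Fin n, (0 : ℤ) ≤ (n : ℤ) - k := fun k => by have := k.2; omega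
  have hle : ∀ k, u k ≤ ∑ l, |v l| := fun k => by
    rw [← habs]
    exact (le_abs_self _).trans (Finset.single_le_sum (f := fun l => |u l|)
      (fun l _ => abs_nonneg _) (Finset.mem_univ k))
  have h0 : (0 : ℤ) ≤ ∑ k : Fin n, ((n : ℤ) - k) * ((∑ l, |v l|) - u k) :=
    Finset.sum_nonneg fun k _ => mul_nonneg (hc k) (sub_nonneg.2 (hle k))
  have h1 : ∀ x : Fin n → ℤ, ∑ k : Fin n, ((n : ℤ) - k) * ((∑ l, |v l|) - x k) =
      (∑ k : Fin n, ((n : ℤ) - k) * ∑ l, |v l|) - weight x := fun x => by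
    unfold weight
    rw [← Finset.sum_sub_distrib]
    exact Finset.sum_congr rfl fun k _ => mul_sub _ _ _
  rw [Int.toNat_lt_toNat]
  · rw [h1, h1]; linarith
  · rw [h1] at h0 ⊢; linarith

theorem height_vecSwap {v : Fin n → ℤ} {i j : Fin n} (hij : (i : ℕ) + 1 = j) (hv : v j < v i) :
    height v < height (vecSwap i j v) := by
  refine height_lt (Equiv.sum_comp (Equiv.swap i j) fun l => |v l|).symm ?_
  rw [vecSwap_eq_add (fin_ne_of_succ hij), weight_add_smul, weight_rootA hij]
  linarith

theorem height_vecNeg {v : Fin n → ℤ} {i : Fin n} (hv : 0 < v i) :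
    height v < height (vecNeg i v) := by
  refine height_lt (Finset.sum_congr rfl fun l _ => ?_) ?_
  · by_cases h : l = i <;> simp [vecNeg, h]
  · rw [vecNeg_eq_add, weight_add_smul, weight_add, weight_single]
    have := i.2
    have : (0 : ℤ) < n - i := by omega
    nlinarith

theorem height_vecTau {v : Fin n → ℤ} {i j : Fin n} (hij : i ≠ j) (hv : 0 < v i + v j) :
    height v < height (vecTau i j v) := by
  refine height_lt ?_ ?_
  · rw [← Equiv.sum_comp (Equiv.swap i j)]
    refine Finset.sum_congr rfl fun l _ => ?_
    rw [Equiv.swap_apply_def]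
    unfold vecTau
    split_ifs <;> simp
  · rw [vecTau_eq_add hij, weight_add_smul, rootD, weight_add, weight_single, weight_single]
    have := i.2
    have := j.2
    have : (0 : ℤ) < n - i := by omega
    have : (0 : ℤ) < n - j := by omega
    nlinarith

section Diamonds

variable {Step : (Fin n → ℤ) → (Fin n → ℤ) → (Laurent R n → Laurent R n) → Prop}

theorem step_of_lt
    (hs : ∀ (v : Fin n → ℤ) (i j : Fin n), (i : ℕ) + 1 = j → v j < v i → Step v (vecSwap i j v) (piA i j))
    {v : Fin n → ℤ} {i j : Fin n} (hij : (i : ℕ) + 1 = j) (hv : v i < v j) :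
    Step (vecSwap i j v) v (piA i j) := by
  have := hs (vecSwap i j v) i j hij (by rwa [vecSwap_left, vecSwap_right])
  rwa [vecSwap_vecSwap] at this

theorem diamond_braid
    (hs : ∀ (v : Fin n → ℤ) (i j : Fin n), (i : ℕ) + 1 = j → v j < v i → Step v (vecSwap i j v) (piA i j))
    {v : Fin n → ℤ} {i j k : Fin n} (hij : (i : ℕ) + 1 = j) (hjk : (j : ℕ) + 1 = k)
    (h1 : v i < v j) (h2 : v j < v k) :
    ∃ w P P', Path Step w (vecSwap i j v) P ∧ Path Step w (vecSwap j k v) P' ∧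
      ∀ f, piA i j (P f) = piA j k (P' f) := by
  have nij := fin_ne_of_succ hij
  have njk := fin_ne_of_succ hjk
  have nik : i ≠ k := by rintro rfl; omega
  have a1 := step_of_lt hs (v := vecSwap i j v) hjk
    (by rw [vecSwap_right, vecSwap_of_ne nik.symm njk.symm]; exact h1.trans h2)
  have a2 := step_of_lt hs (v := vecSwap j k (vecSwap i j v)) hij
    (by rw [vecSwap_left, vecSwap_of_ne nij nik, vecSwap_left, vecSwap_of_ne nik.symm njk.symm]
        exact h2)
  have b1 := step_of_lt hs (v := vecSwap j k v) hij
    (by rw [vecSwap_left, vecSwap_of_ne nij nik]; exact h1.trans h2)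
  have b2 := step_of_lt hs (v := vecSwap i j (vecSwap j k v)) hjk
    (by rw [vecSwap_right, vecSwap_of_ne nik.symm njk.symm, vecSwap_of_ne nij nik, vecSwap_right]
        exact h1)
  rw [← vecSwap_braid nij njk nik] at b2
  exact ⟨_, _, _, .tail _ _ _ _ _ (.single a2) a1, .tail _ _ _ _ _ (.single b2) b1,
    fun f => piA_braid nij njk nik f⟩

theorem diamond_swap_swap
    (hs : ∀ (v : Fin n → ℤ) (i j : Fin n), (i : ℕ) + 1 = j → v j < v i → Step v (vecSwap i j v) (piA i j))
    {v : Fin n → ℤ} {i j k l : Fin n} (hij : (i : ℕ) + 1 = j) (hkl : (k : ℕ) + 1 = l)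
    (h1 : v i < v j) (h2 : v k < v l) :
    ∃ w P P', Path Step w (vecSwap i j v) P ∧ Path Step w (vecSwap k l v) P' ∧
      ∀ f, piA i j (P f) = piA k l (P' f) := by
  by_cases hik : i = k
  · subst hik
    obtain rfl : j = l := Fin.ext (by omega)
    exact ⟨_, _, _, .refl _, .refl _, fun _ => rfl⟩
  by_cases hjk : j = k
  · subst hjk
    exact diamond_braid hs hij hkl h1 h2
  by_cases hil : i = l
  · subst hil
    obtain ⟨w, P, P', h, h', e⟩ := diamond_braid hs hkl hij h2 h1
    exact ⟨w, P', P, h', h, fun f => (e f).symm⟩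
  have hjl : j ≠ l := by rintro rfl; exact hik (Fin.ext (by omega))
  have a1 := step_of_lt hs (v := vecSwap i j v) hkl
    (by rw [vecSwap_of_ne (Ne.symm hik) (Ne.symm hjk), vecSwap_of_ne (Ne.symm hil) hjl.symm]
        exact h2)
  have b1 := step_of_lt hs (v := vecSwap k l v) hij
    (by rw [vecSwap_of_ne hik hil, vecSwap_of_ne hjk hjl]; exact h1)
  rw [vecSwap_comm hik hil hjk hjl] at b1
  exact ⟨_, _, _, .single a1, .single b1,
    fun f => piA_comm (fin_ne_of_succ hij) (fin_ne_of_succ hkl) hik hil hjk hjl f⟩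

end Diamonds

theorem diamond_stepA : Diamond (StepA R (n := n)) := by
  have key : ∀ u v T, StepA R u v T →
      ∃ i j : Fin n, (i : ℕ) + 1 = j ∧ v i < v j ∧ u = vecSwap i j v ∧ T = piA i j := by
    rintro u v T ⟨i, j, hij, hv⟩
    exact ⟨i, j, hij, by rwa [vecSwap_left, vecSwap_right], (vecSwap_vecSwap _ _ _).symm, rfl⟩
  intro u u' v T T' h h'
  obtain ⟨i, j, hij, hv, rfl, rfl⟩ := key _ _ _ h
  obtain ⟨k, l, hkl, hv', rfl, rfl⟩ := key _ _ _ h'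
  exact diamond_swap_swap (fun v i j => .swap v i j) hij hkl hv hv'

theorem vecNeg_self (i : Fin n) (v : Fin n → ℤ) : vecNeg i v i = -v i := by simp [vecNeg]
theorem vecNeg_of_ne {i k : Fin n} (h : k ≠ i) (v : Fin n → ℤ) : vecNeg i v k = v k := by
  simp [vecNeg, h]
theorem vecTau_left (i j : Fin n) (v : Fin n → ℤ) : vecTau i j v i = -v j := by simp [vecTau]
theorem vecTau_right {i j : Fin n} (hij : i ≠ j) (v : Fin n → ℤ) : vecTau i j v j = -v i := by
  simp [vecTau, hij.symm]
theorem vecTau_of_ne {i j k : Fin n} (hi : k ≠ i) (hj : k ≠ j) (v : Fin n → ℤ) :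
    vecTau i j v k = v k := by
  simp [vecTau, hi, hj]

theorem stepBC_last_of_lt (β : R) {v : Fin n → ℤ} {i : Fin n} (hi : (i : ℕ) + 1 = n)
    (hv : v i < 0) : StepBC β (vecNeg i v) v (piBC β i) := by
  have := StepBC.last (β := β) (v := vecNeg i v) i hi (by rw [vecNeg_self]; omega)
  rwa [vecNeg_vecNeg] at this

theorem stepD_last_of_lt {v : Fin n → ℤ} {i j : Fin n} (hij : (i : ℕ) + 1 = j)
    (hj : (j : ℕ) + 1 = n) (hv : v i + v j < 0) : StepD R (vecTau i j v) v (piD i j) := by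
  have nij := fin_ne_of_succ hij
  have := StepD.last (R := R) (v := vecTau i j v) i j hij hj
    (by rw [vecTau_left, vecTau_right nij]; omega)
  rwa [vecTau_vecTau nij] at this

theorem diamond_swap_last_BC (β : R) {v : Fin n → ℤ} {i j k : Fin n} (hij : (i : ℕ) + 1 = j)
    (hk : (k : ℕ) + 1 = n) (h1 : v i < v j) (h2 : v k < 0) :
    ∃ w P P', Path (StepBC β) w (vecSwap i j v) P ∧ Path (StepBC β) w (vecNeg k v) P' ∧
      ∀ f, piA i j (P f) = piBC β k (P' f) := by
  have nij := fin_ne_of_succ hij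
  have hs : ∀ (v : Fin n → ℤ) (i j : Fin n), (i : ℕ) + 1 = j → v j < v i →
    StepBC β v (vecSwap i j v) (piA i j) := fun v i j => .swap v i j
  have hjn := j.2
  have nik : i ≠ k := by rintro rfl; omega
  by_cases hjk : j = k
  · subst hjk
    have a1 := stepBC_last_of_lt β (v := vecSwap i j v) hk (by rw [vecSwap_right]; omega)
    have a2 := step_of_lt hs (v := vecNeg j (vecSwap i j v)) hij
      (by rw [vecNeg_self, vecNeg_of_ne nij, vecSwap_left, vecSwap_right]; omega)
    have a3 := stepBC_last_of_lt β (v := vecSwap i j (vecNeg j (vecSwap i j v))) hk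
      (by rw [vecSwap_right, vecNeg_of_ne nij, vecSwap_left]; omega)
    have b1 := step_of_lt hs (v := vecNeg j v) hij
      (by rw [vecNeg_self, vecNeg_of_ne nij]; omega)
    have b2 := stepBC_last_of_lt β (v := vecSwap i j (vecNeg j v)) hk
      (by rw [vecSwap_right, vecNeg_of_ne nij]; omega)
    have b3 := step_of_lt hs (v := vecNeg j (vecSwap i j (vecNeg j v))) hij
      (by rw [vecNeg_self, vecNeg_of_ne nij, vecSwap_left, vecSwap_right, vecNeg_self,
        vecNeg_of_ne nij]; omega)
    rw [vecSwap_vecNeg_braid nij] at b3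
    exact ⟨_, _, _, .tail _ _ _ _ _ (.tail _ _ _ _ _ (.single a3) a2) a1,
      .tail _ _ _ _ _ (.tail _ _ _ _ _ (.single b3) b2) b1,
      fun f => piA_piBC_braid β nij f⟩
  · have a1 := stepBC_last_of_lt β (v := vecSwap i j v) hk
      (by rwa [vecSwap_of_ne (Ne.symm nik) (Ne.symm hjk)])
    have b1 := step_of_lt hs (v := vecNeg k v) hij
      (by rwa [vecNeg_of_ne nik, vecNeg_of_ne hjk])
    rw [vecSwap_vecNeg_comm nik hjk] at b1
    exact ⟨_, _, _, .single a1, .single b1, fun f => piA_piBC_comm β nij nik hjk f⟩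

theorem diamond_swap_last_D {v : Fin n → ℤ} {i j k l : Fin n} (hij : (i : ℕ) + 1 = j)
    (hkl : (k : ℕ) + 1 = l) (hl : (l : ℕ) + 1 = n) (h1 : v i < v j) (h2 : v k + v l < 0) :
    ∃ w P P', Path (StepD R) w (vecSwap i j v) P ∧ Path (StepD R) w (vecTau k l v) P' ∧
      ∀ f, piA i j (P f) = piD k l (P' f) := by
  have nij := fin_ne_of_succ hij
  have nkl := fin_ne_of_succ hkl
  have hs : ∀ (v : Fin n → ℤ) (i j : Fin n), (i : ℕ) + 1 = j → v j < v i →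
    StepD R v (vecSwap i j v) (piA i j) := fun v i j => .swap v i j
  have hjn := j.2
  have nil : i ≠ l := by rintro rfl; omega
  by_cases hik : i = k
  · subst hik
    obtain rfl : j = l := Fin.ext (by omega)
    have a1 := stepD_last_of_lt (R := R) (v := vecSwap i j v) hkl hl
      (by rw [vecSwap_right, vecSwap_left]; omega)
    have b1 := step_of_lt hs (v := vecTau i j v) hij
      (by rw [vecTau_left, vecTau_right nij]; omega)
    rw [vecSwap_vecTau_self] at b1
    exact ⟨_, _, _, .single a1, .single b1, fun f => piA_piD_self_comm nij f⟩
  have njl : j ≠ l := by rintro rfl; exact hik (Fin.ext (by omega))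
  by_cases hjk : j = k
  · subst hjk
    have a1 := stepD_last_of_lt (R := R) (v := vecSwap i j v) hkl hl
      (by rw [vecSwap_right, vecSwap_of_ne nil.symm nkl.symm]; omega)
    have a2 := step_of_lt hs (v := vecTau j l (vecSwap i j v)) hij
      (by rw [vecTau_left, vecTau_of_ne nij nil, vecSwap_left, vecSwap_of_ne nil.symm nkl.symm]
          omega)
    have b1 := step_of_lt hs (v := vecTau j l v) hij
      (by rw [vecTau_left, vecTau_of_ne nij nil]; omega)
    have b2 := stepD_last_of_lt (R := R) (v := vecSwap i j (vecTau j l v)) hkl hl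
      (by rw [vecSwap_right, vecSwap_of_ne nil.symm nkl.symm, vecTau_of_ne nij nil,
        vecTau_right nkl]; omega)
    rw [← vecSwap_vecTau_braid nij nkl nil] at b2
    exact ⟨_, _, _, .tail _ _ _ _ _ (.single a2) a1, .tail _ _ _ _ _ (.single b2) b1,
      fun f => piA_piD_braid nij nkl nil f⟩
  · have a1 := stepD_last_of_lt (R := R) (v := vecSwap i j v) hkl hl
      (by rwa [vecSwap_of_ne (Ne.symm hik) (Ne.symm hjk), vecSwap_of_ne nil.symm njl.symm])
    have b1 := step_of_lt hs (v := vecTau k l v) hij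
      (by rwa [vecTau_of_ne hik nil, vecTau_of_ne hjk njl])
    rw [vecSwap_vecTau_comm hik nil hjk njl] at b1
    exact ⟨_, _, _, .single a1, .single b1, fun f => piA_piD_comm nij nkl hik nil hjk njl f⟩

theorem diamond_stepBC (β : R) : Diamond (StepBC (n := n) β) := by
  have hs : ∀ (v : Fin n → ℤ) (i j : Fin n), (i : ℕ) + 1 = j → v j < v i →
    StepBC β v (vecSwap i j v) (piA i j) := fun v i j => .swap v i j
  -- In terms of the common endpoint `v`, the two last steps start at images of `v`.
  have key : ∀ u v T, StepBC β u v T →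
      (∃ i j : Fin n, (i : ℕ) + 1 = j ∧ v i < v j ∧ u = vecSwap i j v ∧ T = piA i j) ∨
      (∃ i : Fin n, (i : ℕ) + 1 = n ∧ v i < 0 ∧ u = vecNeg i v ∧ T = piBC β i) := by
    rintro u v T (⟨i, j, hij, hv⟩ | ⟨i, hi, hv⟩)
    · exact .inl ⟨i, j, hij, by rwa [vecSwap_left, vecSwap_right], (vecSwap_vecSwap _ _ _).symm, rfl⟩
    · exact .inr ⟨i, hi, by rw [vecNeg_self]; omega, (vecNeg_vecNeg _ _).symm, rfl⟩
  intro u u' v T T' h h'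
  obtain ⟨i, j, hij, hv, rfl, rfl⟩ | ⟨i, hi, hv, rfl, rfl⟩ := key _ _ _ h
  · obtain ⟨k, l, hkl, hv', rfl, rfl⟩ | ⟨k, hk, hv', rfl, rfl⟩ := key _ _ _ h'
    · exact diamond_swap_swap hs hij hkl hv hv'
    · exact diamond_swap_last_BC β hij hk hv hv'
  · obtain ⟨k, l, hkl, hv', rfl, rfl⟩ | ⟨k, hk, hv', rfl, rfl⟩ := key _ _ _ h'
    · obtain ⟨w, P, P', h1, h2, e⟩ := diamond_swap_last_BC β hkl hi hv' hv
      exact ⟨w, P', P, h2, h1, fun f => (e f).symm⟩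
    · obtain rfl : i = k := Fin.ext (by omega)
      exact ⟨_, _, _, .refl _, .refl _, fun _ => rfl⟩

theorem diamond_stepD : Diamond (StepD R (n := n)) := by
  have hs : ∀ (v : Fin n → ℤ) (i j : Fin n), (i : ℕ) + 1 = j → v j < v i →
    StepD R v (vecSwap i j v) (piA i j) := fun v i j => .swap v i j
  have key : ∀ u v T, StepD R u v T →
      (∃ i j : Fin n, (i : ℕ) + 1 = j ∧ v i < v j ∧ u = vecSwap i j v ∧ T = piA i j) ∨
      (∃ i j : Fin n, (i : ℕ) + 1 = j ∧ (j : ℕ) + 1 = n ∧ v i + v j < 0 ∧ u = vecTau i j v ∧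
        T = piD i j) := by
    rintro u v T (⟨i, j, hij, hv⟩ | ⟨i, j, hij, hj, hv⟩)
    · exact .inl ⟨i, j, hij, by rwa [vecSwap_left, vecSwap_right], (vecSwap_vecSwap _ _ _).symm, rfl⟩
    · have nij := fin_ne_of_succ hij
      exact .inr ⟨i, j, hij, hj, by rw [vecTau_left, vecTau_right nij]; omega,
        (vecTau_vecTau nij _).symm, rfl⟩
  intro u u' v T T' h h'
  obtain ⟨i, j, hij, hv, rfl, rfl⟩ | ⟨i, j, hij, hj, hv, rfl, rfl⟩ := key _ _ _ h
  · obtain ⟨k, l, hkl, hv', rfl, rfl⟩ | ⟨k, l, hkl, hl, hv', rfl, rfl⟩ := key _ _ _ h'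
    · exact diamond_swap_swap hs hij hkl hv hv'
    · exact diamond_swap_last_D hij hkl hl hv hv'
  · obtain ⟨k, l, hkl, hv', rfl, rfl⟩ | ⟨k, l, hkl, hl, hv', rfl, rfl⟩ := key _ _ _ h'
    · obtain ⟨w, P, P', h1, h2, e⟩ := diamond_swap_last_D (R := R) hkl hij hj hv' hv
      exact ⟨w, P', P, h2, h1, fun f => (e f).symm⟩
    · obtain rfl : j = l := Fin.ext (by omega)
      obtain rfl : i = k := Fin.ext (by omega)
      exact ⟨_, _, _, .refl _, .refl _, fun _ => rfl⟩

theorem existsUnique_stepA (v : Fin n → ℤ) :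
    ∃! f, KeyRel (StepA R) (fun v => (mono v : Laurent R n)) v f := by
  refine existsUnique_keyRel height ?_ diamond_stepA v
  rintro u v T ⟨i, j, hij, hv⟩
  exact height_vecSwap hij hv

theorem existsUnique_stepBC (β : R) (v : Fin n → ℤ) :
    ∃! f, KeyRel (StepBC β) (fun v => (mono v : Laurent R n)) v f := by
  refine existsUnique_keyRel height ?_ (diamond_stepBC β) v
  rintro u v T (⟨i, j, hij, hv⟩ | ⟨i, hi, hv⟩)
  · exact height_vecSwap hij hv
  · exact height_vecNeg hv

theorem existsUnique_stepD (v : Fin n → ℤ) :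
    ∃! f, KeyRel (StepD R) (fun v => (mono v : Laurent R n)) v f := by
  refine existsUnique_keyRel height ?_ diamond_stepD v
  rintro u v T (⟨i, j, hij, hv⟩ | ⟨i, j, hij, hj, hv⟩)
  · exact height_vecSwap hij hv
  · exact height_vecTau (fin_ne_of_succ hij) hv

theorem theUnique_eq {S : Type*} [Zero S] {P : S → Prop} {f : S} (hf : P f)
    (hu : ∀ g, P g → g = f) : theUnique P = f := by
  have h : ∃! f, P f := ⟨f, hf, hu⟩
  unfold theUnique
  rw [dif_pos h]
  exact hu _ h.choose_spec.1

theorem IsKeyBC.keyRel {β : R} {v : Fin n → ℤ} {f : Laurent R n} (h : IsKeyBC β v f) :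
    KeyRel (StepBC β) mono v f := by
  induction h with
  | dominant l hl =>
    refine .base _ fun u T h => ?_
    generalize hw : (fun i => (l i : ℤ)) = w at h
    cases h with
    | swap i j hij hv =>
      have h1 := congrFun hw i
      have h2 := congrFun hw j
      have h3 : l j ≤ l i := hl (Fin.le_def.2 (by omega))
      simp only [vecSwap_left, vecSwap_right] at h1 h2
      omega
    | last i hi hv =>
      have h1 := congrFun hw i
      simp only [vecNeg_self] at h1
      omega
  | step v f i j hij hv _ ih => exact .step _ _ _ _ (.swap v i j hij hv) ih
  | last v f i hi hv _ ih => exact .step _ _ _ _ (.last v i hi hv) ih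

theorem IsKeyD.keyRel {v : Fin n → ℤ} {f : Laurent R n} (h : IsKeyD v f) :
    KeyRel (StepD R) mono v f := by
  induction h with
  | dominant l hl =>
    refine .base _ fun u T h => ?_
    generalize hw : (fun i => (l i : ℤ)) = w at h
    cases h with
    | swap i j hij hv =>
      have h1 := congrFun hw i
      have h2 := congrFun hw j
      have h3 : l j ≤ l i := hl (Fin.le_def.2 (by omega))
      simp only [vecSwap_left, vecSwap_right] at h1 h2
      omega
    | last i j hij hj hv =>
      have h1 := congrFun hw i
      have h2 := congrFun hw j
      simp only [vecTau_left, vecTau_right (fin_ne_of_succ hij)] at h1 h2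
      omega
  | step v f i j hij hv _ ih => exact .step _ _ _ _ (.swap v i j hij hv) ih
  | last v f i j hij hj hv _ ih => exact .step _ _ _ _ (.last v i j hij hj hv) ih

theorem IsKeyBC.keyBC_eq {β : R} {v : Fin n → ℤ} {f : Laurent R n} (h : IsKeyBC β v f) :
    keyBC β v = f :=
  theUnique_eq h fun _ hg => (existsUnique_stepBC β v).unique hg.keyRel h.keyRel

theorem IsKeyD.keyD_eq {v : Fin n → ℤ} {f : Laurent R n} (h : IsKeyD v f) : keyD R v = f :=
  theUnique_eq h fun _ hg => (existsUnique_stepD v).unique hg.keyRel h.keyRel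

/-- The key polynomial of type `A` at a vector of `ℤ^n`, which starts with the monomials `x^λ` for all
weakly decreasing vectors `λ` of integers. -/
def keyA (R : Type*) [CommRing R] {n : ℕ} (v : Fin n → ℤ) : Laurent R n :=
  (existsUnique_stepA (R := R) v).choose

theorem keyRel_keyA (v : Fin n → ℤ) : KeyRel (StepA R) mono v (keyA R v) :=
  (existsUnique_stepA (R := R) v).choose_spec.1

theorem keyA_eq {v : Fin n → ℤ} {f : Laurent R n} (h : KeyRel (StepA R) mono v f) :
    keyA R v = f :=
  (existsUnique_stepA (R := R) v).unique (keyRel_keyA v) h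

theorem keyA_antitone {v : Fin n → ℤ} (hv : Antitone v) : keyA R v = mono v := by
  refine keyA_eq (.base v fun u T h => ?_)
  cases h with
  | swap i j hij hu =>
    have := hv (show i ≤ j from Fin.le_def.2 (by omega))
    rw [vecSwap_left, vecSwap_right] at this
    omega

theorem keyA_vecSwap {v : Fin n → ℤ} {i j : Fin n} (hij : (i : ℕ) + 1 = j) (hv : v j < v i) :
    keyA R (vecSwap i j v) = piA i j (keyA R v) :=
  keyA_eq (.step _ _ _ _ (.swap v i j hij hv) (keyRel_keyA v))

theorem keyA_of_lt {v : Fin n → ℤ} {i j : Fin n} (hij : (i : ℕ) + 1 = j) (hv : v i < v j) :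
    keyA R v = piA i j (keyA R (vecSwap i j v)) := by
  conv_lhs => rw [← vecSwap_vecSwap i j v]
  exact keyA_vecSwap hij (by rwa [vecSwap_left, vecSwap_right])

theorem exists_lt_of_not_antitone {v : Fin n → ℤ} (h : ¬ Antitone v) :
    ∃ i j : Fin n, (i : ℕ) + 1 = j ∧ v i < v j := by
  by_contra! hc
  refine h ?_
  cases n with
  | zero => exact fun i => i.elim0
  | succ n =>
    rw [Fin.antitone_iff_succ_le]
    exact fun i => hc _ _ (by simp)

/-- A key polynomial of type `A` at a vector with `v_i = v_{i+1}` is symmetric in `x_i`, `x_{i+1}`. -/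
theorem piA_keyA_of_eq {v : Fin n → ℤ} {i j : Fin n} (hij : (i : ℕ) + 1 = j) (hv : v i = v j) :
    piA i j (keyA R v) = keyA R v := by
  induction hN : height v using Nat.strong_induction_on generalizing v i j with
  | _ N ih =>
    subst hN
    have nij := fin_ne_of_succ hij
    by_cases ha : Antitone v
    · rw [keyA_antitone ha]
      refine piA_eq_self nij (actHom_mono_fixed ?_)
      rw [swapHom_apply, vecSwap_eq_add nij, hv, sub_self, zero_smul, add_zero]
    obtain ⟨k, l, hkl, hlt⟩ := exists_lt_of_not_antitone ha
    have nkl := fin_ne_of_succ hkl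
    have hheight : ∀ {w : Fin n → ℤ} {k l : Fin n}, (k : ℕ) + 1 = l → w k < w l →
        height (vecSwap k l w) < height w := by
      intro w k l hkl hw
      have := height_vecSwap (v := vecSwap k l w) hkl (by rwa [vecSwap_left, vecSwap_right])
      rwa [vecSwap_vecSwap] at this
    have hik : i ≠ k := by
      rintro rfl
      obtain rfl : j = l := Fin.ext (by omega)
      exact hlt.ne hv
    have hjl : j ≠ l := by rintro rfl; exact hik (Fin.ext (by omega))
    rw [keyA_of_lt hkl hlt]
    by_cases hjk : j = k
    · subst hjk
      have nil : i ≠ l := by rintro rfl; omega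
      have h1 : vecSwap j l v i < vecSwap j l v j := by
        rw [vecSwap_left, vecSwap_of_ne nij nil, hv]; exact hlt
      rw [keyA_of_lt hij h1, piA_braid nij nkl nil]
      congr 2
      refine ih _ ((hheight hij h1).trans (hheight hkl hlt)) hkl ?_ rfl
      rw [vecSwap_right, vecSwap_of_ne nil.symm nkl.symm, vecSwap_of_ne nij nil, vecSwap_right]
      exact hv
    by_cases hil : i = l
    · subst hil
      have nkj : k ≠ j := fun h => hjk h.symm
      have h1 : vecSwap k i v i < vecSwap k i v j := by
        rw [vecSwap_right, vecSwap_of_ne nkj.symm nij.symm, ← hv]; exact hlt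
      rw [keyA_of_lt hij h1, ← piA_braid nkl nij nkj]
      congr 2
      refine ih _ ((hheight hij h1).trans (hheight hkl hlt)) hkl ?_ rfl
      rw [vecSwap_left, vecSwap_of_ne nkl nkj, vecSwap_left, vecSwap_of_ne nkj.symm nij.symm]
      exact hv
    rw [piA_comm nij nkl hik hil hjk hjl]
    congr 1
    refine ih _ (hheight hkl hlt) hij ?_ rfl
    rw [vecSwap_of_ne hik hil, vecSwap_of_ne hjk hjl, hv]

end Steps

/-! ### The constant term pairing -/

section Pairing

variable {R : Type*} [CommRing R] {N : ℕ}

theorem laurent_linearMap_ext {M : Type*} [AddCommMonoid M] [Module R M] {F G : Laurent R N →ₗ[R] M}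
    (h : ∀ c, F (mono c) = G (mono c)) (f : Laurent R N) : F f = G f := by
  induction f using AddMonoidAlgebra.induction_linear with
  | zero => simp
  | add f g hf hg => simp [hf, hg]
  | single v r => rw [single_eq_smul_mono, map_smul, map_smul, h]

/-- A vector of natural numbers, as an exponent of a power series. -/
def toExp (a : Fin N → ℕ) : Fin N →₀ ℕ := Finsupp.equivFunOnFinite.symm a

@[simp] theorem toExp_apply (a : Fin N → ℕ) (i : Fin N) : toExp a i = a i := rfl

variable {A : Type*} [CommRing A]

open Classical in
/-- The coefficient of `x^c` in a power series, for an exponent `c` in `ℤ^N`: it vanishes if `c` has a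
negative component. -/
def coeffZ (Ω : MvPowerSeries (Fin N) A) (c : Fin N → ℤ) : A :=
  if ∀ i, 0 ≤ c i then MvPowerSeries.coeff (toExp fun i => (c i).toNat) Ω else 0

theorem coeffZ_natCast (Ω : MvPowerSeries (Fin N) A) (a : Fin N → ℕ) :
    coeffZ Ω (fun i => (a i : ℤ)) = MvPowerSeries.coeff (toExp a) Ω := by
  simp [coeffZ]

theorem coeffZ_of_neg (Ω : MvPowerSeries (Fin N) A) {c : Fin N → ℤ} {i : Fin N} (h : c i < 0) :
    coeffZ Ω c = 0 := by
  unfold coeffZ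
  rw [if_neg]
  push Not
  exact ⟨i, h⟩

theorem coeffZ_cases (c : Fin N → ℤ) :
    (∃ a : Fin N → ℕ, c = fun i => (a i : ℤ)) ∨ ∃ i, c i < 0 := by
  by_cases h : ∀ i, 0 ≤ c i
  · exact .inl ⟨fun i => (c i).toNat, by ext i; simp [h i]⟩
  · push Not at h
    exact .inr h

theorem coeffZ_X_mul (Ω : MvPowerSeries (Fin N) A) (i : Fin N) (c : Fin N → ℤ) :
    coeffZ (MvPowerSeries.X i * Ω) c = coeffZ Ω (c - Pi.single i 1) := by
  classical
  obtain ⟨a, rfl⟩ | ⟨k, hk⟩ := coeffZ_cases c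
  · rw [coeffZ_natCast, MvPowerSeries.X_def, MvPowerSeries.coeff_monomial_mul, one_mul]
    by_cases h : a i = 0
    · rw [if_neg, coeffZ_of_neg (i := i)]
      · simp [h]
      · intro hle
        have := hle i
        simp [h] at this
    · rw [if_pos]
      · have : (fun k => (a k : ℤ)) - Pi.single i 1 =
            fun k => ((a k - (Pi.single i 1 : Fin N → ℕ) k : ℕ) : ℤ) := by
          ext k
          by_cases hk : k = i
          · subst hk; simp; omega
          · simp [hk]
        have hexp : toExp a - Finsupp.single i 1 =
            toExp fun k => a k - (Pi.single i 1 : Fin N → ℕ) k := by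
          ext k
          simp [Finsupp.single_apply, Pi.single_apply, eq_comm]
        rw [this, coeffZ_natCast, hexp]
      · intro k
        by_cases hk : k = i
        · subst hk; simp; omega
        · simp [Ne.symm hk]
  · rw [coeffZ_of_neg _ hk, coeffZ_of_neg (i := k)]
    simp only [Pi.sub_apply, Pi.single_apply]
    split_ifs <;> omega

theorem coeffZ_map (σ : A →+* A) (Ω : MvPowerSeries (Fin N) A) (c : Fin N → ℤ) :
    coeffZ (MvPowerSeries.map σ Ω) c = σ (coeffZ Ω c) := by
  unfold coeffZ
  split_ifs <;> simp

theorem coeffZ_rename_swap (i j : Fin N) (Ω : MvPowerSeries (Fin N) A) (c : Fin N → ℤ) :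
    coeffZ (MvPowerSeries.rename (Equiv.swap i j) Ω) c = coeffZ Ω (vecSwap i j c) := by
  obtain ⟨a, rfl⟩ | ⟨k, hk⟩ := coeffZ_cases c
  · have h1 : vecSwap i j (fun k => (a k : ℤ)) = fun k => ((vecSwap i j a k : ℕ) : ℤ) := rfl
    rw [h1, coeffZ_natCast, coeffZ_natCast]
    have h2 := MvPowerSeries.coeff_embDomain_rename (Equiv.swap i j).toEmbedding Ω
      (toExp (vecSwap i j a))
    have h3 : toExp a = (toExp (vecSwap i j a)).embDomain (Equiv.swap i j).toEmbedding := by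
      ext k
      conv_rhs => rw [← Equiv.swap_apply_self i j k]
      rw [show Equiv.swap i j ((Equiv.swap i j) k) = (Equiv.swap i j).toEmbedding (Equiv.swap i j k)
        from rfl, Finsupp.embDomain_apply_self]
      simp [vecSwap]
    rw [h3]
    exact h2
  · rw [coeffZ_of_neg _ hk, coeffZ_of_neg (i := Equiv.swap i j k)]
    simpa [vecSwap] using hk

variable [Algebra R A]

/-- The constant term in `x` of the product `Ω h` of a power series and a Laurent polynomial. -/
def pairing (Ω : MvPowerSeries (Fin N) A) : Laurent R N →ₗ[R] A :=
  (Finsupp.linearCombination R fun c => coeffZ Ω (-c)) ∘ₗ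
    (AddMonoidAlgebra.coeffLinearEquiv R).toLinearMap

theorem pairing_apply (Ω : MvPowerSeries (Fin N) A) (h : Laurent R N) :
    pairing Ω h = h.coeff.sum fun c r => r • coeffZ Ω (-c) := rfl

theorem pairing_mono (Ω : MvPowerSeries (Fin N) A) (c : Fin N → ℤ) :
    pairing Ω (mono c : Laurent R N) = coeffZ Ω (-c) := by
  rw [pairing_apply, mono, AddMonoidAlgebra.coeff_single, Finsupp.sum_single_index (by simp),
    one_smul]

theorem pairing_add (Ω Ω' : MvPowerSeries (Fin N) A) (h : Laurent R N) :
    pairing (Ω + Ω') h = pairing Ω h + pairing Ω' h := by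
  have := laurent_linearMap_ext (F := pairing (R := R) (Ω + Ω'))
    (G := pairing Ω + pairing Ω') (fun c => ?_) h
  · exact this
  · rw [LinearMap.add_apply, pairing_mono, pairing_mono, pairing_mono]
    unfold coeffZ
    split_ifs <;> simp

theorem pairing_C_mul (a : A) (Ω : MvPowerSeries (Fin N) A) (h : Laurent R N) :
    pairing (MvPowerSeries.C a * Ω) h = a * pairing Ω h := by
  have := laurent_linearMap_ext (F := pairing (R := R) (MvPowerSeries.C a * Ω))
    (G := (LinearMap.mulLeft R a) ∘ₗ pairing Ω) (fun c => ?_) h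
  · exact this
  · rw [LinearMap.comp_apply, LinearMap.mulLeft_apply, pairing_mono, pairing_mono]
    unfold coeffZ
    split_ifs <;> simp

theorem pairing_neg (Ω : MvPowerSeries (Fin N) A) (h : Laurent R N) :
    pairing (-Ω) h = -pairing Ω h := by
  have := pairing_C_mul (-1) Ω h
  rwa [map_neg, map_one, neg_one_mul, neg_one_mul] at this

theorem pairing_sub (Ω Ω' : MvPowerSeries (Fin N) A) (h : Laurent R N) :
    pairing (Ω - Ω') h = pairing Ω h - pairing Ω' h := by
  rw [sub_eq_add_neg, pairing_add, pairing_neg, sub_eq_add_neg]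

theorem pairing_X_mul (i : Fin N) (Ω : MvPowerSeries (Fin N) A) (h : Laurent R N) :
    pairing (MvPowerSeries.X i * Ω) h = pairing Ω (var i * h) := by
  have := laurent_linearMap_ext (F := pairing (R := R) (MvPowerSeries.X i * Ω))
    (G := pairing Ω ∘ₗ LinearMap.mulLeft R (var i)) (fun c => ?_) h
  · exact this
  · rw [LinearMap.comp_apply, LinearMap.mulLeft_apply, pairing_mono, var, mono_mul, pairing_mono,
      coeffZ_X_mul]
    congr 1; abel

theorem pairing_map (σ : A →ₐ[R] A) (Ω : MvPowerSeries (Fin N) A) (h : Laurent R N) :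
    pairing (MvPowerSeries.map (σ : A →+* A) Ω) h = σ (pairing Ω h) := by
  have := laurent_linearMap_ext (F := pairing (R := R) (MvPowerSeries.map (σ : A →+* A) Ω))
    (G := σ.toLinearMap ∘ₗ pairing Ω) (fun c => ?_) h
  · exact this
  · rw [LinearMap.comp_apply, pairing_mono, pairing_mono, coeffZ_map]
    rfl

theorem pairing_rename_swap (i j : Fin N) (Ω : MvPowerSeries (Fin N) A) (h : Laurent R N) :
    pairing (MvPowerSeries.rename (Equiv.swap i j) Ω) h = pairing Ω (actHom (swapHom i j) h) := by
  have := laurent_linearMap_ext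
    (F := pairing (R := R) (MvPowerSeries.rename (Equiv.swap i j) Ω))
    (G := pairing Ω ∘ₗ (actHom (swapHom i j)).toLinearMap) (fun c => ?_) h
  · exact this
  · rw [LinearMap.comp_apply, AlgHom.toLinearMap_apply, actHom_mono, pairing_mono, pairing_mono,
      coeffZ_rename_swap]
    rfl

theorem swap_lt_swap {i j : Fin N} (hij : (i : ℕ) + 1 = j) {a b : Fin N} (hab : a < b)
    (hne : ¬ (a = i ∧ b = j)) : Equiv.swap i j a < Equiv.swap i j b := by
  rw [Equiv.swap_apply_def, Equiv.swap_apply_def]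
  rw [Fin.lt_def] at hab
  simp only [Fin.ext_iff] at *
  rw [Fin.lt_def]
  split_ifs <;> omega

/-- A product over the pairs `a < b` other than `(i, i + 1)` can be reindexed by the transposition of
`i` and `i + 1`. -/
theorem prod_lt_swap {M : Type*} [CommMonoid M] {i j : Fin N} (hij : (i : ℕ) + 1 = j)
    (f g : Fin N × Fin N → M)
    (h : ∀ p : Fin N × Fin N, f p = g (Equiv.swap i j p.1, Equiv.swap i j p.2)) :
    ∏ p : Fin N × Fin N with p.1 < p.2 ∧ ¬(p.1 = i ∧ p.2 = j), f p =
      ∏ p : Fin N × Fin N with p.1 < p.2 ∧ ¬(p.1 = i ∧ p.2 = j), g p := by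
  have nij := fin_ne_of_succ hij
  have hmem : ∀ p : Fin N × Fin N, p.1 < p.2 ∧ ¬(p.1 = i ∧ p.2 = j) →
      Equiv.swap i j p.1 < Equiv.swap i j p.2 ∧
        ¬(Equiv.swap i j p.1 = i ∧ Equiv.swap i j p.2 = j) := by
    rintro ⟨a, b⟩ ⟨h1, h2⟩
    refine ⟨swap_lt_swap hij h1 h2, ?_⟩
    rintro ⟨ha, hb⟩
    rw [Equiv.swap_apply_eq_iff, Equiv.swap_apply_left] at ha
    rw [Equiv.swap_apply_eq_iff, Equiv.swap_apply_right] at hb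
    dsimp only at ha hb h1
    rw [ha, hb, Fin.lt_def] at h1
    omega
  refine Finset.prod_nbij' (fun p => (Equiv.swap i j p.1, Equiv.swap i j p.2))
    (fun p => (Equiv.swap i j p.1, Equiv.swap i j p.2)) ?_ ?_ ?_ ?_ ?_
  · intro p hp
    simpa using hmem p (by simpa using hp)
  · intro p hp
    simpa using hmem p (by simpa using hp)
  · intro p _; simp
  · intro p _; simp
  · intro p _; exact h p

theorem prod_lt_split {M : Type*} [CommMonoid M] {i j : Fin N} (hij : (i : ℕ) + 1 = j)
    (f : Fin N × Fin N → M) :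
    ∏ p : Fin N × Fin N with p.1 < p.2, f p =
      f (i, j) * ∏ p : Fin N × Fin N with p.1 < p.2 ∧ ¬(p.1 = i ∧ p.2 = j), f p := by
  rw [← Finset.mul_prod_erase (Finset.univ.filter fun p : Fin N × Fin N => p.1 < p.2) f
    (a := (i, j)) (by simpa using Fin.lt_def.2 (by omega))]
  congr 2
  ext ⟨a, b⟩
  simp [and_comm]

/-- The Weyl denominator `∏_{i<j} (1 - x_i / x_j)`. -/
def weylDen (R : Type*) [CommRing R] (N : ℕ) : Laurent R N :=
  ∏ p : Fin N × Fin N with p.1 < p.2, (1 - mono (rootA p.2 p.1))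

theorem actHom_rootA (i j k l : Fin N) :
    actHom (swapHom i j) (mono (rootA k l) : Laurent R N) =
      mono (rootA (Equiv.swap i j k) (Equiv.swap i j l)) := by
  rw [actHom_mono]
  congr 1
  ext m
  have h : ∀ a b : Fin N, (Equiv.swap i j a = b) = (a = Equiv.swap i j b) := fun a b =>
    propext (Equiv.swap_apply_eq_iff)
  rw [swapHom_apply]
  simp only [vecSwap, rootA, Pi.sub_apply, Pi.single_apply, h]

/-- The Weyl denominator is the product of one factor and an element symmetric in `x_i`, `x_{i+1}`. -/
theorem weylDen_split {i j : Fin N} (hij : (i : ℕ) + 1 = j) : ∃ D : Laurent R N,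
    weylDen R N = (1 - mono (rootA j i)) * D ∧ actHom (swapHom i j) D = D := by
  refine ⟨_, prod_lt_split hij _, ?_⟩
  rw [map_prod]
  refine prod_lt_swap hij _ _ fun p => ?_
  rw [map_sub, map_one, actHom_rootA]

theorem mono_rootA_mul_swap (i j : Fin N) :
    (mono (rootA j i) : Laurent R N) * mono (rootA i j) = 1 := by
  rw [mono_mul]; unfold rootA; rw [sub_add_sub_cancel, sub_self, mono_zero]

/-- With respect to the pairing `(f, g) ↦ CT (f g ∏_{i<j} (1 - x_i / x_j))`, the isobaric divided
differences are self-adjoint. The value `Ω'` of the divided difference at the power series `Ω` is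
given by the equation that defines it. -/
theorem pairing_piA {i j : Fin N} (hij : (i : ℕ) + 1 = j) {Ω Ω' : MvPowerSeries (Fin N) A}
    (h : (MvPowerSeries.X i - MvPowerSeries.X j) * Ω' = MvPowerSeries.X i * Ω
      - MvPowerSeries.X j * MvPowerSeries.rename (Equiv.swap i j) Ω) (g : Laurent R N) :
    pairing Ω (piA i j g * weylDen R N) = pairing Ω' (g * weylDen R N) := by
  have nij := fin_ne_of_succ hij
  obtain ⟨D, hD, hfix⟩ := weylDen_split (R := R) hij
  have hj := var_mul_varInv (R := R) j
  have hr : (mono (rootA j i) : Laurent R N) * var j = var i := by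
    rw [mul_comm, var_mul_mono_rootA]
  have ht := mono_rootA_mul_swap (R := R) i j
  have e1 : g * weylDen R N = var i * (-(varInv j * (g * D))) - var j * (-(varInv j * (g * D))) := by
    rw [hD]
    linear_combination (-(g * D) + g * D * mono (rootA j i)) * hj - varInv j * (g * D) * hr
  have e2 : var j * (-(varInv j * (g * D))) = -(g * D) := by linear_combination -(g * D) * hj
  have e3 : var i * (-(varInv j * (g * D))) = -(mono (rootA j i) * (g * D)) := by
    linear_combination -(mono (rootA j i) * (g * D)) * hj + varInv j * (g * D) * hr
  have e4 := piA_spec nij g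
  have e5 : actHom (swapHom i j) (-(g * D)) = -(actHom (swapHom i j) g * D) := by
    rw [map_neg, map_mul, hfix]
  rw [e1, map_sub, ← pairing_X_mul, ← pairing_X_mul, ← pairing_sub, ← sub_mul, h, pairing_sub,
    pairing_X_mul, pairing_X_mul, pairing_rename_swap, e2, e3, ← map_sub, e5, hD]
  congr 1
  linear_combination (-mono (rootA j i) * D) * e4 +
    (D * actHom (swapHom i j) g - D * piA i j g) * ht

end Pairing

/-! ### The reproducing property of the kernel of type `A` -/

section Reproducing

variable {R : Type*} [CommRing R] {N : ℕ} {A : Type*} [CommRing A]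

/-- The specialization of `x_j` to `0` in a power series. -/
def killX (j : Fin N) : MvPowerSeries (Fin N) A →ₐ[A] MvPowerSeries (Fin N) A :=
  (MvPowerSeries.rename (Function.Embedding.subtype (· ≠ j))).comp
    (MvPowerSeries.killCompl (Function.Embedding.subtype (· ≠ j)))

theorem killX_C (j : Fin N) (a : A) : killX j (MvPowerSeries.C a) = MvPowerSeries.C a := by
  simp [killX]

theorem killX_X {i j : Fin N} (h : i ≠ j) :
    killX j (MvPowerSeries.X i : MvPowerSeries (Fin N) A) = MvPowerSeries.X i := by
  have h1 := MvPowerSeries.killCompl_X (R := A) (e := Function.Embedding.subtype (· ≠ j)) ⟨i, h⟩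
  have h2 : (Function.Embedding.subtype (· ≠ j)) ⟨i, h⟩ = i := rfl
  rw [h2] at h1
  rw [killX, AlgHom.comp_apply, h1, MvPowerSeries.rename_X, h2]

theorem coeffZ_of_killX {j : Fin N} {G : MvPowerSeries (Fin N) A} (hG : killX j G = G)
    {c : Fin N → ℤ} (hc : c j ≠ 0) : coeffZ G c = 0 := by
  obtain ⟨a, rfl⟩ | ⟨k, hk⟩ := coeffZ_cases c
  · rw [coeffZ_natCast, ← hG, killX, AlgHom.comp_apply]
    refine MvPowerSeries.coeff_rename_eq_zero _ _ ?_
    rintro ⟨y, hy⟩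
    have h1 : toExp a j = 0 := by
      rw [← hy, Finsupp.mapDomain_of_notMem_range]
      simp
    exact hc (by simpa using h1)
  · exact coeffZ_of_neg _ hk

/-- The map on exponents which makes one component zero. -/
def zeroHom (j : Fin N) : (Fin N → ℤ) →+ (Fin N → ℤ) where
  toFun c := fun k => if k = j then 0 else c k
  map_zero' := by ext; simp
  map_add' _ _ := by ext k; by_cases h : k = j <;> simp [h]

variable [Algebra R A]

theorem pairing_geometric {j : Fin N} {z : A} {G Ω : MvPowerSeries (Fin N) A}
    (hG : killX j G = G) (hΩ : (1 - MvPowerSeries.X j * MvPowerSeries.C z) * Ω = G) (c : ℕ)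
    {h : Laurent R N} (hh : actHom (zeroHom j) h = h) :
    pairing Ω (mono (Pi.single j (-(c : ℤ))) * h) = z ^ c * pairing G h := by
  have hΩ' : Ω = G + MvPowerSeries.C z * (MvPowerSeries.X j * Ω) := by linear_combination hΩ
  induction c with
  | zero =>
    rw [Nat.cast_zero, neg_zero, Pi.single_zero, mono_zero, one_mul, pow_zero, one_mul, hΩ',
      pairing_add, pairing_C_mul, pairing_X_mul]
    have h0 : pairing Ω (var j * h) = 0 := by
      rw [← hh]
      have := laurent_linearMap_ext (F := pairing Ω ∘ₗ LinearMap.mulLeft R (var j) ∘ₗ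
        (actHom (zeroHom j)).toLinearMap) (G := 0) (fun c => ?_) h
      · exact this
      · simp only [LinearMap.comp_apply, AlgHom.toLinearMap_apply, LinearMap.mulLeft_apply,
          actHom_mono, var, mono_mul, pairing_mono, LinearMap.zero_apply]
        refine coeffZ_of_neg (i := j) _ ?_
        simp [zeroHom]
    rw [h0, mul_zero, add_zero]
  | succ c ih =>
    have h0 : pairing G (mono (Pi.single j (-((c + 1 : ℕ) : ℤ))) * h) = 0 := by
      rw [← hh]
      have := laurent_linearMap_ext (F := pairing G ∘ₗ
        LinearMap.mulLeft R (mono (Pi.single j (-((c + 1 : ℕ) : ℤ)))) ∘ₗ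
        (actHom (zeroHom j)).toLinearMap) (G := 0) (fun c => ?_) h
      · exact this
      · simp only [LinearMap.comp_apply, AlgHom.toLinearMap_apply, LinearMap.mulLeft_apply,
          actHom_mono, mono_mul, pairing_mono, LinearMap.zero_apply]
        refine coeffZ_of_killX (j := j) hG ?_
        simp [zeroHom]
        omega
    have h1 : var j * (mono (Pi.single j (-((c + 1 : ℕ) : ℤ))) * h) =
        mono (Pi.single j (-(c : ℤ))) * h := by
      rw [← mul_assoc, var, mono_mul, ← Pi.single_add]
      congr 3
      push_cast
      ring
    rw [hΩ', pairing_add, pairing_C_mul, pairing_X_mul, h0, h1, ih, zero_add, pow_succ]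
    ring

/-- Taking the constant term in `x_j` against `1 / (1 - x_j z)` substitutes `z` for `1 / x_j`. -/
theorem pairing_substitute {j : Fin N} {z : A} {U : MvPowerSeries (Fin N) A}
    (hU : (1 - MvPowerSeries.X j * MvPowerSeries.C z) * U = 1) (S : Finset (Fin N)) (hS : j ∉ S)
    {G : MvPowerSeries (Fin N) A} (hG : killX j G = G) (c : ℕ)
    {h : Laurent R N} (hh : actHom (zeroHom j) h = h) :
    pairing (U * G) (mono (Pi.single j (-(c : ℤ))) * ((∏ i ∈ S, (1 - mono (rootA j i))) * h)) =
      z ^ c * pairing ((∏ i ∈ S, (1 - MvPowerSeries.X i * MvPowerSeries.C z)) * G) h := by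
  induction S using Finset.induction_on generalizing c h with
  | empty =>
    rw [Finset.prod_empty, Finset.prod_empty, one_mul, one_mul]
    exact pairing_geometric hG (by rw [← mul_assoc, hU, one_mul]) c hh
  | insert i S hi ih =>
    have hjS : j ∉ S := fun h => hS (Finset.mem_insert_of_mem h)
    have hij : i ≠ j := fun h => hS (h ▸ Finset.mem_insert_self _ _)
    have hvar : actHom (zeroHom j) (var i * h) = var i * h := by
      rw [map_mul, hh, var, actHom_mono]
      congr 2
      ext k
      by_cases hk : k = j
      · subst hk; simp [zeroHom, hij.symm]
      · simp [zeroHom, hk]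
    have h1 := ih hjS c hh
    have h2 := ih hjS (c + 1) hvar
    have h3 : (mono (Pi.single j (-(c : ℤ))) : Laurent R N) * mono (rootA j i) =
        mono (Pi.single j (-((c + 1 : ℕ) : ℤ))) * var i := by
      rw [var, mono_mul, mono_mul]
      congr 1
      ext k
      simp only [rootA, Pi.add_apply, Pi.sub_apply, Pi.single_apply]
      split_ifs <;> push_cast <;> ring
    have h4 : mono (Pi.single j (-(c : ℤ))) * ((∏ i ∈ insert i S, (1 - mono (rootA j i))) * h) =
        mono (Pi.single j (-(c : ℤ))) * ((∏ i ∈ S, (1 - mono (rootA j i))) * h)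
        - mono (Pi.single j (-((c + 1 : ℕ) : ℤ))) *
          ((∏ i ∈ S, (1 - mono (rootA j i))) * (var i * h)) := by
      rw [Finset.prod_insert hi]
      linear_combination -((∏ i ∈ S, (1 - mono (rootA j i))) * h) * h3
    have h5 : (∏ i ∈ insert i S, (1 - MvPowerSeries.X i * MvPowerSeries.C z)) * G =
        (∏ i ∈ S, (1 - MvPowerSeries.X i * MvPowerSeries.C z)) * G
        - MvPowerSeries.C z * (MvPowerSeries.X i *
          ((∏ i ∈ S, (1 - MvPowerSeries.X i * MvPowerSeries.C z)) * G)) := by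
      rw [Finset.prod_insert hi]
      ring
    rw [h4, map_sub, h1, h2, h5, pairing_sub, pairing_C_mul, pairing_X_mul, pow_succ]
    ring

/-- The inverse of `1 - x_i z`. -/
def geom (i : Fin N) (z : A) : MvPowerSeries (Fin N) A :=
  Ring.inverse (1 - MvPowerSeries.X i * MvPowerSeries.C z)

theorem isUnit_one_sub_X_mul (i : Fin N) (z : A) :
    IsUnit (1 - MvPowerSeries.X i * MvPowerSeries.C z : MvPowerSeries (Fin N) A) := by
  rw [MvPowerSeries.isUnit_iff_constantCoeff]
  simp

theorem one_sub_mul_geom (i : Fin N) (z : A) :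
    (1 - MvPowerSeries.X i * MvPowerSeries.C z) * geom i z = 1 :=
  Ring.mul_inverse_cancel _ (isUnit_one_sub_X_mul i z)

theorem killX_geom {i j : Fin N} (h : i ≠ j) (z : A) : killX j (geom i z) = geom i z := by
  have h1 := congrArg (killX j) (one_sub_mul_geom i z)
  rw [map_mul, map_sub, map_one, map_mul, killX_X h, killX_C] at h1
  exact (isUnit_one_sub_X_mul i z).mul_left_cancel (h1.trans (one_sub_mul_geom i z).symm)

/-- The kernel of type `A` is a reproducing kernel for the pairing. -/
theorem pairing_kernelA (z : Fin N → A) (v : Fin N → ℕ) :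
    pairing (∏ p : Fin N × Fin N with (p.1 : ℕ) + p.2 < N, geom p.1 (z p.2))
      (mono (fun i => -(v i : ℤ)) * weylDen R N) = ∏ i, z (Fin.rev i) ^ v i := by
  -- The variables are eliminated from the last one to the first one.
  have key : ∀ t : ℕ, t ≤ N →
      pairing (∏ p : Fin N × Fin N with (p.1 : ℕ) + p.2 < N ∧ (p.1 : ℕ) < t ∧ N ≤ p.2 + t,
          geom p.1 (z p.2))
        (mono (fun i => if (i : ℕ) < t then -(v i : ℤ) else 0) *
          ∏ p : Fin N × Fin N with p.1 < p.2 ∧ (p.2 : ℕ) < t,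
            (1 - mono (rootA p.2 p.1) : Laurent R N)) =
        ∏ i : Fin N with i.val < t, z (Fin.rev i) ^ v i := by
    intro t ht
    induction t with
    | zero =>
      have h1 : (mono (fun i => if (i : ℕ) < 0 then -(v i : ℤ) else 0) : Laurent R N) = mono 0 := by
        congr 1
      simp only [not_lt_zero, and_false, false_and, Finset.filter_false, Finset.prod_empty, mul_one]
      rw [show (fun i : Fin N => if False then -(v i : ℤ) else 0) = 0 by ext; simp, pairing_mono]
      have := coeffZ_natCast (1 : MvPowerSeries (Fin N) A) 0
      have h0 : (-0 : Fin N → ℤ) = fun i => (((0 : Fin N → ℕ) i : ℕ) : ℤ) := by ext; simp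
      rw [h0, this]
      have h0' : toExp (0 : Fin N → ℕ) = 0 := by ext; simp
      rw [h0']
      simp
    | succ t ih =>
      have ht' : t < N := ht
      set j : Fin N := ⟨t, ht'⟩ with hj
      have hS : j ∉ (Finset.univ.filter fun i : Fin N => (i : ℕ) < t) := by simp [hj]
      have hU := one_sub_mul_geom j (z (Fin.rev j))
      set G : MvPowerSeries (Fin N) A := (∏ i : Fin N with i.val < t, geom i (z (Fin.rev j))) *
        ∏ p : Fin N × Fin N with (p.1 : ℕ) + p.2 < N ∧ (p.1 : ℕ) < t ∧ N ≤ p.2 + t,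
          geom p.1 (z p.2) with hGdef
      have hG : killX j G = G := by
        rw [hGdef, map_mul, map_prod, map_prod]
        congr 1
        · refine Finset.prod_congr rfl fun i hi => killX_geom ?_ _
          rintro rfl
          exact hS hi
        · refine Finset.prod_congr rfl fun p hp => killX_geom ?_ _
          have := (Finset.mem_filter.1 hp).2.2.1
          intro h
          rw [h] at this
          simp [hj] at this
      set h0 : Laurent R N := mono (fun i => if (i : ℕ) < t then -(v i : ℤ) else 0) *
          ∏ p : Fin N × Fin N with p.1 < p.2 ∧ (p.2 : ℕ) < t, (1 - mono (rootA p.2 p.1)) with hh0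
      have hh : actHom (zeroHom j) h0 = h0 := by
        rw [hh0, map_mul, map_prod, actHom_mono]
        congr 1
        · congr 1
          ext k
          by_cases hk : k = j
          · subst hk; simp [zeroHom, hj]
          · simp [zeroHom, hk]
        · refine Finset.prod_congr rfl fun p hp => ?_
          obtain ⟨h1, h2⟩ := (Finset.mem_filter.1 hp).2
          rw [map_sub, map_one, actHom_mono]
          congr 2
          ext k
          by_cases hk : k = j
          · subst hk
            have h3 : j ≠ p.2 := by intro h; rw [← h] at h2; simp [hj] at h2
            have h4 : j ≠ p.1 := by
              intro h; rw [← h, Fin.lt_def] at h1; simp [hj] at h1; omega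
            simp [zeroHom, rootA, h3, h4]
          · simp [zeroHom, hk]
      have hmain := pairing_substitute hU _ hS hG (v j) hh
      have hker : ∏ p : Fin N × Fin N with (p.1 : ℕ) + p.2 < N ∧ (p.1 : ℕ) < t + 1 ∧ N ≤ p.2 + (t + 1),
          geom p.1 (z p.2) = geom j (z (Fin.rev j)) * G := by
        have hset : (Finset.univ.filter fun p : Fin N × Fin N =>
            (p.1 : ℕ) + p.2 < N ∧ (p.1 : ℕ) < t + 1 ∧ N ≤ p.2 + (t + 1)) =
            ((insert j (Finset.univ.filter fun i : Fin N => (i : ℕ) < t)).map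
              (Function.Embedding.sectL _ (Fin.rev j))) ∪
            (Finset.univ.filter fun p : Fin N × Fin N =>
              (p.1 : ℕ) + p.2 < N ∧ (p.1 : ℕ) < t ∧ N ≤ p.2 + t) := by
          ext ⟨a, b⟩
          simp only [Finset.mem_filter, Finset.mem_univ, true_and, Finset.mem_union, Finset.mem_map,
            Finset.mem_insert, Function.Embedding.sectL_apply, Prod.mk.injEq,
            Fin.ext_iff, Fin.val_rev, hj]
          constructor
          · rintro ⟨h1, h2, h3⟩
            by_cases h4 : (b : ℕ) = N - (t + 1)
            · exact .inl ⟨a, by omega, rfl, h4.symm⟩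
            · exact .inr ⟨h1, by omega, by omega⟩
          · rintro (⟨a', h1, h2, h3⟩ | ⟨h1, h2, h3⟩)
            · omega
            · omega
        rw [hset, Finset.prod_union, Finset.prod_map, Finset.prod_insert hS, mul_assoc, hGdef]
        · rfl
        · rw [Finset.disjoint_left]
          rintro ⟨a, b⟩ h1 h2
          simp only [Finset.mem_filter, Finset.mem_univ, true_and, Finset.mem_map,
            Finset.mem_insert, Function.Embedding.sectL_apply, Prod.mk.injEq,
            Fin.ext_iff, Fin.val_rev, hj] at h1 h2
          obtain ⟨a', h1, h3, h4⟩ := h1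
          omega
      have hlau : (mono (fun i => if (i : ℕ) < t + 1 then -(v i : ℤ) else 0) : Laurent R N) *
          ∏ p : Fin N × Fin N with p.1 < p.2 ∧ (p.2 : ℕ) < t + 1, (1 - mono (rootA p.2 p.1)) =
          mono (Pi.single j (-(v j : ℤ))) *
            ((∏ i : Fin N with i.val < t, (1 - mono (rootA j i))) * h0) := by
        have hset : (Finset.univ.filter fun p : Fin N × Fin N => p.1 < p.2 ∧ (p.2 : ℕ) < t + 1) =
            ((Finset.univ.filter fun i : Fin N => (i : ℕ) < t).map
              (Function.Embedding.sectL _ j)) ∪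
            (Finset.univ.filter fun p : Fin N × Fin N => p.1 < p.2 ∧ (p.2 : ℕ) < t) := by
          ext ⟨a, b⟩
          simp only [Finset.mem_filter, Finset.mem_univ, true_and, Finset.mem_union, Finset.mem_map,
            Function.Embedding.sectL_apply, Prod.mk.injEq, Fin.ext_iff, Fin.lt_def, hj]
          constructor
          · rintro ⟨h1, h2⟩
            by_cases h4 : (b : ℕ) = t
            · exact .inl ⟨a, by omega, rfl, h4.symm⟩
            · exact .inr ⟨h1, by omega⟩
          · rintro (⟨a', h1, h2, h3⟩ | ⟨h1, h2⟩) <;> omega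
        have hexp : (fun i : Fin N => if (i : ℕ) < t + 1 then -(v i : ℤ) else 0) =
            Pi.single j (-(v j : ℤ)) + fun i : Fin N => if (i : ℕ) < t then -(v i : ℤ) else 0 := by
          ext i
          by_cases hi : i = j
          · subst hi; simp [hj]
          · have : (i : ℕ) ≠ t := fun h => hi (Fin.ext h)
            have h2 : ((i : ℕ) < t + 1) = ((i : ℕ) < t) := propext ⟨by omega, by omega⟩
            simp [hi, h2]
        rw [hset, Finset.prod_union, Finset.prod_map, hexp, ← mono_mul, hh0]
        · simp only [Function.Embedding.sectL_apply]
          ring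
        · rw [Finset.disjoint_left]
          rintro ⟨a, b⟩ h1 h2
          simp only [Finset.mem_filter, Finset.mem_univ, true_and, Finset.mem_map,
            Function.Embedding.sectL_apply, Prod.mk.injEq, Fin.ext_iff, hj] at h1 h2
          obtain ⟨a', h1, h3, h4⟩ := h1
          omega
      have hprod : ∏ i : Fin N with i.val < t + 1, z (Fin.rev i) ^ v i =
          z (Fin.rev j) ^ v j * ∏ i : Fin N with i.val < t, z (Fin.rev i) ^ v i := by
        rw [← Finset.prod_insert (f := fun i => z (Fin.rev i) ^ v i) hS]
        congr 1
        ext i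
        simp [hj, Fin.ext_iff]
        omega
      rw [hker, hlau, hmain, hprod, ← ih (by omega), hGdef, ← mul_assoc, ← Finset.prod_mul_distrib,
        Finset.prod_congr rfl (fun i _ => one_sub_mul_geom i (z (Fin.rev j))), Finset.prod_const_one,
        one_mul]
  have h := key N le_rfl
  have e1 : (Finset.univ.filter fun p : Fin N × Fin N =>
      (p.1 : ℕ) + p.2 < N ∧ (p.1 : ℕ) < N ∧ N ≤ p.2 + N) =
      Finset.univ.filter fun p : Fin N × Fin N => (p.1 : ℕ) + p.2 < N := by
    ext p; simp
  have e2 : (Finset.univ.filter fun p : Fin N × Fin N => p.1 < p.2 ∧ (p.2 : ℕ) < N) =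
      Finset.univ.filter fun p : Fin N × Fin N => p.1 < p.2 := by
    ext p; simp
  have e3 : (Finset.univ.filter fun i : Fin N => (i : ℕ) < N) = Finset.univ := by
    ext i; simp
  have e4 : (fun i : Fin N => if (i : ℕ) < N then -(v i : ℤ) else 0) = fun i => -(v i : ℤ) := by
    ext i; simp
  rw [e1, e2, e3, e4] at h
  exact h

end Reproducing

/-! ### Norms of exponents -/

section Norms

variable {R : Type*} [CommRing R] {N : ℕ}

theorem piA_add {i j : Fin N} (hij : i ≠ j) (f g : Laurent R N) :
    piA i j (f + g) = piA i j f + piA i j g := by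
  refine piA_eq hij ?_
  rw [map_add]
  linear_combination piA_spec hij f + piA_spec hij g

theorem piA_smul {i j : Fin N} (hij : i ≠ j) (r : R) (f : Laurent R N) :
    piA i j (r • f) = r • piA i j f := by
  refine piA_eq hij ?_
  rw [map_smul, mul_smul_comm, mul_smul_comm, piA_spec hij, smul_sub]

/-- The operator `piA` as a linear map. -/
def piALin {i j : Fin N} (hij : i ≠ j) : Laurent R N →ₗ[R] Laurent R N where
  toFun := piA i j
  map_add' := piA_add hij
  map_smul' := piA_smul hij

@[simp] theorem piALin_apply {i j : Fin N} (hij : i ≠ j) (f : Laurent R N) :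
    piALin hij f = piA i j f := rfl

theorem piA_mono_of_eq_add {i j : Fin N} (hij : i ≠ j) {c : Fin N → ℤ} {m : ℕ} (h : c i = c j + m) :
    piA i j (mono c : Laurent R N) =
      ∑ k ∈ Finset.range (m + 1), mono (c + (k : ℤ) • rootA i j) := by
  refine piA_eq hij ?_
  have h1 : ∀ k : ℕ, (mono (c + (k : ℤ) • rootA i j) : Laurent R N) =
      mono c * mono (rootA i j) ^ k := by
    intro k
    rw [mono_pow, mono_mul, natCast_zsmul]
  have h2 : (actHom (swapHom i j) (mono c) : Laurent R N) = mono c * mono (rootA i j) ^ m := by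
    rw [actHom_mono, swapHom_apply, vecSwap_eq_add hij, ← h1, h]
    congr 3
    ring
  rw [Finset.sum_congr rfl fun k _ => h1 k, ← Finset.mul_sum, h2]
  linear_combination mono c * mul_neg_geom_sum (mono (rootA i j) : Laurent R N) (m + 1)

/-- The squared Euclidean norm of an exponent. -/
def normSq (c : Fin N → ℤ) : ℤ := ∑ k, c k ^ 2

theorem normSq_vecSwap (i j : Fin N) (c : Fin N → ℤ) : normSq (vecSwap i j c) = normSq c :=
  Equiv.sum_comp (Equiv.swap i j) fun l => c l ^ 2

theorem normSq_neg (c : Fin N → ℤ) : normSq (-c) = normSq c := by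
  simp [normSq]

theorem normSq_add (b c : Fin N → ℤ) : normSq (b + c) = normSq b + 2 * ∑ k, b k * c k + normSq c := by
  simp only [normSq, Finset.mul_sum, ← Finset.sum_add_distrib, Pi.add_apply]
  exact Finset.sum_congr rfl fun k _ => by ring

theorem sum_mul_rootA (i j : Fin N) (c : Fin N → ℤ) : ∑ k, c k * rootA i j k = c j - c i := by
  simp only [rootA, Pi.sub_apply, mul_sub, Finset.sum_sub_distrib, Pi.single_apply, mul_ite, mul_one,
    mul_zero, Finset.sum_ite_eq', Finset.mem_univ, if_true]

theorem sum_rootA (i j : Fin N) : ∑ k, rootA i j k = 0 := by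
  simpa using sum_mul_rootA i j 1

theorem normSq_add_smul_rootA {i j : Fin N} (hij : i ≠ j) (c : Fin N → ℤ) (k : ℤ) :
    normSq (c + k • rootA i j) = normSq c + 2 * k * (c j - c i) + 2 * k ^ 2 := by
  have h1 : ∑ l, c l * (k • rootA i j) l = k * (c j - c i) := by
    rw [← sum_mul_rootA, Finset.mul_sum]
    exact Finset.sum_congr rfl fun l _ => by simp only [Pi.smul_apply, smul_eq_mul]; ring
  have h2 : normSq (k • rootA i j) = 2 * k ^ 2 := by
    have : normSq (k • rootA i j) = k ^ 2 * ∑ l, rootA i j l * rootA i j l := by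
      rw [normSq, Finset.mul_sum]
      exact Finset.sum_congr rfl fun l _ => by simp only [Pi.smul_apply, smul_eq_mul]; ring
    rw [this, sum_mul_rootA]
    simp [rootA, hij, hij.symm]
    ring
  rw [normSq_add, h1, h2]
  ring

theorem sum_add_smul_rootA (i j : Fin N) (c : Fin N → ℤ) (k : ℤ) :
    ∑ l, (c + k • rootA i j) l = ∑ l, c l := by
  simp only [Pi.add_apply, Pi.smul_apply, smul_eq_mul, Finset.sum_add_distrib, ← Finset.mul_sum,
    sum_rootA, mul_zero, add_zero]

/-- The Laurent polynomials whose exponents lie in the set `S`. -/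
def monoSpan (R : Type*) [CommRing R] {N : ℕ} (S : Set (Fin N → ℤ)) : Submodule R (Laurent R N) :=
  Submodule.span R (mono '' S)

theorem mono_mem_monoSpan {S : Set (Fin N → ℤ)} {c : Fin N → ℤ} (h : c ∈ S) :
    mono c ∈ monoSpan R S :=
  Submodule.subset_span ⟨c, h, rfl⟩

theorem monoSpan_mono {S T : Set (Fin N → ℤ)} (h : S ⊆ T) : monoSpan R S ≤ monoSpan R T :=
  Submodule.span_mono (Set.image_mono h)

theorem monoSpan_induction {S : Set (Fin N → ℤ)} {p : Laurent R N → Prop}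
    (h1 : ∀ c ∈ S, p (mono c)) (h0 : p 0) (hadd : ∀ f g, p f → p g → p (f + g))
    (hsmul : ∀ (r : R) f, p f → p (r • f)) {f : Laurent R N} (hf : f ∈ monoSpan R S) : p f := by
  refine Submodule.span_induction (p := fun f _ => p f) ?_ h0 (fun f g _ _ => hadd f g)
    (fun r f _ => hsmul r f) hf
  rintro _ ⟨c, hc, rfl⟩
  exact h1 c hc

theorem coeff_eq_zero_of_mem_monoSpan {S : Set (Fin N → ℤ)} {f : Laurent R N}
    (hf : f ∈ monoSpan R S) {c : Fin N → ℤ} (hc : c ∉ S) : f.coeff c = 0 := by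
  classical
  refine monoSpan_induction (p := fun f => f.coeff c = 0) ?_ ?_ ?_ ?_ hf
  · intro b hb
    rw [coeff_mono, if_neg]
    rintro rfl
    exact hc hb
  · rfl
  · intro f g hf hg
    rw [AddMonoidAlgebra.coeff_add, Finsupp.add_apply, hf, hg, add_zero]
  · intro r f hf
    rw [AddMonoidAlgebra.coeff_smul, Finsupp.smul_apply, hf, smul_zero]

theorem mul_mem_monoSpan {S T U : Set (Fin N → ℤ)} (h : ∀ b ∈ S, ∀ c ∈ T, b + c ∈ U)
    {f g : Laurent R N} (hf : f ∈ monoSpan R S) (hg : g ∈ monoSpan R T) : f * g ∈ monoSpan R U := by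
  refine monoSpan_induction (p := fun f => f * g ∈ monoSpan R U) ?_ ?_ ?_ ?_ hf
  · intro b hb
    refine monoSpan_induction (p := fun g => mono b * g ∈ monoSpan R U) ?_ ?_ ?_ ?_ hg
    · intro c hc
      rw [mono_mul]
      exact mono_mem_monoSpan (h b hb c hc)
    · simp
    · intro f g hf hg
      rw [mul_add]
      exact add_mem hf hg
    · intro r f hf
      rw [mul_smul_comm]
      exact Submodule.smul_mem _ r hf
  · simp
  · intro f g hf hg
    rw [add_mul]
    exact add_mem hf hg
  · intro r f hf
    rw [smul_mul_assoc]
    exact Submodule.smul_mem _ r hf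

/-- The exponents of norm at most `M` on the hyperplane of vectors with sum `d`. -/
def ball (N : ℕ) (M d : ℤ) : Set (Fin N → ℤ) := {c | normSq c ≤ M ∧ ∑ k, c k = d}

/-- The exponents that occur in `π_i (x^c)` apart from `c` and its reflection are shorter than `c`. -/
theorem piA_mono_eq {i j : Fin N} (hij : i ≠ j) {c : Fin N → ℤ} (h : c j ≤ c i) :
    ∃ g ∈ monoSpan R (ball N (normSq c - 1) (∑ k, c k)), piA i j (mono c) =
      mono c + (if c i = c j then 0 else mono (vecSwap i j c)) + g := by
  obtain ⟨m, hm⟩ : ∃ m : ℕ, c i = c j + m := ⟨(c i - c j).toNat, by omega⟩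
  rw [piA_mono_of_eq_add hij hm]
  cases m with
  | zero => exact ⟨0, zero_mem _, by simp [hm]⟩
  | succ m =>
    refine ⟨∑ k ∈ Finset.range m, mono (c + ((k + 1 : ℕ) : ℤ) • rootA i j), ?_, ?_⟩
    · refine sum_mem fun k hk => mono_mem_monoSpan ⟨?_, sum_add_smul_rootA _ _ _ _⟩
      rw [normSq_add_smul_rootA hij, hm]
      have hk : k < m := Finset.mem_range.1 hk
      have h1 : (0 : ℤ) ≤ (k + 1) * (m - k - 1) := mul_nonneg (by omega) (by omega)
      push_cast
      nlinarith
    · rw [Finset.sum_range_succ, Finset.sum_range_succ', if_neg (by omega), vecSwap_eq_add hij, hm]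
      simp only [Nat.cast_zero, zero_smul, add_zero, add_sub_cancel_left]
      ring

theorem piA_mono_vecSwap {i j : Fin N} (hij : i ≠ j) (c : Fin N → ℤ) :
    piA i j (mono (vecSwap i j c) : Laurent R N) =
      mono c + mono (vecSwap i j c) - piA i j (mono c) := by
  rw [eq_sub_iff_add_eq, ← piA_add hij, add_comm (mono (vecSwap i j c))]
  refine piA_eq_self hij ?_
  rw [map_add, actHom_mono, actHom_mono, swapHom_apply, swapHom_apply, vecSwap_vecSwap, add_comm]

theorem ball_subset {M M' d : ℤ} (h : M ≤ M') : ball N M d ⊆ ball N M' d :=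
  fun _ hc => ⟨hc.1.trans h, hc.2⟩

theorem vecSwap_mem_ball {i j : Fin N} {c : Fin N → ℤ} {M d : ℤ} (h : c ∈ ball N M d) :
    vecSwap i j c ∈ ball N M d :=
  ⟨(normSq_vecSwap i j c).le.trans h.1, (Equiv.sum_comp (Equiv.swap i j) c).trans h.2⟩

theorem piA_mem_monoSpan {i j : Fin N} (hij : i ≠ j) {M d : ℤ} {f : Laurent R N}
    (hf : f ∈ monoSpan R (ball N M d)) : piA i j f ∈ monoSpan R (ball N M d) := by
  have key : ∀ c ∈ ball N M d, c j ≤ c i →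
      (piA i j (mono c) : Laurent R N) ∈ monoSpan R (ball N M d) := by
    intro c hc h
    obtain ⟨g, hg, hgc⟩ := piA_mono_eq (R := R) hij h
    rw [hgc]
    refine add_mem (add_mem (mono_mem_monoSpan hc) ?_) ?_
    · split_ifs
      · exact zero_mem _
      · exact mono_mem_monoSpan (vecSwap_mem_ball hc)
    · refine monoSpan_mono ?_ hg
      rw [hc.2]
      exact ball_subset (by have := hc.1; omega)
  refine monoSpan_induction (p := fun f => piA i j f ∈ monoSpan R (ball N M d)) ?_ ?_ ?_ ?_ hf
  · intro c hc
    obtain h | h := le_total (c j) (c i)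
    · exact key c hc h
    · have hc' := vecSwap_mem_ball (i := i) (j := j) hc
      rw [← vecSwap_vecSwap i j c, piA_mono_vecSwap hij, vecSwap_vecSwap]
      exact sub_mem (add_mem (mono_mem_monoSpan hc') (mono_mem_monoSpan hc))
        (key _ hc' (by rwa [vecSwap_left, vecSwap_right]))
  · rw [← piALin_apply hij, map_zero]
    exact zero_mem _
  · intro f g hf hg
    rw [piA_add hij]
    exact add_mem hf hg
  · intro r f hf
    rw [piA_smul hij]
    exact Submodule.smul_mem _ r hf

/-- At an exponent of maximal norm, the operator `π_i` acts on coefficients by sorting the components `i`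
and `i + 1` of the exponent. -/
theorem coeff_piA_of_normSq_eq {i j : Fin N} (hij : i ≠ j) {M d : ℤ} {f : Laurent R N}
    (hf : f ∈ monoSpan R (ball N M d)) {b : Fin N → ℤ} (hb : normSq b = M) :
    (piA i j f).coeff b = if b j ≤ b i then f.coeff b else f.coeff (vecSwap i j b) := by
  classical
  have key : ∀ c ∈ ball N M d, c j ≤ c i → (piA i j (mono c : Laurent R N)).coeff b =
      (if c = b then 1 else 0) + if c i = c j then 0 else if vecSwap i j c = b then 1 else 0 := by
    intro c hc h
    obtain ⟨g, hg, hgc⟩ := piA_mono_eq (R := R) hij h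
    have hg0 : g.coeff b = 0 := by
      refine coeff_eq_zero_of_mem_monoSpan hg fun hmem => ?_
      have := hmem.1
      have := hc.1
      omega
    rw [hgc, AddMonoidAlgebra.coeff_add, AddMonoidAlgebra.coeff_add, Finsupp.add_apply,
      Finsupp.add_apply, hg0, add_zero, coeff_mono]
    by_cases h2 : c i = c j
    · rw [if_pos h2, if_pos h2, AddMonoidAlgebra.coeff_zero, Finsupp.zero_apply]
    · rw [if_neg h2, if_neg h2, coeff_mono]
  have hsw : ∀ c, (vecSwap i j c = b) = (c = vecSwap i j b) := fun c => propext
    ⟨fun h => by rw [← h, vecSwap_vecSwap], fun h => by rw [h, vecSwap_vecSwap]⟩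
  refine monoSpan_induction (p := fun f => (piA i j f).coeff b =
    if b j ≤ b i then f.coeff b else f.coeff (vecSwap i j b)) ?_ ?_ ?_ ?_ hf
  · intro c hc
    rw [coeff_mono, coeff_mono]
    obtain h | h := le_total (c j) (c i)
    · rw [key c hc h]
      simp only [hsw]
      by_cases h1 : c = b
      · subst h1
        rw [if_pos rfl, if_pos h]
        split_ifs with h2 h3
        · simp
        · have := congrFun h3 i
          rw [vecSwap_left] at this
          exact absurd this h2
        · simp
      · rw [if_neg h1, zero_add]
        by_cases h2 : c = vecSwap i j b
        · subst h2
          rw [vecSwap_left, vecSwap_right] at h ⊢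
          rw [if_pos rfl]
          by_cases h3 : b j = b i
          · exfalso
            apply h1
            rw [vecSwap_eq_add hij, h3, sub_self, zero_smul, add_zero]
          · rw [if_neg h3, if_neg (by omega)]
        · rw [if_neg h2]
          simp
    · have hc' := vecSwap_mem_ball (i := i) (j := j) hc
      have h' : vecSwap i j c j ≤ vecSwap i j c i := by rwa [vecSwap_left, vecSwap_right]
      have e := piA_mono_vecSwap (R := R) hij (vecSwap i j c)
      rw [vecSwap_vecSwap] at e
      rw [e, AddMonoidAlgebra.coeff_sub, AddMonoidAlgebra.coeff_add, Finsupp.sub_apply,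
        Finsupp.add_apply, key _ hc' h', vecSwap_vecSwap, coeff_mono, coeff_mono, vecSwap_left,
        vecSwap_right]
      simp only [hsw]
      by_cases h1 : c = b
      · subst h1
        by_cases h3 : c i = c j
        · have h4 : vecSwap i j c = c := by
            rw [vecSwap_eq_add hij, h3, sub_self, zero_smul, add_zero]
          simp [h3, h4]
        · have h4 : c ≠ vecSwap i j c := by
            intro h5
            have := congrFun h5 i
            rw [vecSwap_left] at this
            exact h3 this
          simp [Ne.symm h3, h4]
          omega
      · by_cases h2 : c = vecSwap i j b
        · subst h2
          rw [vecSwap_left, vecSwap_right] at h ⊢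
          simp [h1, h]
        · simp [h1, h2]
  · rw [← piALin_apply hij, map_zero]
    simp
  · intro f g hf hg
    rw [piA_add hij, AddMonoidAlgebra.coeff_add, Finsupp.add_apply, hf, hg]
    split_ifs <;> rfl
  · intro r f hf
    rw [piA_smul hij, AddMonoidAlgebra.coeff_smul, Finsupp.smul_apply, hf]
    split_ifs <;> rfl

theorem keyA_induction {p : (Fin N → ℤ) → Laurent R N → Prop}
    (h0 : ∀ v, Antitone v → p v (mono v))
    (h1 : ∀ (v : Fin N → ℤ) (f : Laurent R N) (i j : Fin N), (i : ℕ) + 1 = j → v j < v i → p v f →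
      p (vecSwap i j v) (piA i j f))
    (v : Fin N → ℤ) : p v (keyA R v) := by
  have h := keyRel_keyA (R := R) v
  generalize keyA R v = f at h
  induction h with
  | base v hv =>
    refine h0 v ?_
    by_contra hc
    obtain ⟨i, j, hij, hlt⟩ := exists_lt_of_not_antitone hc
    refine hv _ _ (step_of_lt (fun v i j => StepA.swap v i j) hij hlt)
  | step u v T f h hf ih =>
    obtain ⟨i, j, hij, hv⟩ := h
    exact h1 _ _ _ _ hij hv ih

theorem keyA_mem_monoSpan (v : Fin N → ℤ) :
    keyA R v ∈ monoSpan R (ball N (normSq v) (∑ k, v k)) := by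
  refine keyA_induction (p := fun v f => f ∈ monoSpan R (ball N (normSq v) (∑ k, v k)))
    (fun v _ => mono_mem_monoSpan ⟨le_rfl, rfl⟩) (fun v f i j hij _ hf => ?_) v
  rw [normSq_vecSwap, show ∑ k, vecSwap i j v k = ∑ k, v k from Equiv.sum_comp (Equiv.swap i j) v]
  exact piA_mem_monoSpan (fin_ne_of_succ hij) hf

/-- The number `2^m`, where `m` is the number of pairs `i < j` with `v_i < v_j`. -/
def twoPowInv (v : Fin N → ℤ) : ℕ :=
  ∏ p : Fin N × Fin N with p.1 < p.2, if v p.1 < v p.2 then 2 else 1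

theorem twoPowInv_vecSwap {v : Fin N → ℤ} {i j : Fin N} (hij : (i : ℕ) + 1 = j) (hv : v j < v i) :
    twoPowInv (vecSwap i j v) = 2 * twoPowInv v := by
  unfold twoPowInv
  rw [prod_lt_split hij, prod_lt_split hij fun p => if v p.1 < v p.2 then 2 else 1]
  dsimp only
  rw [vecSwap_left, vecSwap_right, if_pos hv, if_neg (by omega), one_mul]
  congr 1
  exact prod_lt_swap hij _ _ fun p => rfl

theorem twoPowInv_pos (v : Fin N → ℤ) : 0 < twoPowInv v :=
  Finset.prod_pos fun p _ => by split_ifs <;> omega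

theorem twoPowInv_le (v : Fin N → ℤ) : twoPowInv v ≤ 2 ^ (Fintype.card (Fin N × Fin N)) := by
  refine (Finset.prod_le_pow_card _ _ 2 fun p _ => by split_ifs <;> omega).trans ?_
  exact Nat.pow_le_pow_right (by omega) (Finset.card_le_univ _)

/-- Among the permutations of a vector, the weakly increasing one has the largest number of pairs `i < j`
with `v_i < v_j`. -/
theorem exists_monotone_perm (v : Fin N → ℤ) : ∃ σ : Equiv.Perm (Fin N),
    Monotone (v ∘ σ) ∧ (v ∘ σ = v ∨ twoPowInv v < twoPowInv (v ∘ σ)) := by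
  induction hm : 2 ^ (Fintype.card (Fin N × Fin N)) - twoPowInv v using Nat.strong_induction_on
    generalizing v with
  | _ m ih =>
    subst hm
    by_cases hv : Monotone v
    · exact ⟨1, by simpa using hv, .inl (by simp)⟩
    · have hv' : ¬ Antitone (-v) := fun h => hv (by simpa using h.neg)
      obtain ⟨i, j, hij, hlt⟩ := exists_lt_of_not_antitone hv'
      have hlt' : v j < v i := by simpa using hlt
      have h1 := twoPowInv_vecSwap hij hlt'
      have h2 := twoPowInv_le (vecSwap i j v)
      have h3 := twoPowInv_pos v
      obtain ⟨σ, hσ, hσ'⟩ := ih _ (by omega) (vecSwap i j v) rfl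
      refine ⟨σ.trans (Equiv.swap i j), hσ, .inr ?_⟩
      have h4 : v ∘ (σ.trans (Equiv.swap i j)) = vecSwap i j v ∘ σ := rfl
      rw [h4]
      obtain h5 | h5 := hσ'
      · rw [h5]; omega
      · omega

/-- The coefficients of a key polynomial at its exponents of maximal norm. -/
theorem coeff_keyA_of_normSq_eq (v : Fin N → ℤ) : (keyA R v).coeff v = 1 ∧
    ∀ b, normSq b = normSq v → (keyA R v).coeff b ≠ 0 →
      (∃ σ : Equiv.Perm (Fin N), b = v ∘ σ) ∧ (b = v ∨ twoPowInv b < twoPowInv v) := by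
  classical
  have key := keyA_induction (p := fun v f => f ∈ monoSpan R (ball N (normSq v) (∑ k, v k)) ∧
    f.coeff v = 1 ∧ ∀ b, normSq b = normSq v → f.coeff b ≠ 0 →
      (∃ σ : Equiv.Perm (Fin N), b = v ∘ σ) ∧ (b = v ∨ twoPowInv b < twoPowInv v)) ?_ ?_ v
  · exact key.2
  · intro v _
    refine ⟨mono_mem_monoSpan ⟨le_rfl, rfl⟩, by rw [coeff_mono, if_pos rfl], fun b _ hb => ?_⟩
    rw [coeff_mono] at hb
    have : v = b := by by_contra h; simp [h] at hb
    subst this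
    exact ⟨⟨1, by simp⟩, .inl rfl⟩
  · rintro v f i j hij hv ⟨hf, hf1, hfb⟩
    have nij := fin_ne_of_succ hij
    refine ⟨?_, ?_, fun b hb hne => ?_⟩
    · rw [normSq_vecSwap,
        show ∑ k, vecSwap i j v k = ∑ k, v k from Equiv.sum_comp (Equiv.swap i j) v]
      exact piA_mem_monoSpan nij hf
    · rw [coeff_piA_of_normSq_eq nij hf (normSq_vecSwap i j v), vecSwap_left, vecSwap_right,
        if_neg (by omega), vecSwap_vecSwap, hf1]
    · rw [normSq_vecSwap] at hb
      rw [coeff_piA_of_normSq_eq nij hf hb] at hne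
      have hinv := twoPowInv_vecSwap hij hv
      have hpos := twoPowInv_pos v
      split_ifs at hne with hle
      · obtain ⟨⟨σ, hσ⟩, h2⟩ := hfb b hb hne
        refine ⟨⟨σ.trans (Equiv.swap i j), ?_⟩, .inr ?_⟩
        · ext k; simp [hσ, vecSwap]
        · obtain rfl | h2 := h2 <;> omega
      · obtain ⟨⟨σ, hσ⟩, h2⟩ := hfb _ ((normSq_vecSwap i j b).trans hb) hne
        refine ⟨⟨((Equiv.swap i j).trans σ).trans (Equiv.swap i j), ?_⟩, ?_⟩
        · rw [← vecSwap_vecSwap i j b, hσ]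
          ext k; simp [vecSwap]
        · obtain h2 | h2 := h2
          · left
            rw [← h2, vecSwap_vecSwap]
          · right
            have h3 := twoPowInv_vecSwap (v := vecSwap i j b) hij
              (by rw [vecSwap_left, vecSwap_right]; omega)
            rw [vecSwap_vecSwap] at h3
            omega

theorem coeff_keyA_of_monotone (v : Fin N → ℤ) {b : Fin N → ℤ} (hb : Monotone b)
    (hnorm : normSq b = normSq v) [Decidable (v = b)] :
    (keyA R v).coeff b = if v = b then 1 else 0 := by
  obtain ⟨h1, h2⟩ := coeff_keyA_of_normSq_eq (R := R) v
  split_ifs with h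
  · rw [← h, h1]
  · by_contra hne
    obtain ⟨⟨σ, hσ⟩, h3⟩ := h2 b hnorm hne
    obtain ⟨τ, hτ, h4⟩ := exists_monotone_perm v
    have h5 : v ∘ τ = b := by
      rw [hσ] at hb ⊢
      rw [Tuple.comp_sort_eq_comp_iff_monotone.2 hτ, Tuple.comp_sort_eq_comp_iff_monotone.2 hb]
    rw [h5] at h4
    obtain h3 | h3 := h3
    · exact h h3.symm
    · obtain h4 | h4 := h4
      · exact h h4.symm
      · omega

end Norms

/-! ### Duality of the two families of key polynomials -/

section Duality

variable {R : Type*} [CommRing R] {N : ℕ}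

/-- The positive cone: the non-zero vectors with sum `0` that pair non-negatively with all dominant
vectors. That they are non-zero is expressed by the strictly dominant linear form `weight`. -/
def posCone (N : ℕ) : Set (Fin N → ℤ) :=
  {c | ∑ k, c k = 0 ∧ 0 < weight c ∧ ∀ l : Fin N → ℤ, Antitone l → 0 ≤ ∑ k, l k * c k}

theorem add_mem_posCone {b c : Fin N → ℤ} (hb : b ∈ posCone N) (hc : c ∈ posCone N) :
    b + c ∈ posCone N := by
  refine ⟨?_, ?_, fun l hl => ?_⟩
  · simp only [Pi.add_apply, Finset.sum_add_distrib, hb.1, hc.1, add_zero]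
  · rw [weight_add]
    exact add_pos hb.2.1 hc.2.1
  · simp only [Pi.add_apply, mul_add, Finset.sum_add_distrib]
    exact add_nonneg (hb.2.2 l hl) (hc.2.2 l hl)

theorem rootA_mem_posCone {i j : Fin N} (hij : i < j) : rootA j i ∈ posCone N := by
  refine ⟨sum_rootA _ _, ?_, fun l hl => ?_⟩
  · have h : (rootA j i : Fin N → ℤ) + Pi.single j 1 = Pi.single i 1 := by
      rw [rootA, sub_add_cancel]
    have h1 := congrArg weight h
    rw [weight_add, weight_single, weight_single] at h1
    have := Fin.lt_def.1 hij
    omega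
  · rw [sum_mul_rootA]
    have := hl hij.le
    omega

theorem weylDen_eq : ∃ g ∈ monoSpan R (posCone N), weylDen R N = 1 + g := by
  unfold weylDen
  refine Finset.prod_induction _ (fun f => ∃ g ∈ monoSpan R (posCone N), f = 1 + g) ?_ ?_ ?_
  · rintro _ _ ⟨g, hg, rfl⟩ ⟨g', hg', rfl⟩
    refine ⟨g + g' + g * g', add_mem (add_mem hg hg') ?_, by ring⟩
    exact mul_mem_monoSpan (fun b hb c hc => add_mem_posCone hb hc) hg hg'
  · exact ⟨0, zero_mem _, by simp⟩
  · intro p hp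
    refine ⟨-mono (rootA p.2 p.1), neg_mem (mono_mem_monoSpan (rootA_mem_posCone ?_)), by ring⟩
    simpa using hp

/-- The bilinear form `CT (f g ∏_{i<j} (1 - x_i / x_j))`. -/
def ctForm (f g : Laurent R N) : R := (f * g * weylDen R N).coeff 0

theorem ctForm_comm (f g : Laurent R N) : ctForm f g = ctForm g f := by
  unfold ctForm
  rw [mul_comm f g]

theorem ctForm_sub (f f' g : Laurent R N) : ctForm (f - f') g = ctForm f g - ctForm f' g := by
  unfold ctForm
  rw [sub_mul, sub_mul, AddMonoidAlgebra.coeff_sub, Finsupp.sub_apply]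

theorem ctForm_add (f g g' : Laurent R N) : ctForm f (g + g') = ctForm f g + ctForm f g' := by
  unfold ctForm
  rw [mul_add, add_mul, AddMonoidAlgebra.coeff_add, Finsupp.add_apply]

theorem ctForm_smul (r : R) (f g : Laurent R N) : ctForm f (r • g) = r • ctForm f g := by
  unfold ctForm
  rw [mul_smul_comm, smul_mul_assoc, AddMonoidAlgebra.coeff_smul, Finsupp.smul_apply]

theorem coeff_zero_actHom_swap (i j : Fin N) (f : Laurent R N) :
    (actHom (swapHom i j) f).coeff 0 = f.coeff 0 := by
  classical
  have := laurent_linearMap_ext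
    (F := (Finsupp.lapply (0 : Fin N → ℤ) : ((Fin N → ℤ) →₀ R) →ₗ[R] R) ∘ₗ
      (AddMonoidAlgebra.coeffLinearEquiv R).toLinearMap ∘ₗ (actHom (swapHom i j)).toLinearMap)
    (G := (Finsupp.lapply (0 : Fin N → ℤ) : ((Fin N → ℤ) →₀ R) →ₗ[R] R) ∘ₗ
      (AddMonoidAlgebra.coeffLinearEquiv R).toLinearMap) (fun c => ?_) f
  · exact this
  · simp only [LinearMap.comp_apply, AlgHom.toLinearMap_apply, actHom_mono]
    change (mono (vecSwap i j c) : Laurent R N).coeff 0 = (mono c : Laurent R N).coeff 0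
    rw [coeff_mono, coeff_mono]
    have : (vecSwap i j c = 0) = (c = 0) := propext
      ⟨fun h => by rw [← vecSwap_vecSwap i j c, h]; rfl, fun h => by rw [h]; rfl⟩
    simp only [this]

/-- The operators `π_i` are self-adjoint. -/
theorem ctForm_piA {i j : Fin N} (hij : (i : ℕ) + 1 = j) (f g : Laurent R N) :
    ctForm (piA i j f) g = ctForm f (piA i j g) := by
  have nij := fin_ne_of_succ hij
  obtain ⟨D, hD, hfix⟩ := weylDen_split (R := R) hij
  have ht := mono_rootA_mul_swap (R := R) i j
  have e1 : piA i j f * g * weylDen R N =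
      actHom (swapHom i j) f * g * D - mono (rootA j i) * f * g * D := by
    rw [hD]
    linear_combination -(mono (rootA j i) * g * D) * piA_spec nij f
      - (g * D * (piA i j f - actHom (swapHom i j) f)) * ht
  have e2 : f * piA i j g * weylDen R N =
      actHom (swapHom i j) (actHom (swapHom i j) f * g * D) - mono (rootA j i) * f * g * D := by
    rw [hD, map_mul, map_mul, hfix, actHom_swap_swap]
    linear_combination -(mono (rootA j i) * f * D) * piA_spec nij g
      - (f * D * (piA i j g - actHom (swapHom i j) g)) * ht
  unfold ctForm
  rw [e1, e2, AddMonoidAlgebra.coeff_sub, AddMonoidAlgebra.coeff_sub, Finsupp.sub_apply,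
    Finsupp.sub_apply, coeff_zero_actHom_swap]

/-- Against Laurent polynomials whose exponents are not longer than the dominant vector `l`, the monomial
`x^l` only sees the coefficient of `x^(-l)`. -/
theorem ctForm_mono_antitone {l : Fin N → ℤ} (hl : Antitone l) {g : Laurent R N} {d : ℤ}
    (hg : g ∈ monoSpan R (ball N (normSq l) d)) : ctForm (mono l) g = g.coeff (-l) := by
  classical
  refine monoSpan_induction (p := fun g => ctForm (mono l) g = g.coeff (-l)) ?_ ?_ ?_ ?_ hg
  · intro b hb
    obtain ⟨g, hg, hW⟩ := weylDen_eq (R := R) (N := N)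
    have h0 : g.coeff (0 - (l + b)) = 0 := by
      refine coeff_eq_zero_of_mem_monoSpan hg fun hmem => ?_
      obtain ⟨-, hw, hpos⟩ := hmem
      have h1 := normSq_add l (0 - (l + b))
      rw [show l + (0 - (l + b)) = -b by abel, normSq_neg] at h1
      have h2 := hpos l hl
      have h3 : normSq (0 - (l + b)) ≤ 0 := by
        have := hb.1
        omega
      have h4 : 0 - (l + b) = 0 := by
        have h5 : normSq (0 - (l + b)) = 0 :=
          le_antisymm h3 (Finset.sum_nonneg fun k _ => sq_nonneg _)
        rw [normSq, Finset.sum_eq_zero_iff_of_nonneg fun k _ => sq_nonneg _] at h5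
        ext k
        exact pow_eq_zero_iff (two_ne_zero) |>.1 (h5 k (Finset.mem_univ k))
      rw [h4] at hw
      simp [weight] at hw
    unfold ctForm
    rw [mono_mul, coeff_mono_mul, hW, AddMonoidAlgebra.coeff_add, Finsupp.add_apply, h0, add_zero,
      ← mono_zero, coeff_mono, coeff_mono]
    have : (0 = 0 - (l + b)) = (b = -l) := propext
      ⟨fun h => by rw [eq_neg_iff_add_eq_zero, add_comm]; rwa [zero_sub, zero_eq_neg] at h,
        fun h => by rw [h]; simp⟩
    simp only [this]
  · simp [ctForm]
  · intro f g hf hg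
    rw [ctForm_add, hf, hg]
    rfl
  · intro r f hf
    rw [ctForm_smul, hf]
    rfl

theorem ctForm_keyA_of_normSq_lt (w : Fin N → ℤ) {M d : ℤ} (hM : M < normSq w) {f : Laurent R N}
    (hf : f ∈ monoSpan R (ball N M d)) : ctForm f (keyA R w) = 0 := by
  refine keyA_induction (p := fun w g => M < normSq w → ∀ f ∈ monoSpan R (ball N M d),
    ctForm f g = 0) ?_ ?_ w hM f hf
  · intro l hl hM f hf
    rw [ctForm_comm, ctForm_mono_antitone hl (monoSpan_mono (ball_subset hM.le) hf)]
    refine coeff_eq_zero_of_mem_monoSpan hf fun h => ?_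
    have := h.1
    rw [normSq_neg] at this
    omega
  · intro v g i j hij _ ih hM f hf
    rw [normSq_vecSwap] at hM
    rw [← ctForm_piA hij]
    exact ih hM _ (piA_mem_monoSpan (fin_ne_of_succ hij) hf)

theorem ctForm_mono_keyA {u : Fin N → ℤ} (hu : Antitone u) (w : Fin N → ℤ) [Decidable (w = -u)] :
    ctForm (mono u) (keyA R w) = if w = -u then 1 else 0 := by
  obtain h | h | h := lt_trichotomy (normSq w) (normSq u)
  · rw [ctForm_mono_antitone hu (monoSpan_mono (ball_subset h.le) (keyA_mem_monoSpan w)), if_neg]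
    · refine coeff_eq_zero_of_mem_monoSpan (keyA_mem_monoSpan w) fun h' => ?_
      have := h'.1
      rw [normSq_neg] at this
      omega
    · rintro rfl
      rw [normSq_neg] at h
      omega
  · rw [ctForm_mono_antitone hu (monoSpan_mono (ball_subset h.le) (keyA_mem_monoSpan w)),
      coeff_keyA_of_monotone w (b := -u) hu.neg (by rw [normSq_neg, h])]
  · rw [ctForm_keyA_of_normSq_lt w h (mono_mem_monoSpan ⟨le_rfl, rfl⟩), if_neg]
    rintro rfl
    rw [normSq_neg] at h
    omega

/-- A polynomial as a Laurent polynomial. -/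
def toLaurent : MvPolynomial (Fin N) R →ₐ[R] Laurent R N := MvPolynomial.aeval var

theorem toLaurent_X (i : Fin N) : toLaurent (MvPolynomial.X i : MvPolynomial (Fin N) R) = var i :=
  MvPolynomial.aeval_X _ _

theorem prod_mono {ι : Type*} (s : Finset ι) (c : ι → Fin N → ℤ) :
    ∏ i ∈ s, (mono (c i) : Laurent R N) = mono (∑ i ∈ s, c i) := by
  classical
  induction s using Finset.induction_on with
  | empty => simp [mono_zero]
  | insert a s ha ih => rw [Finset.prod_insert ha, Finset.sum_insert ha, ih, mono_mul]

theorem prod_var_pow (a : Fin N → ℕ) : ∏ i, (var i : Laurent R N) ^ a i = mono fun i => (a i : ℤ) := by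
  simp only [var, mono_pow, prod_mono]
  congr 1
  ext k
  simp [Pi.single_apply]

theorem toLaurent_swapPoly (i j : Fin N) (f : MvPolynomial (Fin N) R) :
    toLaurent (swapPoly i j f) = actHom (swapHom i j) (toLaurent f) := by
  have : toLaurent.comp (MvPolynomial.rename (Equiv.swap i j)) =
      (actHom (swapHom i j)).comp (toLaurent : MvPolynomial (Fin N) R →ₐ[R] Laurent R N) := by
    refine MvPolynomial.algHom_ext fun k => ?_
    rw [AlgHom.comp_apply, AlgHom.comp_apply, MvPolynomial.rename_X, toLaurent_X, toLaurent_X, var,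
      var, actHom_mono]
    congr 1
    ext l
    simp only [swapHom_apply, vecSwap, Pi.single_apply]
    simp only [← Equiv.swap_apply_eq_iff]
  exact DFunLike.congr_fun this f

theorem piPoly_spec (i j : Fin N) (f : MvPolynomial (Fin N) R) :
    piPoly i j f * (MvPolynomial.X i - MvPolynomial.X j) =
      MvPolynomial.X i * f - MvPolynomial.X j * swapPoly i j f := by
  refine exactQuot_mul ?_
  rw [← Ideal.mem_span_singleton, ← Ideal.Quotient.eq_zero_iff_mem]
  set I : Ideal (MvPolynomial (Fin N) R) := Ideal.span {MvPolynomial.X i - MvPolynomial.X j}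
  have hX : Ideal.Quotient.mkₐ R I (MvPolynomial.X i) = Ideal.Quotient.mkₐ R I (MvPolynomial.X j) :=
    Ideal.Quotient.eq.2 (Ideal.mem_span_singleton_self _)
  have hs : (Ideal.Quotient.mkₐ R I).comp (MvPolynomial.rename (Equiv.swap i j)) =
      Ideal.Quotient.mkₐ R I := by
    refine MvPolynomial.algHom_ext fun k => ?_
    rw [AlgHom.comp_apply, MvPolynomial.rename_X, Equiv.swap_apply_def]
    split_ifs with h1 h2
    · rw [h1, hX]
    · rw [h2, hX]
    · rfl
  have h := DFunLike.congr_fun hs f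
  change Ideal.Quotient.mkₐ R I (_ - _) = 0
  rw [AlgHom.comp_apply] at h
  rw [map_sub, map_mul, map_mul, hX, swapPoly, h, sub_self]

theorem toLaurent_piPoly {i j : Fin N} (hij : i ≠ j) (f : MvPolynomial (Fin N) R) :
    toLaurent (piPoly i j f) = piA i j (toLaurent f) := by
  refine (piA_eq' hij ?_).symm
  have := congrArg toLaurent (piPoly_spec i j f)
  rw [map_mul, map_sub, map_sub, map_mul, map_mul, toLaurent_X, toLaurent_X, toLaurent_swapPoly] at this
  rw [← this, mul_comm]

theorem toLaurent_piHatPoly {i j : Fin N} (hij : i ≠ j) (f : MvPolynomial (Fin N) R) :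
    toLaurent (piHatPoly i j f) = piA i j (toLaurent f) - toLaurent f := by
  rw [piHatPoly, map_sub, toLaurent_piPoly hij]

theorem exists_isKeyPoly (d : Fin N → Fin N → MvPolynomial (Fin N) R → MvPolynomial (Fin N) R)
    (u : Fin N → ℕ) : ∃ f, IsKeyPoly d u f := by
  induction hh : height (fun i => (u i : ℤ)) using Nat.strong_induction_on generalizing u with
  | _ m ih =>
    subst hh
    by_cases hu : Antitone fun i => (u i : ℤ)
    · exact ⟨_, .dominant u fun i j hij => Nat.cast_le.1 (hu hij)⟩
    · obtain ⟨i, j, hij, hlt⟩ := exists_lt_of_not_antitone hu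
      have h1 : vecSwap i j u j < vecSwap i j u i := by
        rw [vecSwap_left, vecSwap_right]
        exact_mod_cast hlt
      have h2 := height_vecSwap (v := vecSwap i j fun i => (u i : ℤ)) hij
        (by rwa [vecSwap_left, vecSwap_right])
      rw [vecSwap_vecSwap] at h2
      obtain ⟨f, hf⟩ := ih _ h2 (vecSwap i j u) rfl
      have := IsKeyPoly.step _ _ i j hij h1 hf
      rw [vecSwap_vecSwap] at this
      exact ⟨_, this⟩

/-- The key polynomials `K̂_u` are dual to the key polynomials of the opposite vectors. -/
theorem ctForm_isKeyPoly {u : Fin N → ℕ} {f : MvPolynomial (Fin N) R} (hf : IsKeyPoly piHatPoly u f)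
    (v : Fin N → ℕ) [Decidable (u = v)] :
    ctForm (toLaurent f) (keyA R fun i => -(v i : ℤ)) = if u = v then 1 else 0 := by
  classical
  have key : ∀ w : Fin N → ℤ, ctForm (toLaurent f) (keyA R w) =
      if w = -(fun i => (u i : ℤ)) then 1 else 0 := by
    induction hf with
    | dominant l hl =>
      intro w
      rw [map_prod]
      simp only [map_pow, toLaurent_X, prod_var_pow]
      exact ctForm_mono_keyA (fun i j hij => by exact_mod_cast hl hij) w
    | step u f i j hij hu _ ih =>
      intro w
      have nij := fin_ne_of_succ hij
      have hu' : (u j : ℤ) < u i := by exact_mod_cast hu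
      rw [toLaurent_piHatPoly nij, ctForm_sub, ctForm_piA hij]
      have hsw : (fun k => ((vecSwap i j u k : ℕ) : ℤ)) = vecSwap i j fun k => (u k : ℤ) := rfl
      rw [hsw]
      obtain h | h | h := lt_trichotomy (w i) (w j)
      · rw [keyA_of_lt hij h, piA_piA nij, sub_self, if_neg]
        rintro rfl
        simp only [Pi.neg_apply, vecSwap_left, vecSwap_right] at h
        omega
      · rw [piA_keyA_of_eq hij h, sub_self, if_neg]
        rintro rfl
        simp only [Pi.neg_apply, vecSwap_left, vecSwap_right] at h
        omega
      · rw [← keyA_vecSwap hij h, ih, ih, if_neg (c := w = _), sub_zero]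
        · have : (vecSwap i j w = -fun k => (u k : ℤ)) = (w = -vecSwap i j fun k => (u k : ℤ)) :=
            propext ⟨fun h => by rw [← vecSwap_vecSwap i j w, h]; rfl,
              fun h => by
                rw [h]
                exact congrArg (fun b : Fin N → ℤ => -b) (vecSwap_vecSwap i j fun k => (u k : ℤ))⟩
          simp only [this]
        · rintro rfl
          simp only [Pi.neg_apply] at h
          omega
  rw [key]
  have : ((fun i => -(v i : ℤ)) = -fun i => (u i : ℤ)) = (u = v) := propext
    ⟨fun h => by ext i; have := congrFun h i; simp at this; exact this.symm,
      fun h => by subst h; rfl⟩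
  simp only [this]

theorem isKeyPoly_mem_monoSpan {u : Fin N → ℕ} {f : MvPolynomial (Fin N) R}
    (hf : IsKeyPoly piHatPoly u f) :
    toLaurent f ∈ monoSpan R (ball N (normSq fun i => (u i : ℤ)) (∑ i, (u i : ℤ))) := by
  induction hf with
  | dominant l hl =>
    rw [map_prod]
    simp only [map_pow, toLaurent_X, prod_var_pow]
    exact mono_mem_monoSpan ⟨le_rfl, rfl⟩
  | step u f i j hij hu _ ih =>
    have nij := fin_ne_of_succ hij
    have hsw : (fun k => ((vecSwap i j u k : ℕ) : ℤ)) = vecSwap i j fun k => (u k : ℤ) := rfl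
    have hs : ∑ k, ((vecSwap i j u k : ℕ) : ℤ) = ∑ k, (u k : ℤ) :=
      Equiv.sum_comp (Equiv.swap i j) fun k => (u k : ℤ)
    rw [toLaurent_piHatPoly nij, hs, hsw, normSq_vecSwap]
    exact sub_mem (piA_mem_monoSpan nij ih) ih

theorem coeff_toLaurent (f : MvPolynomial (Fin N) R) (c : Fin N → ℤ) :
    (toLaurent f).coeff c = coeffZ (f : MvPowerSeries (Fin N) R) c := by
  classical
  induction f using MvPolynomial.induction_on' with
  | monomial e r =>
    have h1 : toLaurent (MvPolynomial.monomial e r) = r • (mono fun i => (e i : ℤ) : Laurent R N) := by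
      rw [MvPolynomial.monomial_eq, map_mul, ← prod_var_pow]
      rw [Finsupp.prod_fintype _ _ (by simp), map_prod]
      simp only [map_pow, toLaurent_X]
      rw [toLaurent, MvPolynomial.aeval_C, ← Algebra.smul_def]
    rw [h1, AddMonoidAlgebra.coeff_smul, Finsupp.smul_apply, coeff_mono]
    obtain ⟨a, rfl⟩ | ⟨k, hk⟩ := coeffZ_cases c
    · rw [coeffZ_natCast, MvPolynomial.coeff_coe, MvPolynomial.coeff_monomial]
      have : ((fun i => (e i : ℤ)) = fun i => (a i : ℤ)) = (e = toExp a) := propext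
        ⟨fun h => by ext i; have := congrFun h i; simpa using this,
          fun h => by ext i; rw [h]; simp⟩
      simp [this]
    · rw [coeffZ_of_neg _ hk, if_neg, smul_zero]
      intro h
      rw [← h] at hk
      simp only at hk
      omega
  | add f g hf hg =>
    rw [map_add, AddMonoidAlgebra.coeff_add, Finsupp.add_apply, hf, hg, MvPolynomial.coe_add]
    unfold coeffZ
    split_ifs <;> simp

theorem pairing_coe (f : MvPolynomial (Fin N) R) (h : Laurent R N) :
    pairing (f : MvPowerSeries (Fin N) R) h = (toLaurent f * h).coeff 0 := by
  have := laurent_linearMap_ext (F := pairing (R := R) (f : MvPowerSeries (Fin N) R))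
    (G := (Finsupp.lapply (0 : Fin N → ℤ) : ((Fin N → ℤ) →₀ R) →ₗ[R] R) ∘ₗ
      (AddMonoidAlgebra.coeffLinearEquiv R).toLinearMap ∘ₗ LinearMap.mulLeft R (toLaurent f))
    (fun c => ?_) h
  · exact this
  · rw [pairing_mono, ← coeff_toLaurent]
    change _ = (toLaurent f * mono c).coeff 0
    rw [mul_comm, coeff_mono_mul, zero_sub]

theorem keyA_mul_weylDen_mem (v : Fin N → ℤ) :
    keyA R v * weylDen R N ∈ monoSpan R {c | ∑ k, c k = ∑ k, v k} := by
  obtain ⟨g, hg, hW⟩ := weylDen_eq (R := R) (N := N)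
  have h1 := monoSpan_mono (fun c (hc : c ∈ ball N _ _) => hc.2) (keyA_mem_monoSpan (R := R) v)
  rw [hW, mul_add, mul_one]
  refine add_mem h1 (mul_mem_monoSpan (T := {c | ∑ k, c k = 0}) (fun b hb c hc => ?_) h1
    (monoSpan_mono (fun c hc => hc.1) hg))
  change ∑ k, (b + c) k = ∑ k, v k
  simp only [Pi.add_apply, Finset.sum_add_distrib]
  rw [show ∑ k, c k = 0 from hc, show ∑ k, b k = ∑ k, v k from hb, add_zero]

section Expansion

variable {A : Type*} [CommRing A] [Algebra R A]

theorem pairing_eq_sum (Ω : MvPowerSeries (Fin N) A) (d : ℕ) {h : Laurent R N}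
    (hh : h ∈ monoSpan R {c | ∑ k, c k = -(d : ℤ)}) : pairing Ω h =
      ∑ a ∈ Finset.piAntidiag Finset.univ d,
        h.coeff (fun i => -(a i : ℤ)) • MvPowerSeries.coeff (toExp a) Ω := by
  classical
  refine monoSpan_induction (p := fun h => pairing Ω h = ∑ a ∈ Finset.piAntidiag Finset.univ d,
    h.coeff (fun i => -(a i : ℤ)) • MvPowerSeries.coeff (toExp a) Ω) ?_ ?_ ?_ ?_ hh
  · intro c hc
    rw [pairing_mono]
    obtain ⟨a, ha⟩ | ⟨k, hk⟩ := coeffZ_cases (-c)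
    · have hc' : c = fun i => -(a i : ℤ) := by
        rw [← neg_neg c, ha]; rfl
      rw [ha, coeffZ_natCast, Finset.sum_eq_single a]
      · rw [coeff_mono, if_pos hc', one_smul]
      · intro b _ hb
        rw [coeff_mono, if_neg, zero_smul]
        intro h
        apply hb
        rw [hc'] at h
        ext i
        have := congrFun h i
        simpa using this.symm
      · intro ha'
        exfalso
        apply ha'
        rw [Finset.mem_piAntidiag]
        refine ⟨?_, fun i _ => Finset.mem_univ i⟩
        have hc2 : ∑ k, c k = -(d : ℤ) := hc
        rw [hc', Finset.sum_neg_distrib, neg_inj] at hc2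
        exact_mod_cast hc2
    · rw [coeffZ_of_neg _ hk, Finset.sum_eq_zero]
      intro b _
      rw [coeff_mono, if_neg, zero_smul]
      rintro rfl
      simp at hk
      omega
  · simp
  · intro f g hf hg
    rw [map_add, hf, hg, ← Finset.sum_add_distrib]
    refine Finset.sum_congr rfl fun a _ => ?_
    rw [AddMonoidAlgebra.coeff_add, Finsupp.add_apply, add_smul]
  · intro r f hf
    rw [map_smul, hf, Finset.smul_sum]
    refine Finset.sum_congr rfl fun a _ => ?_
    rw [AddMonoidAlgebra.coeff_smul, Finsupp.smul_apply, smul_eq_mul, mul_smul]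

/-- The vectors of natural numbers with sum `d`. -/
abbrev Compositions (N d : ℕ) : Type := {a : Fin N → ℕ // a ∈ Finset.piAntidiag Finset.univ d}

theorem mem_compositions {d : ℕ} {a : Fin N → ℕ} :
    a ∈ Finset.piAntidiag Finset.univ d ↔ ∑ i, a i = d := by
  simp [Finset.mem_piAntidiag]

/-- The coefficients of the series that are dual to the polynomials `K̂_v` of degree `d`. -/
def dualMatrix (R : Type*) [CommRing R] (N d : ℕ) : Matrix (Compositions N d) (Compositions N d) R :=
  fun a v => (keyA R (fun i => -(v.1 i : ℤ)) * weylDen R N).coeff fun i => -(a.1 i : ℤ)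

theorem pairing_keyA_eq_sum (Ω : MvPowerSeries (Fin N) A) {d : ℕ} (v : Compositions N d) :
    pairing Ω (keyA R (fun i => -(v.1 i : ℤ)) * weylDen R N) =
      ∑ a, dualMatrix R N d a v • MvPowerSeries.coeff (toExp a.1) Ω := by
  rw [pairing_eq_sum Ω d, ← Finset.sum_coe_sort]
  · rfl
  · have h := keyA_mul_weylDen_mem (R := R) fun i => -(v.1 i : ℤ)
    have hs : ∑ k, -(v.1 k : ℤ) = -(d : ℤ) := by
      have := mem_compositions.1 v.2
      rw [Finset.sum_neg_distrib, neg_inj]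
      exact_mod_cast this
    rwa [hs] at h

theorem sum_coeff_mul_dualMatrix {d : ℕ} (u v : Compositions N d) {f : MvPolynomial (Fin N) R}
    (hf : IsKeyPoly piHatPoly u.1 f) :
    ∑ a : Compositions N d, f.coeff (toExp a.1) * dualMatrix R N d a v = if u = v then 1 else 0 := by
  have h := pairing_keyA_eq_sum (R := R) (f : MvPowerSeries (Fin N) R) v
  rw [pairing_coe, ← mul_assoc] at h
  have h2 := ctForm_isKeyPoly hf v.1
  unfold ctForm at h2
  rw [h2] at h
  simp only [Subtype.ext_iff]
  rw [h]
  refine Finset.sum_congr rfl fun a _ => ?_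
  rw [MvPolynomial.coeff_coe, smul_eq_mul, mul_comm]

theorem coeff_isKeyPoly_eq_zero {u : Fin N → ℕ} {f : MvPolynomial (Fin N) R}
    (hf : IsKeyPoly piHatPoly u f) {a : Fin N → ℕ} (ha : ∑ i, a i ≠ ∑ i, u i) :
    f.coeff (toExp a) = 0 := by
  have h := coeff_toLaurent f fun i => (a i : ℤ)
  rw [coeffZ_natCast, MvPolynomial.coeff_coe] at h
  rw [← h]
  refine coeff_eq_zero_of_mem_monoSpan (isKeyPoly_mem_monoSpan hf) fun hmem => ha ?_
  have h2 : ∑ i, (a i : ℤ) = ∑ i, (u i : ℤ) := hmem.2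
  exact_mod_cast h2

/-- The recursion for the polynomials `K̂_v` is consistent, since they are determined by duality. -/
theorem isKeyPoly_piHatPoly_unique {u : Fin N → ℕ} {f g : MvPolynomial (Fin N) R}
    (hf : IsKeyPoly piHatPoly u f) (hg : IsKeyPoly piHatPoly u g) : f = g := by
  choose k hk using exists_isKeyPoly (R := R) (N := N) piHatPoly
  ext e
  obtain ⟨a, rfl⟩ : ∃ a : Fin N → ℕ, e = toExp a := ⟨e, by ext; simp⟩
  by_cases ha : ∑ i, a i = ∑ i, u i
  · set d := ∑ i, u i with hd
    let B : Matrix (Compositions N d) (Compositions N d) R := fun u a => (k u.1).coeff (toExp a.1)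
    have hBA : B * dualMatrix R N d = 1 := by
      ext u v
      rw [Matrix.mul_apply, Matrix.one_apply]
      exact sum_coeff_mul_dualMatrix u v (hk u.1)
    have hAB : dualMatrix R N d * B = 1 := mul_eq_one_comm.1 hBA
    have key : ∀ f : MvPolynomial (Fin N) R, IsKeyPoly piHatPoly u f → f.coeff (toExp a) =
        B ⟨u, mem_compositions.2 rfl⟩ ⟨a, mem_compositions.2 ha⟩ := by
      intro f hf
      have h1 : Matrix.vecMul (fun a : Compositions N d => f.coeff (toExp a.1)) (dualMatrix R N d) =
          Pi.single ⟨u, mem_compositions.2 rfl⟩ 1 := by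
        ext v
        rw [Matrix.vecMul, dotProduct, sum_coeff_mul_dualMatrix ⟨u, mem_compositions.2 rfl⟩ v hf,
          Pi.single_apply]
        simp only [eq_comm]
      have h2 := congrArg (fun w => Matrix.vecMul w B) h1
      simp only [Matrix.vecMul_vecMul, hAB, Matrix.vecMul_one, Matrix.single_one_vecMul] at h2
      exact congrFun h2 ⟨a, mem_compositions.2 ha⟩
    rw [key f hf, key g hg]
  · rw [coeff_isKeyPoly_eq_zero hf ha, coeff_isKeyPoly_eq_zero hg ha]

theorem isKeyPoly_keyHat (u : Fin N → ℕ) : IsKeyPoly piHatPoly u (keyHat R u) := by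
  obtain ⟨f, hf⟩ := exists_isKeyPoly (R := R) piHatPoly u
  have : keyHat R u = f := theUnique_eq hf fun g hg => isKeyPoly_piHatPoly_unique hg hf
  rwa [this]

theorem coeff_aeval_X (f : MvPolynomial (Fin N) R) (e : Fin N →₀ ℕ) :
    MvPowerSeries.coeff e (MvPolynomial.aeval
      (fun i => (MvPowerSeries.X i : MvPowerSeries (Fin N) A)) f) = algebraMap R A (f.coeff e) := by
  have h : MvPolynomial.aeval (fun i => (MvPowerSeries.X i : MvPowerSeries (Fin N) A)) f =
      ((MvPolynomial.map (algebraMap R A) f : MvPolynomial (Fin N) A) : MvPowerSeries (Fin N) A) := by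
    induction f using MvPolynomial.induction_on with
    | C r => simp [MvPowerSeries.algebraMap_apply]
    | add f g hf hg => simp [hf, hg]
    | mul_X f i hf => simp [hf]
  rw [h, MvPolynomial.coeff_coe, MvPolynomial.coeff_map]

/-- Every formal power series has an expansion in the polynomials `K̂_v`, whose coefficients are given by
the dual basis. -/
theorem isFormalSum_keyHat (Ω : MvPowerSeries (Fin N) A) :
    IsFormalSum (fun v : Fin N → ℕ => MvPolynomial.aeval (fun i => MvPowerSeries.X i) (keyHat R v)
      * MvPowerSeries.C (pairing Ω (keyA R (fun i => -(v i : ℤ)) * weylDen R N))) Ω := by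
  intro e
  obtain ⟨a, rfl⟩ : ∃ a : Fin N → ℕ, e = toExp a := ⟨e, by ext; simp⟩
  set d := ∑ i, a i with hd
  have hcoeff : ∀ v, MvPowerSeries.coeff (toExp a) (MvPolynomial.aeval (fun i => MvPowerSeries.X i)
      (keyHat R v) * MvPowerSeries.C (pairing Ω (keyA R (fun i => -(v i : ℤ)) * weylDen R N))) =
      (keyHat R v).coeff (toExp a) • pairing Ω (keyA R (fun i => -(v i : ℤ)) * weylDen R N) := by
    intro v
    rw [MvPowerSeries.coeff_mul_C, coeff_aeval_X, Algebra.smul_def]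
  simp only [hcoeff]
  have hsupp : Function.support (fun v => (keyHat R v).coeff (toExp a) •
      pairing Ω (keyA R (fun i => -(v i : ℤ)) * weylDen R N)) ⊆
      ((Finset.piAntidiag Finset.univ d : Finset (Fin N → ℕ)) : Set (Fin N → ℕ)) := by
    intro v hv
    rw [Finset.mem_coe, mem_compositions]
    by_contra hne
    apply hv
    dsimp only
    rw [coeff_isKeyPoly_eq_zero (isKeyPoly_keyHat v) (Ne.symm hne), zero_smul]
  refine ⟨(Finset.finite_toSet _).subset hsupp, ?_⟩
  rw [finsum_eq_sum_of_support_subset _ hsupp, ← Finset.sum_coe_sort]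
  let B : Matrix (Compositions N d) (Compositions N d) R := fun u a => (keyHat R u.1).coeff (toExp a.1)
  have hBA : B * dualMatrix R N d = 1 := by
    ext u v
    rw [Matrix.mul_apply, Matrix.one_apply]
    exact sum_coeff_mul_dualMatrix u v (isKeyPoly_keyHat u.1)
  have hAB : dualMatrix R N d * B = 1 := mul_eq_one_comm.1 hBA
  have h1 : ∀ v : Compositions N d, (keyHat R v.1).coeff (toExp a) •
      pairing Ω (keyA R (fun i => -(v.1 i : ℤ)) * weylDen R N) =
      ∑ b, (dualMatrix R N d b v * B v ⟨a, mem_compositions.2 rfl⟩) •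
        MvPowerSeries.coeff (toExp b.1) Ω := by
    intro v
    rw [pairing_keyA_eq_sum, Finset.smul_sum]
    refine Finset.sum_congr rfl fun b _ => ?_
    rw [smul_smul, mul_comm]
  rw [Finset.sum_congr rfl fun v _ => h1 v, Finset.sum_comm]
  simp only [← Finset.sum_smul]
  have h2 : ∀ b, ∑ v, dualMatrix R N d b v * B v ⟨a, mem_compositions.2 rfl⟩ =
      if b = ⟨a, mem_compositions.2 rfl⟩ then 1 else 0 := by
    intro b
    rw [← Matrix.mul_apply, hAB, Matrix.one_apply]
  simp only [h2, ite_smul, one_smul, zero_smul, Finset.sum_ite_eq', Finset.mem_univ, if_true]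

end Expansion

end Duality

/-! ### The expansion of the kernel of type `A` -/

section TypeA

variable {R : Type*} [CommRing R] {N : ℕ}

/-- The substitution of the inverse indeterminates in the reverse order for the indeterminates. -/
def toInvRev : MvPolynomial (Fin N) R →ₐ[R] Laurent R N :=
  MvPolynomial.aeval fun i => varInv (Fin.rev i)

theorem toInvRev_X (i : Fin N) :
    toInvRev (MvPolynomial.X i : MvPolynomial (Fin N) R) = varInv (Fin.rev i) :=
  MvPolynomial.aeval_X _ _

theorem prod_varInv_rev_pow (a : Fin N → ℕ) : ∏ i, (varInv (Fin.rev i) : Laurent R N) ^ a i =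
    mono fun i => -(a (Fin.rev i) : ℤ) := by
  rw [← Equiv.prod_comp Fin.revPerm]
  simp only [varInv, mono_pow, prod_mono, Fin.revPerm_apply, Fin.rev_rev]
  congr 1
  ext k
  simp [Pi.single_apply]

theorem toInvRev_swapPoly (i j : Fin N) (f : MvPolynomial (Fin N) R) :
    toInvRev (swapPoly i j f) = actHom (swapHom (Fin.rev j) (Fin.rev i)) (toInvRev f) := by
  have : toInvRev.comp (MvPolynomial.rename (Equiv.swap i j)) =
      (actHom (swapHom (Fin.rev j) (Fin.rev i))).comp
        (toInvRev : MvPolynomial (Fin N) R →ₐ[R] Laurent R N) := by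
    refine MvPolynomial.algHom_ext fun k => ?_
    rw [AlgHom.comp_apply, AlgHom.comp_apply, MvPolynomial.rename_X, toInvRev_X, toInvRev_X, varInv,
      varInv, actHom_mono]
    congr 1
    ext l
    simp only [swapHom_apply, vecSwap, Pi.single_apply, Equiv.swap_apply_def]
    split_ifs <;> simp_all
  exact DFunLike.congr_fun this f

theorem toInvRev_piPoly {i j : Fin N} (hij : i ≠ j) (f : MvPolynomial (Fin N) R) :
    toInvRev (piPoly i j f) = piA (Fin.rev j) (Fin.rev i) (toInvRev f) := by
  refine (piA_eq' (fun h => hij (Fin.rev_injective h).symm) ?_).symm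
  have h := congrArg toInvRev (piPoly_spec i j f)
  rw [map_mul, map_sub, map_sub, map_mul, map_mul, toInvRev_X, toInvRev_X, toInvRev_swapPoly] at h
  have hi := var_mul_varInv (R := R) (Fin.rev i)
  have hj := var_mul_varInv (R := R) (Fin.rev j)
  linear_combination (var (Fin.rev i) * var (Fin.rev j)) * h
    + (var (Fin.rev j) * toInvRev f - var (Fin.rev j) * toInvRev (piPoly i j f)) * hi
    + (var (Fin.rev i) * toInvRev (piPoly i j f)
      - var (Fin.rev i) * actHom (swapHom (Fin.rev j) (Fin.rev i)) (toInvRev f)) * hj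

/-- Inversion and reversal of the indeterminates turn the key polynomials at vectors of natural numbers
into those at the opposite vectors. -/
theorem toInvRev_isKeyPoly {u : Fin N → ℕ} {f : MvPolynomial (Fin N) R}
    (hf : IsKeyPoly piPoly u f) : toInvRev f = keyA R fun i => -(u (Fin.rev i) : ℤ) := by
  induction hf with
  | dominant l hl =>
    rw [map_prod]
    simp only [map_pow, toInvRev_X, prod_varInv_rev_pow]
    refine (keyA_antitone fun i j hij => ?_).symm
    exact neg_le_neg (Nat.cast_le.2 (hl (Fin.rev_le_rev.2 hij)))
  | step u f i j hij hu _ ih =>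
    have nij := fin_ne_of_succ hij
    rw [toInvRev_piPoly nij, ih, ← keyA_vecSwap]
    · congr 1
      ext k
      simp only [vecSwap, Equiv.swap_apply_def, Fin.rev_eq_iff]
      split_ifs <;> simp_all
    · rw [Fin.val_rev, Fin.val_rev]
      have := j.2
      omega
    · simpa using hu

variable {A : Type*} [CommRing A]

/-- The kernel of type `A`, with the elements `z_j` of the ring of coefficients in place of `y_j`. -/
def kernelA (z : Fin N → A) : MvPowerSeries (Fin N) A :=
  ∏ p : Fin N × Fin N with (p.1 : ℕ) + p.2 < N, geom p.1 (z p.2)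

variable [Algebra R A]

theorem pairing_kernelA_toInvRev (z : Fin N → A) (f : MvPolynomial (Fin N) R) :
    pairing (kernelA z) (toInvRev f * weylDen R N) = MvPolynomial.aeval z f := by
  induction f using MvPolynomial.induction_on' with
  | monomial e r =>
    have h1 : toInvRev (MvPolynomial.monomial e r) =
        r • (mono fun i => -(e (Fin.rev i) : ℤ) : Laurent R N) := by
      rw [MvPolynomial.monomial_eq, map_mul, ← prod_varInv_rev_pow fun i => e i]
      rw [Finsupp.prod_fintype _ _ (by simp), map_prod]
      simp only [map_pow, toInvRev_X]
      rw [toInvRev, MvPolynomial.aeval_C, ← Algebra.smul_def]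
    rw [h1, smul_mul_assoc, map_smul, kernelA, pairing_kernelA, MvPolynomial.aeval_monomial,
      ← Algebra.smul_def, Finsupp.prod_fintype _ _ (by simp), ← Equiv.prod_comp Fin.revPerm]
    simp
  | add f g hf hg => rw [map_add, add_mul, map_add, hf, hg, map_add]

theorem toInvRev_injective :
    Function.Injective (toInvRev : MvPolynomial (Fin N) R → Laurent R N) := by
  intro f g h
  have h1 := pairing_kernelA_toInvRev (MvPolynomial.X : Fin N → MvPolynomial (Fin N) R) f
  have h2 := pairing_kernelA_toInvRev (MvPolynomial.X : Fin N → MvPolynomial (Fin N) R) g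
  rw [h, h2] at h1
  simpa using h1.symm

theorem isKeyPoly_key (u : Fin N → ℕ) : IsKeyPoly piPoly u (key R u) := by
  obtain ⟨f, hf⟩ := exists_isKeyPoly (R := R) piPoly u
  have : key R u = f := theUnique_eq hf fun g hg =>
    toInvRev_injective ((toInvRev_isKeyPoly hg).trans (toInvRev_isKeyPoly hf).symm)
  rwa [this]

theorem pairing_kernelA_keyA (z : Fin N → A) (v : Fin N → ℕ) :
    pairing (kernelA z) (keyA R (fun i => -(v i : ℤ)) * weylDen R N) =
      MvPolynomial.aeval z (key R fun i => v (Fin.rev i)) := by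
  rw [← pairing_kernelA_toInvRev, toInvRev_isKeyPoly (isKeyPoly_key _)]
  simp only [Fin.rev_rev]

theorem ring_inverse_eq {S : Type*} [CommRing S] {a b : S} (h : a * b = 1) : Ring.inverse a = b :=
  (IsUnit.of_mul_eq_one b h).mul_left_cancel
    ((Ring.mul_inverse_cancel a (IsUnit.of_mul_eq_one b h)).trans h.symm)

theorem omegaA_eq (n : ℕ) : omegaA (xs R n) (ys R n) = kernelA var := by
  have hset : (Finset.univ.filter fun p : Fin n × Fin n => (p.1 : ℕ) + 1 + ((p.2 : ℕ) + 1) ≤ n + 1) =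
      Finset.univ.filter fun p : Fin n × Fin n => (p.1 : ℕ) + p.2 < n := by
    ext p
    simp only [Finset.mem_filter, Finset.mem_univ, true_and]
    omega
  unfold omegaA kernelA
  rw [hset]
  refine ring_inverse_eq ?_
  rw [← Finset.prod_mul_distrib]
  exact Finset.prod_eq_one fun p _ => one_sub_mul_geom _ _

/-- The expansion of the kernel of type `A`. -/
theorem isFormalSum_omegaA (R : Type*) [CommRing R] (n : ℕ) : IsFormalSum
    (fun v : Fin n → ℕ => MvPolynomial.aeval (xs R n) (keyHat R v)
      * MvPolynomial.aeval (ys R n) (key R (fun i => v (Fin.rev i))))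
    (omegaA (xs R n) (ys R n)) := by
  rw [omegaA_eq]
  have h := isFormalSum_keyHat (R := R) (kernelA (var : Fin n → Laurent R n))
  have hy : ∀ f : MvPolynomial (Fin n) R, MvPolynomial.aeval (ys R n) f =
      MvPowerSeries.C (MvPolynomial.aeval (var : Fin n → Laurent R n) f) := by
    intro f
    induction f using MvPolynomial.induction_on with
    | C r => simp [MvPowerSeries.algebraMap_apply]
    | add f g hf hg => simp [hf, hg]
    | mul_X f i hf => simp [hf, ys, inY]
  simp only [pairing_kernelA_keyA] at h
  simp only [hy]
  exact h

end TypeA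

/-! ### Divided differences of kernels -/

section KernelSteps

variable {R : Type*} [CommRing R] {N n : ℕ}

theorem map_geom {A B : Type*} [CommRing A] [CommRing B] (σ : A →+* B) (i : Fin N) (z : A) :
    MvPowerSeries.map σ (geom i z) = geom i (σ z) := by
  have h1 := congrArg (MvPowerSeries.map σ) (one_sub_mul_geom i z)
  rw [map_mul, map_sub, map_one, map_mul, MvPowerSeries.map_X, MvPowerSeries.map_C] at h1
  exact (isUnit_one_sub_X_mul i _).mul_left_cancel (h1.trans (one_sub_mul_geom i _).symm)

theorem rename_geom {A : Type*} [CommRing A] (e : Equiv.Perm (Fin N)) (i : Fin N) (z : A) :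
    MvPowerSeries.rename e (geom i z) = geom (e i) z := by
  have h1 := congrArg (MvPowerSeries.rename e) (one_sub_mul_geom i z)
  rw [map_mul, map_sub, map_one, map_mul, MvPowerSeries.rename_X, MvPowerSeries.rename_C] at h1
  exact (isUnit_one_sub_X_mul _ _).mul_left_cancel (h1.trans (one_sub_mul_geom _ _).symm)

/-- The action on power series of an operation on the indeterminates `y`. -/
abbrev mapY (s : (Fin n → ℤ) →+ (Fin n → ℤ)) :
    MvPowerSeries (Fin N) (Laurent R n) →+* MvPowerSeries (Fin N) (Laurent R n) :=
  MvPowerSeries.map ((actHom s : Laurent R n →ₐ[R] Laurent R n) : Laurent R n →+* Laurent R n)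

theorem pairing_mapY (s : (Fin n → ℤ) →+ (Fin n → ℤ)) (Ω : MvPowerSeries (Fin N) (Laurent R n))
    (h : Laurent R N) : pairing (mapY s Ω) h = actHom s (pairing Ω h) :=
  pairing_map (actHom s) Ω h

theorem pairing_mul_piA {i j : Fin n} (hij : i ≠ j) {S U U' : MvPowerSeries (Fin N) (Laurent R n)}
    (hS : mapY (swapHom i j) S = S)
    (hU : MvPowerSeries.C (var i - var j) * U' = MvPowerSeries.C (var i) * U
      - MvPowerSeries.C (var j) * mapY (swapHom i j) U) (h : Laurent R N) :
    pairing (S * U') h = piA i j (pairing (S * U) h) := by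
  refine (piA_eq' hij ?_).symm
  rw [← pairing_C_mul, ← pairing_C_mul, ← pairing_mapY, ← pairing_C_mul, ← pairing_sub, map_mul, hS]
  refine congrArg (fun Ω => pairing Ω h) ?_
  linear_combination S * hU

theorem pairing_mul_piBC (β : R) {i : Fin n} {S U U' : MvPowerSeries (Fin N) (Laurent R n)}
    (hS : mapY (negHom i) S = S)
    (hU : MvPowerSeries.C (var i - varInv i) * U' =
      MvPowerSeries.C (var i + algebraMap R (Laurent R n) β) * U
      - MvPowerSeries.C (varInv i + algebraMap R (Laurent R n) β) * mapY (negHom i) U)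
    (h : Laurent R N) :
    pairing (S * U') h = piBC β i (pairing (S * U) h) := by
  refine (piBC_eq' β ?_).symm
  rw [← pairing_C_mul, ← pairing_C_mul, ← pairing_mapY, ← pairing_C_mul, ← pairing_sub, map_mul, hS]
  refine congrArg (fun Ω => pairing Ω h) ?_
  linear_combination S * hU

theorem pairing_mul_piD {i j : Fin n} (hij : i ≠ j) {S U U' : MvPowerSeries (Fin N) (Laurent R n)}
    (hS : mapY (tauHom i j) S = S)
    (hU : MvPowerSeries.C (1 - varInv i * varInv j) * U' =
      U - MvPowerSeries.C (varInv i * varInv j) * mapY (tauHom i j) U) (h : Laurent R N) :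
    pairing (S * U') h = piD i j (pairing (S * U) h) := by
  rw [varInv_mul_varInv] at hU
  refine (piD_eq hij ?_).symm
  rw [← pairing_C_mul, ← pairing_mapY, ← pairing_C_mul, ← pairing_sub, map_mul, hS]
  refine congrArg (fun Ω => pairing Ω h) ?_
  linear_combination S * hU

theorem actHom_swap_var (i j k : Fin n) :
    actHom (swapHom i j) (var k : Laurent R n) = var (Equiv.swap i j k) := by
  rw [var, var, actHom_mono]
  congr 1
  ext l
  simp only [swapHom_apply, vecSwap, Pi.single_apply]
  simp only [← Equiv.swap_apply_eq_iff]

theorem actHom_swap_varInv (i j k : Fin n) :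
    actHom (swapHom i j) (varInv k : Laurent R n) = varInv (Equiv.swap i j k) := by
  rw [varInv, varInv, actHom_mono]
  congr 1
  ext l
  simp only [swapHom_apply, vecSwap, Pi.single_apply]
  simp only [← Equiv.swap_apply_eq_iff]

theorem actHom_neg_var_self (i : Fin n) :
    actHom (negHom i) (var i : Laurent R n) = varInv i := by
  rw [var, varInv, actHom_mono]
  congr 1
  ext l
  by_cases h : l = i <;> simp [vecNeg, h]

theorem actHom_neg_varInv_self (i : Fin n) :
    actHom (negHom i) (varInv i : Laurent R n) = var i := by
  rw [← actHom_neg_var_self, actHom_neg_neg]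

theorem actHom_neg_var_of_ne {i k : Fin n} (h : k ≠ i) :
    actHom (negHom i) (var k : Laurent R n) = var k := by
  refine actHom_mono_fixed ?_
  ext l
  by_cases hl : l = i
  · subst hl; simp [vecNeg, h.symm]
  · simp [vecNeg, hl]

theorem actHom_neg_varInv_of_ne {i k : Fin n} (h : k ≠ i) :
    actHom (negHom i) (varInv k : Laurent R n) = varInv k := by
  refine actHom_mono_fixed ?_
  ext l
  by_cases hl : l = i
  · subst hl; simp [vecNeg, h.symm]
  · simp [vecNeg, hl]

theorem actHom_tau_var_left {i j : Fin n} (hij : i ≠ j) :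
    actHom (tauHom i j) (var i : Laurent R n) = varInv j := by
  rw [var, varInv, actHom_mono]
  congr 1
  ext l
  simp only [tauHom_apply, vecTau, Pi.single_apply]
  split_ifs <;> simp_all

theorem actHom_tau_var_right {i j : Fin n} (hij : i ≠ j) :
    actHom (tauHom i j) (var j : Laurent R n) = varInv i := by
  rw [var, varInv, actHom_mono]
  congr 1
  ext l
  simp only [tauHom_apply, vecTau, Pi.single_apply]
  split_ifs <;> simp_all

theorem actHom_tau_varInv_left {i j : Fin n} (hij : i ≠ j) :
    actHom (tauHom i j) (varInv i : Laurent R n) = var j := by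
  rw [← actHom_tau_var_right hij, actHom_tau_tau hij]

theorem actHom_tau_varInv_right {i j : Fin n} (hij : i ≠ j) :
    actHom (tauHom i j) (varInv j : Laurent R n) = var i := by
  rw [← actHom_tau_var_left hij, actHom_tau_tau hij]

theorem actHom_tau_var_of_ne {i j k : Fin n} (hi : k ≠ i) (hj : k ≠ j) :
    actHom (tauHom i j) (var k : Laurent R n) = var k := by
  refine actHom_mono_fixed ?_
  ext l
  simp only [tauHom_apply, vecTau, Pi.single_apply]
  split_ifs <;> simp_all

theorem actHom_tau_varInv_of_ne {i j k : Fin n} (hi : k ≠ i) (hj : k ≠ j) :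
    actHom (tauHom i j) (varInv k : Laurent R n) = varInv k := by
  refine actHom_mono_fixed ?_
  ext l
  simp only [tauHom_apply, vecTau, Pi.single_apply]
  split_ifs <;> simp_all

open Classical in
/-- The product of the factors `1 / (1 - x_i y_j)` with `P i j` and of the factors `1 / (1 - x_i / y_j)`
with `Q i j`. -/
def kern (R : Type*) [CommRing R] (N n : ℕ) (P Q : ℕ → ℕ → Prop) :
    MvPowerSeries (Fin N) (Laurent R n) :=
  ∏ i : Fin N, ∏ j : Fin n,
    (if P i j then geom i (var j) else 1) * (if Q i j then geom i (varInv j) else 1)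

theorem kern_congr {P Q P' Q' : ℕ → ℕ → Prop} (hP : ∀ i j, i < N → j < n → (P i j ↔ P' i j))
    (hQ : ∀ i j, i < N → j < n → (Q i j ↔ Q' i j)) : kern R N n P Q = kern R N n P' Q' := by
  classical
  unfold kern
  refine Finset.prod_congr rfl fun i _ => Finset.prod_congr rfl fun j _ => ?_
  have h1 := hP _ _ i.2 j.2
  have h2 := hQ _ _ i.2 j.2
  exact congrArg₂ _ (if_congr h1 rfl rfl) (if_congr h2 rfl rfl)

theorem kern_insert_left {P P' Q : ℕ → ℕ → Prop} (a : Fin N) (m : Fin n)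
    (h : ∀ i j, P' i j ↔ P i j ∨ (i = a ∧ j = m)) (hn : ¬ P a m) :
    kern R N n P' Q = kern R N n P Q * geom a (var m) := by
  classical
  have h1 : ∏ i : Fin N, ∏ j : Fin n, (if i = a then if j = m then
      (geom i (var j) : MvPowerSeries (Fin N) (Laurent R n)) else 1 else 1) = geom a (var m) := by
    rw [Finset.prod_eq_single a (fun b _ hb => by simp [hb]) (by simp)]
    simp
  rw [← h1, kern, kern]
  simp only [← Finset.prod_mul_distrib]
  refine Finset.prod_congr rfl fun i _ => Finset.prod_congr rfl fun j _ => ?_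
  by_cases hi : i = a
  · by_cases hj : j = m
    · subst hi hj
      rw [if_pos ((h _ _).2 (.inr ⟨rfl, rfl⟩)), if_neg hn, if_pos rfl, if_pos rfl]
      ring
    · have : P' i j ↔ P i j := by
        rw [h, or_iff_left]
        exact fun h => hj (Fin.ext h.2)
      simp only [this, hj, if_false, ite_self, mul_one]
  · have : P' i j ↔ P i j := by
      rw [h, or_iff_left]
      exact fun h => hi (Fin.ext h.1)
    simp only [this, hi, if_false, mul_one]

theorem kern_insert_right {P Q Q' : ℕ → ℕ → Prop} (a : Fin N) (m : Fin n)
    (h : ∀ i j, Q' i j ↔ Q i j ∨ (i = a ∧ j = m)) (hn : ¬ Q a m) :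
    kern R N n P Q' = kern R N n P Q * geom a (varInv m) := by
  classical
  have h1 : ∏ i : Fin N, ∏ j : Fin n, (if i = a then if j = m then
      (geom i (varInv j) : MvPowerSeries (Fin N) (Laurent R n)) else 1 else 1) =
      geom a (varInv m) := by
    rw [Finset.prod_eq_single a (fun b _ hb => by simp [hb]) (by simp)]
    simp
  rw [← h1, kern, kern]
  simp only [← Finset.prod_mul_distrib]
  refine Finset.prod_congr rfl fun i _ => Finset.prod_congr rfl fun j _ => ?_
  by_cases hi : i = a
  · by_cases hj : j = m
    · subst hi hj
      rw [if_pos ((h _ _).2 (.inr ⟨rfl, rfl⟩)), if_neg hn, if_pos rfl, if_pos rfl]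
      ring
    · have : Q' i j ↔ Q i j := by
        rw [h, or_iff_left]
        exact fun h => hj (Fin.ext h.2)
      simp only [this, hj, if_false, ite_self, mul_one]
  · have : Q' i j ↔ Q i j := by
      rw [h, or_iff_left]
      exact fun h => hi (Fin.ext h.1)
    simp only [this, hi, if_false, mul_one]

theorem mapY_geom (s : (Fin n → ℤ) →+ (Fin n → ℤ)) (i : Fin N) (z : Laurent R n) :
    mapY s (geom i z) = geom i (actHom s z) :=
  map_geom _ _ _

theorem mapY_ite (s : (Fin n → ℤ) →+ (Fin n → ℤ)) (p : Prop) [Decidable p] (i : Fin N)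
    (z : Laurent R n) : mapY s (if p then geom i z else 1) =
      if p then geom i (actHom s z) else 1 := by
  split_ifs
  · exact map_geom _ _ _
  · exact map_one _

theorem mapY_kern_swap {P Q : ℕ → ℕ → Prop} {m m' : Fin n} (hP : ∀ i, P i m ↔ P i m')
    (hQ : ∀ i, Q i m ↔ Q i m') : mapY (swapHom m m') (kern R N n P Q) = kern R N n P Q := by
  classical
  unfold kern
  simp only [map_prod]
  refine Finset.prod_congr rfl fun i _ => ?_
  conv_rhs => rw [← Equiv.prod_comp (Equiv.swap m m')]
  refine Finset.prod_congr rfl fun j _ => ?_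
  rw [map_mul, mapY_ite, mapY_ite, actHom_swap_var, actHom_swap_varInv]
  have h1 : P i (Equiv.swap m m' j) ↔ P i j := by
    rw [Equiv.swap_apply_def]; split_ifs with h1 h2
    · rw [h1, hP]
    · rw [h2, hP]
    · rfl
  have h2 : Q i (Equiv.swap m m' j) ↔ Q i j := by
    rw [Equiv.swap_apply_def]; split_ifs with h1 h2
    · rw [h1, hQ]
    · rw [h2, hQ]
    · rfl
  simp only [h1, h2]

theorem mapY_kern_neg {P Q : ℕ → ℕ → Prop} {m : Fin n} (h : ∀ i, P i m ↔ Q i m) :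
    mapY (negHom m) (kern R N n P Q) = kern R N n P Q := by
  classical
  unfold kern
  simp only [map_prod]
  refine Finset.prod_congr rfl fun i _ => Finset.prod_congr rfl fun j _ => ?_
  rw [map_mul, mapY_ite, mapY_ite]
  by_cases hj : j = m
  · subst hj
    rw [actHom_neg_var_self, actHom_neg_varInv_self, mul_comm]
    simp only [h]
  · rw [actHom_neg_var_of_ne hj, actHom_neg_varInv_of_ne hj]

theorem mapY_kern_tau {P Q : ℕ → ℕ → Prop} {m m' : Fin n} (hm : m ≠ m') (h : ∀ i, P i m ↔ Q i m')
    (h' : ∀ i, P i m' ↔ Q i m) :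
    mapY (tauHom m m') (kern R N n P Q) = kern R N n P Q := by
  classical
  unfold kern
  simp only [map_prod]
  refine Finset.prod_congr rfl fun i _ => ?_
  conv_rhs => rw [← Equiv.prod_comp (Equiv.swap m m')]
  refine Finset.prod_congr rfl fun j _ => ?_
  rw [map_mul, mapY_ite, mapY_ite]
  by_cases hj : j = m
  · subst hj
    rw [actHom_tau_var_left hm, actHom_tau_varInv_left hm, mul_comm, Equiv.swap_apply_left]
    simp only [h, h']
  · by_cases hj' : j = m'
    · subst hj'
      rw [actHom_tau_var_right hm, actHom_tau_varInv_right hm, mul_comm, Equiv.swap_apply_right]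
      simp only [h, h']
    · rw [actHom_tau_var_of_ne hj hj', actHom_tau_varInv_of_ne hj hj',
        Equiv.swap_apply_of_ne_of_ne hj hj']

theorem rename_kern_swap {P Q : ℕ → ℕ → Prop} {a b : Fin N} (hP : ∀ j, P a j ↔ P b j)
    (hQ : ∀ j, Q a j ↔ Q b j) :
    MvPowerSeries.rename (Equiv.swap a b) (kern R N n P Q) = kern R N n P Q := by
  classical
  unfold kern
  simp only [map_prod]
  conv_rhs => rw [← Equiv.prod_comp (Equiv.swap a b)]
  refine Finset.prod_congr rfl fun i _ => Finset.prod_congr rfl fun j _ => ?_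
  have h1 : P (Equiv.swap a b i) j ↔ P i j := by
    rw [Equiv.swap_apply_def]; split_ifs with h1 h2
    · rw [h1, hP]
    · rw [h2, hP]
    · rfl
  have h2 : Q (Equiv.swap a b i) j ↔ Q i j := by
    rw [Equiv.swap_apply_def]; split_ifs with h1 h2
    · rw [h1, hQ]
    · rw [h2, hQ]
    · rfl
  rw [map_mul]
  simp only [h1, h2]
  congr 1
  · split_ifs
    · exact rename_geom _ _ _
    · exact map_one _
  · split_ifs
    · exact rename_geom _ _ _
    · exact map_one _

/-- A power series with coefficients in `R`, as a series with coefficients in the Laurent polynomials. -/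
abbrev const (n : ℕ) : MvPowerSeries (Fin N) R →+* MvPowerSeries (Fin N) (Laurent R n) :=
  MvPowerSeries.map (algebraMap R (Laurent R n))

theorem mapY_const (s : (Fin n → ℤ) →+ (Fin n → ℤ)) (c : MvPowerSeries (Fin N) R) :
    mapY s (const n c) = const n c := by
  ext1 e
  simp only [MvPowerSeries.coeff_map]
  exact (actHom s).commutes _

theorem C_var_mul_C_varInv (j : Fin n) : (MvPowerSeries.C (var j) * MvPowerSeries.C (varInv j) :
    MvPowerSeries (Fin N) (Laurent R n)) = 1 := by
  rw [← map_mul, var_mul_varInv, map_one]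

theorem kernel_identity {S : Type*} [CommRing S] {x w y y' z z' g₁ g₂ g₃ g₄ : S}
    (h₁ : (1 - x * y) * g₁ = 1) (h₂ : (1 - x * y') * g₂ = 1) (h₃ : (1 - w * z) * g₃ = 1)
    (h₄ : (1 - w * z') * g₄ = 1) (hz : y * z = 1) (hz' : y' * z' = 1) :
    (y - y') * ((1 - x * w) * (g₁ * g₂ * g₄ * g₃)) = y * (g₁ * g₄) - y' * (g₂ * g₃) := by
  have e1 : y * (g₁ * g₄) = y * (g₁ * g₄) * ((1 - x * y') * g₂) * ((1 - w * z) * g₃) := by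
    rw [h₂, h₃, mul_one, mul_one]
  have e2 : y' * (g₂ * g₃) = y' * (g₂ * g₃) * ((1 - x * y) * g₁) * ((1 - w * z') * g₄) := by
    rw [h₁, h₄, mul_one, mul_one]
  rw [e1, e2]
  linear_combination g₁ * g₂ * g₃ * g₄ * w * ((1 - x * y') * hz - (1 - x * y) * hz')

/-- The step that creates a factor `1 - x_a x_b`. -/
theorem pairing_kern_step {P₀ P P' Q₀ Q Q' : ℕ → ℕ → Prop} {a b : Fin N} {m m' : Fin n} (hm : m ≠ m')
    (hP₀ : ∀ i, P₀ i m ↔ P₀ i m') (hQ₀ : ∀ i, Q₀ i m ↔ Q₀ i m')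
    (ha : ¬ P₀ a m) (hb : ¬ Q₀ b m)
    (hP : ∀ i j, P i j ↔ P₀ i j ∨ (i = a ∧ j = m))
    (hP' : ∀ i j, P' i j ↔ P i j ∨ (i = a ∧ j = m'))
    (hQ : ∀ i j, Q i j ↔ Q₀ i j ∨ (i = b ∧ j = m'))
    (hQ' : ∀ i j, Q' i j ↔ Q i j ∨ (i = b ∧ j = m))
    (c : MvPowerSeries (Fin N) R) (h : Laurent R N) :
    pairing (const n (c * (1 - MvPowerSeries.X a * MvPowerSeries.X b)) * kern R N n P' Q') h =
      piA m m' (pairing (const n c * kern R N n P Q) h) := by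
  have hmv : (m : ℕ) ≠ m' := fun h => hm (Fin.ext h)
  have e1 : kern R N n P' Q' = kern R N n P₀ Q₀ * (geom a (var m) * geom a (var m') *
      geom b (varInv m') * geom b (varInv m)) := by
    rw [kern_insert_left a m' hP', kern_insert_left a m hP, kern_insert_right b m hQ',
      kern_insert_right b m' hQ]
    · ring
    · rwa [← hQ₀]
    · rw [hQ]
      rintro (h | h)
      · exact hb h
      · exact hmv h.2
    · exact ha
    · rw [hP]
      rintro (h | h)
      · exact ha ((hP₀ _).2 h)
      · exact hmv h.2.symm
  have e2 : const n c * kern R N n P Q =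
      const n c * kern R N n P₀ Q₀ * (geom a (var m) * geom b (varInv m')) := by
    rw [kern_insert_left a m hP ha, kern_insert_right b m' hQ (by rwa [← hQ₀])]
    ring
  have e3 : const n (c * (1 - MvPowerSeries.X a * MvPowerSeries.X b)) * kern R N n P' Q' =
      const n c * kern R N n P₀ Q₀ * ((1 - MvPowerSeries.X a * MvPowerSeries.X b) *
        (geom a (var m) * geom a (var m') * geom b (varInv m') * geom b (varInv m))) := by
    rw [e1, map_mul, map_sub, map_one, map_mul, MvPowerSeries.map_X, MvPowerSeries.map_X]
    exact mul_mul_mul_comm _ _ _ _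
  have e4 : mapY (swapHom m m') (geom a (var m) * geom b (varInv m') :
      MvPowerSeries (Fin N) (Laurent R n)) = geom a (var m') * geom b (varInv m) := by
    rw [map_mul, mapY_geom, mapY_geom, actHom_swap_var, actHom_swap_varInv, Equiv.swap_apply_left,
      Equiv.swap_apply_right]
  rw [e3, e2]
  have hS : mapY (swapHom m m') (const n c * kern R N n P₀ Q₀) = const n c * kern R N n P₀ Q₀ := by
    rw [map_mul, mapY_const, mapY_kern_swap hP₀ hQ₀]
  refine pairing_mul_piA hm hS ?_ h
  rw [e4, map_sub]
  exact kernel_identity (one_sub_mul_geom a _) (one_sub_mul_geom a _) (one_sub_mul_geom b _)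
    (one_sub_mul_geom b _) (C_var_mul_C_varInv m) (C_var_mul_C_varInv m')

end KernelSteps

section MoreSteps

variable {R : Type*} [CommRing R] {N n : ℕ}

theorem kernel_identity_left {S : Type*} [CommRing S] {x y y' g₁ g₂ : S}
    (h₁ : (1 - x * y) * g₁ = 1) (h₂ : (1 - x * y') * g₂ = 1) :
    (y - y') * (g₁ * g₂) = y * g₁ - y' * g₂ := by
  linear_combination y * g₁ * h₂ - y' * g₂ * h₁

/-- The step that adds the second of the factors `1 / (1 - x_a y_m)` and `1 / (1 - x_a y_{m'})`. -/
theorem pairing_kern_step_left {P₀ P P' Q : ℕ → ℕ → Prop} {a : Fin N} {m m' : Fin n} (hm : m ≠ m')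
    (hP₀ : ∀ i, P₀ i m ↔ P₀ i m') (hQ : ∀ i, Q i m ↔ Q i m') (ha : ¬ P₀ a m)
    (hP : ∀ i j, P i j ↔ P₀ i j ∨ (i = a ∧ j = m))
    (hP' : ∀ i j, P' i j ↔ P i j ∨ (i = a ∧ j = m'))
    (c : MvPowerSeries (Fin N) R) (h : Laurent R N) :
    pairing (const n c * kern R N n P' Q) h = piA m m' (pairing (const n c * kern R N n P Q) h) := by
  have hmv : (m : ℕ) ≠ m' := fun h => hm (Fin.ext h)
  have e1 : const n c * kern R N n P' Q =
      const n c * kern R N n P₀ Q * (geom a (var m) * geom a (var m')) := by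
    rw [kern_insert_left a m' hP', kern_insert_left a m hP ha]
    · ring
    · rw [hP]
      rintro (h | h)
      · exact ha ((hP₀ _).2 h)
      · exact hmv h.2.symm
  have e2 : const n c * kern R N n P Q = const n c * kern R N n P₀ Q * geom a (var m) := by
    rw [kern_insert_left a m hP ha, mul_assoc]
  have hS : mapY (swapHom m m') (const n c * kern R N n P₀ Q) = const n c * kern R N n P₀ Q := by
    rw [map_mul, mapY_const, mapY_kern_swap hP₀ hQ]
  rw [e1, e2]
  refine pairing_mul_piA hm hS ?_ h
  rw [mapY_geom, actHom_swap_var, Equiv.swap_apply_left, map_sub]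
  exact kernel_identity_left (one_sub_mul_geom a _) (one_sub_mul_geom a _)

/-- The step that adds the second of the factors `1 / (1 - x_a / y_{m'})` and `1 / (1 - x_a / y_m)`. -/
theorem pairing_kern_step_right {P Q₀ Q Q' : ℕ → ℕ → Prop} {a : Fin N} {m m' : Fin n} (hm : m ≠ m')
    (hP : ∀ i, P i m ↔ P i m') (hQ₀ : ∀ i, Q₀ i m ↔ Q₀ i m') (ha : ¬ Q₀ a m)
    (hQ : ∀ i j, Q i j ↔ Q₀ i j ∨ (i = a ∧ j = m'))
    (hQ' : ∀ i j, Q' i j ↔ Q i j ∨ (i = a ∧ j = m))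
    (c : MvPowerSeries (Fin N) R) (h : Laurent R N) :
    pairing (const n c * kern R N n P Q') h = piA m m' (pairing (const n c * kern R N n P Q) h) := by
  have hmv : (m : ℕ) ≠ m' := fun h => hm (Fin.ext h)
  have e1 : const n c * kern R N n P Q' =
      const n c * kern R N n P Q₀ * (geom a (varInv m) * geom a (varInv m')) := by
    rw [kern_insert_right a m hQ', kern_insert_right a m' hQ (by rwa [← hQ₀])]
    · ring
    · rw [hQ]
      rintro (h | h)
      · exact ha h
      · exact hmv h.2
  have e2 : const n c * kern R N n P Q = const n c * kern R N n P Q₀ * geom a (varInv m') := by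
    rw [kern_insert_right a m' hQ (by rwa [← hQ₀]), mul_assoc]
  have hS : mapY (swapHom m m') (const n c * kern R N n P Q₀) = const n c * kern R N n P Q₀ := by
    rw [map_mul, mapY_const, mapY_kern_swap hP hQ₀]
  rw [e1, e2]
  refine pairing_mul_piA hm hS ?_ h
  rw [mapY_geom, actHom_swap_varInv, Equiv.swap_apply_right, map_sub]
  have h1 := one_sub_mul_geom a (varInv m : Laurent R n)
  have h2 := one_sub_mul_geom a (varInv m' : Laurent R n)
  have i1 := C_var_mul_C_varInv (N := N) (R := R) m
  have i2 := C_var_mul_C_varInv (N := N) (R := R) m'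
  set x : MvPowerSeries (Fin N) (Laurent R n) := MvPowerSeries.X a
  set g₁ : MvPowerSeries (Fin N) (Laurent R n) := geom a (varInv m)
  set g₂ : MvPowerSeries (Fin N) (Laurent R n) := geom a (varInv m')
  linear_combination MvPowerSeries.C (var m) * g₂ * h1 - MvPowerSeries.C (var m') * g₁ * h2
    + x * g₁ * g₂ * (i1 - i2)

theorem kernel_identity_BC {S : Type*} [CommRing S] {b x y z g₁ g₂ : S}
    (h₁ : (1 - x * y) * g₁ = 1) (h₂ : (1 - x * z) * g₂ = 1) :
    (y - z) * ((1 + b * x) * (g₁ * g₂)) = (y + b) * g₁ - (z + b) * g₂ := by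
  linear_combination (y + b) * g₁ * h₂ - (z + b) * g₂ * h₁

/-- The step that creates a factor `1 + β x_a`. -/
theorem pairing_kern_step_BC (β : R) {P₀ P Q Q' : ℕ → ℕ → Prop} {a : Fin N} {m : Fin n}
    (h₀ : ∀ i, P₀ i m ↔ Q i m) (ha : ¬ P₀ a m)
    (hP : ∀ i j, P i j ↔ P₀ i j ∨ (i = a ∧ j = m))
    (hQ' : ∀ i j, Q' i j ↔ Q i j ∨ (i = a ∧ j = m))
    (c : MvPowerSeries (Fin N) R) (h : Laurent R N) :
    pairing (const n (c * (1 + MvPowerSeries.C β * MvPowerSeries.X a)) * kern R N n P Q') h =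
      piBC β m (pairing (const n c * kern R N n P Q) h) := by
  have e1 : const n (c * (1 + MvPowerSeries.C β * MvPowerSeries.X a)) * kern R N n P Q' =
      const n c * kern R N n P₀ Q *
        ((1 + MvPowerSeries.C (algebraMap R (Laurent R n) β) * MvPowerSeries.X a) *
          (geom a (var m) * geom a (varInv m))) := by
    rw [kern_insert_right a m hQ' (by rwa [← h₀]), kern_insert_left a m hP ha, map_mul, map_add,
      map_one, map_mul, MvPowerSeries.map_X, MvPowerSeries.map_C, mul_assoc (kern R N n P₀ Q)]
    exact mul_mul_mul_comm _ _ _ _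
  have e2 : const n c * kern R N n P Q = const n c * kern R N n P₀ Q * geom a (var m) := by
    rw [kern_insert_left a m hP ha, mul_assoc]
  have hS : mapY (negHom m) (const n c * kern R N n P₀ Q) = const n c * kern R N n P₀ Q := by
    rw [map_mul, mapY_const, mapY_kern_neg h₀]
  rw [e1, e2]
  refine pairing_mul_piBC β hS ?_ h
  rw [mapY_geom, actHom_neg_var_self, map_sub, map_add, map_add]
  exact kernel_identity_BC (one_sub_mul_geom a _) (one_sub_mul_geom a _)

theorem kernel_identity_D {S : Type*} [CommRing S] {x y y' z z' g₁ g₂ g₃ g₄ : S}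
    (h₁ : (1 - x * y) * g₁ = 1) (h₂ : (1 - x * y') * g₂ = 1) (h₃ : (1 - x * z) * g₃ = 1)
    (h₄ : (1 - x * z') * g₄ = 1) (hz : y * z = 1) (hz' : y' * z' = 1) :
    (1 - z * z') * ((1 - x * x) * (g₁ * g₂ * g₃ * g₄)) = g₁ * g₂ - z * z' * (g₄ * g₃) := by
  have e1 : g₁ * g₂ = g₁ * g₂ * ((1 - x * z) * g₃) * ((1 - x * z') * g₄) := by
    rw [h₃, h₄, mul_one, mul_one]
  have e2 : z * z' * (g₄ * g₃) = z * z' * (g₄ * g₃) * ((1 - x * y) * g₁) * ((1 - x * y') * g₂) := by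
    rw [h₁, h₂, mul_one, mul_one]
  rw [e2]
  conv_rhs => rw [e1]
  linear_combination g₁ * g₂ * g₃ * g₄ * ((x ^ 2 * y' * z' - x * z') * hz + (x ^ 2 - x * z) * hz')

/-- The step that creates a factor `1 - x_a ^ 2`. -/
theorem pairing_kern_step_D {P₀ P₁ P Q Q₁ Q' : ℕ → ℕ → Prop} {a : Fin N} {m m' : Fin n} (hm : m ≠ m')
    (h₀ : ∀ i, P₀ i m ↔ Q i m') (h₀' : ∀ i, P₀ i m' ↔ Q i m) (ha : ¬ P₀ a m) (ha' : ¬ P₀ a m')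
    (hP₁ : ∀ i j, P₁ i j ↔ P₀ i j ∨ (i = a ∧ j = m))
    (hP : ∀ i j, P i j ↔ P₁ i j ∨ (i = a ∧ j = m'))
    (hQ₁ : ∀ i j, Q₁ i j ↔ Q i j ∨ (i = a ∧ j = m))
    (hQ' : ∀ i j, Q' i j ↔ Q₁ i j ∨ (i = a ∧ j = m'))
    (c : MvPowerSeries (Fin N) R) (h : Laurent R N) :
    pairing (const n (c * (1 - MvPowerSeries.X a * MvPowerSeries.X a)) * kern R N n P Q') h =
      piD m m' (pairing (const n c * kern R N n P Q) h) := by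
  have hmv : (m : ℕ) ≠ m' := fun h => hm (Fin.ext h)
  have nP : ¬ P₁ a m' := by
    rw [hP₁]; rintro (h | h)
    · exact ha' h
    · exact hmv h.2.symm
  have nQ : ¬ Q₁ a m' := by
    rw [hQ₁]; rintro (h | h)
    · exact ha ((h₀ _).2 h)
    · exact hmv h.2.symm
  have nQ' : ¬ Q a m := fun h => ha' ((h₀' _).2 h)
  have e1 : const n (c * (1 - MvPowerSeries.X a * MvPowerSeries.X a)) * kern R N n P Q' =
      const n c * kern R N n P₀ Q * ((1 - MvPowerSeries.X a * MvPowerSeries.X a) *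
          (geom a (var m) * geom a (var m') * geom a (varInv m) * geom a (varInv m'))) := by
    rw [kern_insert_right a m' hQ' nQ, kern_insert_right a m hQ₁ nQ', kern_insert_left a m' hP nP,
      kern_insert_left a m hP₁ ha, map_mul, map_sub, map_one, map_mul, MvPowerSeries.map_X]
    simp only [mul_assoc, mul_left_comm]
  have e2 : const n c * kern R N n P Q =
      const n c * kern R N n P₀ Q * (geom a (var m) * geom a (var m')) := by
    rw [kern_insert_left a m' hP nP, kern_insert_left a m hP₁ ha]
    simp only [mul_assoc]
  have hS : mapY (tauHom m m') (const n c * kern R N n P₀ Q) = const n c * kern R N n P₀ Q := by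
    rw [map_mul, mapY_const, mapY_kern_tau hm h₀ h₀']
  rw [e1, e2]
  refine pairing_mul_piD hm hS ?_ h
  have e3 : mapY (tauHom m m') (geom a (var m) * geom a (var m') :
      MvPowerSeries (Fin N) (Laurent R n)) = geom a (varInv m') * geom a (varInv m) := by
    rw [map_mul, mapY_geom, mapY_geom, actHom_tau_var_left hm, actHom_tau_var_right hm]
  rw [e3, map_sub, map_one, map_mul]
  exact kernel_identity_D (one_sub_mul_geom a _) (one_sub_mul_geom a _) (one_sub_mul_geom a _)
    (one_sub_mul_geom a _) (C_var_mul_C_varInv m) (C_var_mul_C_varInv m')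

end MoreSteps

/-! ### From the kernel of type `A` to the other kernels -/

section Chain

variable {R : Type*} [CommRing R] {N n : ℕ}

/-- The properties common to the recursions of types `BC` and `D`. -/
structure IsKeySystem (K : (Fin n → ℤ) → Laurent R n → Prop) : Prop where
  dominant : ∀ l : Fin n → ℕ, Antitone l → K (fun i => (l i : ℤ)) (mono fun i => (l i : ℤ))
  step : ∀ (v : Fin n → ℤ) (f : Laurent R n) (i j : Fin n), (i : ℕ) + 1 = j → v j < v i → K v f →
    K (vecSwap i j v) (piA i j f)
  unique : ∀ (v : Fin n → ℤ) (f g : Laurent R n), K v f → K v g → f = g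

theorem isKeySystem_isKeyBC (β : R) : IsKeySystem (IsKeyBC β (n := n)) :=
  ⟨.dominant, .step, fun v _ _ hf hg => (existsUnique_stepBC β v).unique hf.keyRel hg.keyRel⟩

theorem isKeySystem_isKeyD : IsKeySystem (IsKeyD (R := R) (n := n)) :=
  ⟨.dominant, .step, fun v _ _ hf hg => (existsUnique_stepD v).unique hf.keyRel hg.keyRel⟩

theorem IsKeySystem.eq_mono {K : (Fin n → ℤ) → Laurent R n → Prop} (hK : IsKeySystem K)
    {l : Fin n → ℕ} (hl : Antitone l) {f : Laurent R n} (hf : K (fun i => (l i : ℤ)) f) :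
    f = mono fun i => (l i : ℤ) :=
  hK.unique _ _ _ hf (hK.dominant l hl)

/-- The exponent at the stage `k`: the components `k, …, N - 1` of the partition `l` have changed sign and are
in the reverse order. The stages run from `k = N`, the partition itself, down to `k = 0`. -/
def vecStage (l : ℕ → ℕ) (N k j : ℕ) : ℤ :=
  if j < k then l j else if j < N then -l (N + k - 1 - j) else 0

/-- The exponent on the way from the stage `k + 1` to the stage `k`, when the component `l_k` has moved to the
position `m`. -/
def vecMove (l : ℕ → ℕ) (N k m j : ℕ) : ℤ :=
  if j < k then l j else if j < m then -l (N + k - 1 - j) else if j = m then l k else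
    if j < N then -l (N + k - j) else 0

theorem vecMove_self (l : ℕ → ℕ) (N k j : ℕ) :
    vecMove l N k k j = vecStage l N (k + 1) j := by
  unfold vecMove vecStage
  obtain h | h | h := lt_trichotomy j k
  · rw [if_pos h, if_pos (by omega)]
  · rw [if_neg (by omega), if_neg (by omega), if_pos h, if_pos (by omega), h]
  · rw [if_neg (by omega), if_neg (by omega), if_neg (by omega),
      if_neg (c := j < k + 1) (by omega), show N + k - j = N + (k + 1) - 1 - j by omega]

theorem vecMove_at (l : ℕ → ℕ) {N k m : ℕ} (h : k ≤ m) : vecMove l N k m m = l k := by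
  unfold vecMove
  rw [if_neg (by omega), if_neg (by omega), if_pos rfl]

theorem vecMove_of_lt (l : ℕ → ℕ) {N k m j : ℕ} (h : k ≤ j) (h' : j < m) :
    vecMove l N k m j = -l (N + k - 1 - j) := by
  unfold vecMove
  rw [if_neg (by omega), if_pos h']

theorem vecMove_of_gt (l : ℕ → ℕ) {N k m j : ℕ} (h : k ≤ m) (h' : m < j) (hj : j < N) :
    vecMove l N k m j = -l (N + k - j) := by
  unfold vecMove
  rw [if_neg (by omega), if_neg (by omega), if_neg (by omega), if_pos hj]

theorem vecMove_of_eq_zero {l : ℕ → ℕ} (hl : Antitone l) {N k m : ℕ} (h0 : l k = 0) (hm : m < N)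
    (j : ℕ) : vecMove l N k m j = l j := by
  have hz : ∀ i, k ≤ i → l i = 0 := fun i hi => Nat.le_zero.1 (h0 ▸ hl hi)
  unfold vecMove
  split_ifs with h1 h2 h3 h4
  · rfl
  · rw [hz (N + k - 1 - j) (by omega), hz j (by omega)]; rfl
  · rw [h0, hz j (by omega)]
  · rw [hz (N + k - j) (by omega), hz j (by omega)]; rfl
  · rw [hz j (by omega)]; rfl

/-- The indices of the factors `1 / (1 - x_i y_j)` at the stage `k`. -/
def stageP (N k i j : ℕ) : Prop := i + min j k < N

/-- The indices of the factors `1 / (1 - x_i / y_j)` at the stage `k`. -/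
def stageQ (N k i j : ℕ) : Prop := i + k ≤ j ∧ i + k < N

/-- The indices of the factors `1 / (1 - x_i y_j)` when, on the way from the stage `k + 1` to the stage `k`,
the component `l_k` is at the position `m`. -/
def moveP (N k m i j : ℕ) : Prop := i + min j (k + 1) < N ∨ (i + k + 1 = N ∧ k < j ∧ j ≤ m)

/-- The indices of the factors `1 / (1 - x_i / y_j)` when, on the way from the stage `k + 1` to the stage `k`,
the component `l_k` is at the position `m`. -/
def moveQ (N k m i j : ℕ) : Prop := (i + (k + 1) ≤ j ∧ i + (k + 1) < N) ∨ (i + k = j ∧ j < m)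

/-- The Laurent polynomial whose pairing with the kernels gives the key polynomials in the chain that
starts with `y^l`. -/
def startVec (R : Type*) [CommRing R] (N : ℕ) (l : ℕ → ℕ) : Laurent R N :=
  mono (fun i => -(l (Fin.rev i) : ℤ)) * weylDen R N

/-- The numerator that the passage from the stage `k + 1` to the stage `k` contributes, with
`a + k + 1 = N`. -/
def rowNum (last : Fin N → MvPowerSeries (Fin N) R) (a : Fin N) : MvPowerSeries (Fin N) R :=
  (∏ b : Fin N with b.val < a.val, (1 - MvPowerSeries.X a * MvPowerSeries.X b)) * last a

/-- At the first stage, the kernel is that of type `A`, and its pairing is the monomial `y^l`. -/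
theorem pairing_stage_start (hN : N ≤ n) {l : ℕ → ℕ} (hl0 : ∀ j, N ≤ j → l j = 0) :
    pairing (kern R N n (stageP N N) (stageQ N N)) (startVec R N l) =
      mono fun j : Fin n => (l j : ℤ) := by
  classical
  have hker : kern R N n (stageP N N) (stageQ N N) =
      ∏ p : Fin N × Fin N with (p.1 : ℕ) + p.2 < N, geom p.1 (var (Fin.castLE hN p.2)) := by
    rw [Finset.prod_filter, Fintype.prod_prod_type]
    refine Finset.prod_congr rfl fun i _ => ?_
    symm
    refine Fintype.prod_of_injective (Fin.castLE hN) (Fin.castLE_injective hN) _ _ ?_ ?_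
    · intro j hj
      have hjN : N ≤ j := by
        by_contra h
        exact hj ⟨⟨j, by omega⟩, rfl⟩
      rw [if_neg (by unfold stageP; omega), if_neg (by unfold stageQ; omega), mul_one]
    · intro j
      have h1 : stageP N N i (Fin.castLE hN j) ↔ (i : ℕ) + j < N := by
        unfold stageP
        have := j.2
        rw [Fin.val_castLE, min_eq_left (by omega)]
      rw [if_neg (c := stageQ N N i _) (by unfold stageQ; omega), mul_one]
      simp only [h1]
  rw [hker, startVec, pairing_kernelA (fun j => (var (Fin.castLE hN j) : Laurent R n))
    fun i => l (Fin.rev i), ← prod_var_pow]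
  rw [← Equiv.prod_comp Fin.revPerm]
  simp only [Fin.revPerm_apply, Fin.rev_rev]
  refine Fintype.prod_of_injective (Fin.castLE hN) (Fin.castLE_injective hN) _ _ ?_ ?_
  · intro j hj
    have hjN : N ≤ j := by
      by_contra h
      exact hj ⟨⟨j, by omega⟩, rfl⟩
    rw [hl0 _ hjN, pow_zero]
  · intro j
    rfl

/-- Between two stages, the component `l_k` moves from the position `k` to the position `N - 1`. -/
theorem key_move {K : (Fin n → ℤ) → Laurent R n → Prop} (hK : IsKeySystem K) (hN : N ≤ n)
    {l : ℕ → ℕ} (hl : Antitone l) {a : Fin N} {k : ℕ} (hk : a + k + 1 = N)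
    (c : MvPowerSeries (Fin N) R) (h : Laurent R N)
    (h0 : K (fun j : Fin n => vecStage l N (k + 1) j)
      (pairing (const n c * kern R N n (stageP N (k + 1)) (stageQ N (k + 1))) h)) :
    ∀ m, k ≤ m → m < N → K (fun j : Fin n => vecMove l N k m j)
      (pairing (const n (c * ∏ b : Fin N with b.val + k < m,
        (1 - MvPowerSeries.X a * MvPowerSeries.X b)) * kern R N n (moveP N k m) (moveQ N k m)) h) := by
  intro m hm
  induction m, hm using Nat.le_induction with
  | base =>
    intro _
    have h1 : (Finset.univ.filter fun b : Fin N => b.val + k < k) = ∅ := by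
      ext b; simp
    have h2 : kern R N n (moveP N k k) (moveQ N k k) =
        kern R N n (stageP N (k + 1)) (stageQ N (k + 1)) := by
      refine kern_congr (fun i j _ _ => ?_) (fun i j _ _ => ?_)
      · unfold moveP stageP; omega
      · unfold moveQ stageQ; omega
    simp only [vecMove_self]
    rw [h1, Finset.prod_empty, mul_one, h2]
    exact h0
  | succ m hm ih =>
    intro hmN
    have hprev := ih (by omega)
    obtain ⟨u, hu⟩ : ∃ u : Fin n, (u : ℕ) = m := ⟨⟨m, by omega⟩, rfl⟩
    obtain ⟨u', hu'⟩ : ∃ u' : Fin n, (u' : ℕ) = m + 1 := ⟨⟨m + 1, by omega⟩, rfl⟩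
    obtain ⟨b, hb⟩ : ∃ b : Fin N, (b : ℕ) = m - k := ⟨⟨m - k, by omega⟩, rfl⟩
    have huu : u ≠ u' := fun h => by rw [h] at hu; omega
    have hset : (Finset.univ.filter fun b : Fin N => b.val + k < m + 1) =
        insert b (Finset.univ.filter fun b : Fin N => b.val + k < m) := by
      ext x
      simp only [Finset.mem_filter, Finset.mem_univ, true_and, Finset.mem_insert, Fin.ext_iff, hb]
      omega
    have hvec : (fun j : Fin n => vecMove l N k (m + 1) j) =
        vecSwap u u' fun j : Fin n => vecMove l N k m j := by
      ext j
      simp only [vecSwap, Equiv.swap_apply_def]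
      split_ifs with h1 h2
      · rw [h1, hu, hu', vecMove_of_lt l hm (by omega), vecMove_of_gt l hm (by omega) hmN,
          show N + k - 1 - m = N + k - (m + 1) by omega]
      · rw [h2, hu, hu', vecMove_at l (by omega), vecMove_at l hm]
      · have h1' : (j : ℕ) ≠ m := fun h => h1 (Fin.ext (h.trans hu.symm))
        have h2' : (j : ℕ) ≠ m + 1 := fun h => h2 (Fin.ext (h.trans hu'.symm))
        unfold vecMove
        have h3 : (j : ℕ) < m + 1 ↔ (j : ℕ) < m := by omega
        simp only [h1', h2', h3, if_false]
    rw [hvec, hset, Finset.prod_insert (by simp [hb]; omega), mul_comm (1 - _), ← mul_assoc,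
      pairing_kern_step (P₀ := fun i j => moveP N k m i j ∧ ¬(i = a ∧ j = m)) (P := moveP N k m)
        (Q₀ := fun i j => moveQ N k m i j ∧ ¬(i = b ∧ j = m + 1)) (Q := moveQ N k m)
        (m := u) (m' := u') huu]
    rotate_left
    · intro i; unfold moveP; omega
    · intro i; unfold moveQ; omega
    · omega
    · unfold moveQ; omega
    · intro i j; unfold moveP; omega
    · intro i j; unfold moveP; omega
    · intro i j; unfold moveQ; omega
    · intro i j; unfold moveQ; omega
    -- If `l k = 0`, all vectors of the chain so far equal `l`, and the operator fixes the monomial.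
    by_cases hlk : l k = 0
    · have e : (fun j : Fin n => vecMove l N k m j) = fun j : Fin n => ((l j : ℕ) : ℤ) := by
        ext j
        exact vecMove_of_eq_zero hl hlk (by omega) j
      have hz : ∀ i, k ≤ i → l i = 0 := fun i hi => Nat.le_zero.1 (hlk ▸ hl hi)
      rw [e] at hprev ⊢
      have hlant : Antitone fun j : Fin n => l j := fun i j hij => hl hij
      have hfix : vecSwap u u' (fun j : Fin n => ((l j : ℕ) : ℤ)) = fun j : Fin n => ((l j : ℕ) : ℤ) := by
        rw [vecSwap_eq_add huu]
        rw [hu, hu', hz m hm, hz (m + 1) (by omega), sub_self, zero_smul, add_zero]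
      rw [hK.eq_mono hlant hprev, hfix, piA_eq_self huu (actHom_mono_fixed hfix)]
      exact hK.dominant _ hlant
    · refine hK.step _ _ u u' (by omega) ?_ hprev
      simp only [hu, hu']
      rw [vecMove_at l hm, vecMove_of_gt l hm (by omega) hmN]
      omega

/-- The chain of operators from the kernel of type `A` to the kernel whose numerator is the product of the
factors `rowNum last a`, when the last operators of each stage are known to produce the factor `last`. -/
theorem key_stage {K : (Fin n → ℤ) → Laurent R n → Prop} (hK : IsKeySystem K) (hN : N ≤ n)
    {l : ℕ → ℕ} (hl : Antitone l) (hl0 : ∀ j, N ≤ j → l j = 0)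
    (last : Fin N → MvPowerSeries (Fin N) R)
    (hlast : ∀ (a : Fin N) (k : ℕ), (a : ℕ) + k + 1 = N → ∀ c : MvPowerSeries (Fin N) R,
      K (fun j : Fin n => vecMove l N k (N - 1) j)
        (pairing (const n c * kern R N n (moveP N k (N - 1)) (moveQ N k (N - 1))) (startVec R N l)) →
      K (fun j : Fin n => vecStage l N k j)
        (pairing (const n (c * last a) * kern R N n (stageP N k) (stageQ N k)) (startVec R N l)))
    (t : ℕ) : ∀ k, k + t = N → K (fun j : Fin n => vecStage l N k j)
      (pairing (const n (∏ a : Fin N with a.val < t, rowNum last a)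
        * kern R N n (stageP N k) (stageQ N k)) (startVec R N l)) := by
  induction t with
  | zero =>
    rintro k rfl
    have e : (fun j : Fin n => vecStage l (k + 0) k j) = fun j : Fin n => ((l j : ℕ) : ℤ) := by
      ext j
      unfold vecStage
      split_ifs with h1 h2
      · rfl
      · omega
      · rw [hl0 _ (by omega)]; rfl
    have h1 : (Finset.univ.filter fun b : Fin (k + 0) => b.val < 0) = ∅ := by
      ext b; simp
    rw [e, h1, Finset.prod_empty, map_one, one_mul]
    have := pairing_stage_start (R := R) hN hl0
    rw [show k + 0 = k from rfl] at this ⊢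
    rw [this]
    exact hK.dominant _ fun i j hij => hl hij
  | succ t ih =>
    intro k hk
    set a : Fin N := ⟨t, by omega⟩ with ha
    have h1 := key_move hK hN hl (a := a) (by simp [ha]; omega) _ _ (ih (k + 1) (by omega)) (N - 1)
      (by omega) (by omega)
    have h2 := hlast a k (by simp [ha]; omega) _ h1
    have hset : (Finset.univ.filter fun b : Fin N => b.val < t + 1) =
        insert a (Finset.univ.filter fun b : Fin N => b.val < t) := by
      ext x
      simp only [Finset.mem_filter, Finset.mem_univ, true_and, Finset.mem_insert, Fin.ext_iff, ha]
      omega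
    have hset' : (Finset.univ.filter fun b : Fin N => b.val + k < N - 1) =
        Finset.univ.filter fun b : Fin N => b.val < a.val := by
      ext x
      simp only [Finset.mem_filter, Finset.mem_univ, true_and, ha]
      omega
    have hprod : ∏ x : Fin N with x.val < t + 1, rowNum last x =
        (∏ x : Fin N with x.val < t, rowNum last x) *
          (∏ b : Fin N with b.val + k < N - 1, (1 - MvPowerSeries.X a * MvPowerSeries.X b)) * last a := by
      rw [hset, Finset.prod_insert (by simp [ha]), rowNum, hset']
      ring
    rw [hprod]
    exact h2

end Chain

section LastSteps

variable {R : Type*} [CommRing R] {N n : ℕ}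

theorem piBC_eq_self (β : R) {i : Fin n} {f : Laurent R n} (h : actHom (negHom i) f = f) :
    piBC β i f = f := by
  refine piBC_eq' β ?_
  rw [h]; ring

theorem piD_eq_self {i j : Fin n} (hij : i ≠ j) {f : Laurent R n}
    (h : actHom (tauHom i j) f = f) : piD i j f = f := by
  refine piD_eq hij ?_
  rw [h]; ring

/-- In type `BC`, the last component changes sign, and the stage is complete. -/
theorem key_last_BC (β : R) {l : ℕ → ℕ} (hl : Antitone l) (a : Fin N) (k : ℕ) (hk : (a : ℕ) + k + 1 = N)
    (c : MvPowerSeries (Fin N) R) (h : Laurent R N)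
    (h0 : IsKeyBC β (fun j : Fin N => vecMove l N k (N - 1) j)
      (pairing (const N c * kern R N N (moveP N k (N - 1)) (moveQ N k (N - 1))) h)) :
    IsKeyBC β (fun j : Fin N => vecStage l N k j)
      (pairing (const N (c * (1 + MvPowerSeries.C β * MvPowerSeries.X a))
        * kern R N N (stageP N k) (stageQ N k)) h) := by
  obtain ⟨u, hu⟩ : ∃ u : Fin N, (u : ℕ) = N - 1 := ⟨⟨N - 1, by omega⟩, rfl⟩
  have hker : kern R N N (stageP N k) (stageQ N k) = kern R N N (moveP N k (N - 1))
      fun i j => moveQ N k (N - 1) i j ∨ (i = a ∧ j = u) := by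
    refine kern_congr (fun i j hi hj => ?_) (fun i j hi hj => ?_)
    · unfold stageP moveP; omega
    · unfold stageQ moveQ; omega
  have hvec : (fun j : Fin N => vecStage l N k j) =
      vecNeg u fun j : Fin N => vecMove l N k (N - 1) j := by
    ext j
    unfold vecNeg
    split_ifs with h1
    · dsimp only
      rw [h1, hu, vecMove_at l (by omega)]
      unfold vecStage
      rw [if_neg (by omega), if_pos (by omega), show N + k - 1 - (N - 1) = k by omega]
    · have h2 : (j : ℕ) ≠ N - 1 := fun h => h1 (Fin.ext (h.trans hu.symm))
      have h3 : (j : ℕ) < N := j.2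
      have h4 : (j : ℕ) < N - 1 := by omega
      unfold vecStage vecMove
      simp only [h3, h4, if_true]
  rw [hker, hvec, pairing_kern_step_BC β
    (P₀ := fun i j => moveP N k (N - 1) i j ∧ ¬(i = a ∧ j = u)) (P := moveP N k (N - 1))
    (Q := moveQ N k (N - 1)) (m := u)]
  rotate_left
  · intro i; unfold moveP moveQ; omega
  · omega
  · intro i j; unfold moveP; omega
  · intro i j; rfl
  -- If `l k = 0`, the vector is still `l` itself, which the reflection fixes: the step is not one of the
  -- recursion, but the operator fixes the monomial too.
  by_cases hlk : l k = 0
  · have e : (fun j : Fin N => vecMove l N k (N - 1) j) = fun j : Fin N => ((l j : ℕ) : ℤ) := by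
      ext j
      exact vecMove_of_eq_zero hl hlk (by omega) j
    have hz : ∀ i, k ≤ i → l i = 0 := fun i hi => Nat.le_zero.1 (hlk ▸ hl hi)
    rw [e] at h0 ⊢
    have hlant : Antitone fun j : Fin N => l j := fun i j hij => hl hij
    have hfix : vecNeg u (fun j : Fin N => ((l j : ℕ) : ℤ)) = fun j : Fin N => ((l j : ℕ) : ℤ) := by
      rw [vecNeg_eq_add, hu, hz (N - 1) (by omega), Nat.cast_zero, zero_smul, add_zero]
    rw [(isKeySystem_isKeyBC β).eq_mono hlant h0, hfix, piBC_eq_self β (actHom_mono_fixed hfix)]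
    exact .dominant _ hlant
  · refine .last _ _ u (by omega) ?_ h0
    simp only [hu]
    rw [vecMove_at l (by omega)]
    omega

/-- In type `D`, there is one more component, which is zero. The component `l_k` moves there, and then
`τ` brings it back with the opposite sign. -/
theorem key_last_D {l : ℕ → ℕ} (hl : Antitone l) (a : Fin N) (k : ℕ) (hk : (a : ℕ) + k + 1 = N)
    (c : MvPowerSeries (Fin N) R) (h : Laurent R N)
    (h0 : IsKeyD (fun j : Fin (N + 1) => vecMove l N k (N - 1) j)
      (pairing (const (N + 1) c * kern R N (N + 1) (moveP N k (N - 1)) (moveQ N k (N - 1))) h)) :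
    IsKeyD (fun j : Fin (N + 1) => vecStage l N k j)
      (pairing (const (N + 1) (c * (1 - MvPowerSeries.X a * MvPowerSeries.X a))
        * kern R N (N + 1) (stageP N k) (stageQ N k)) h) := by
  obtain ⟨u, hu⟩ : ∃ u : Fin (N + 1), (u : ℕ) = N - 1 := ⟨⟨N - 1, by omega⟩, rfl⟩
  obtain ⟨u', hu'⟩ : ∃ u : Fin (N + 1), (u : ℕ) = N := ⟨⟨N, by omega⟩, rfl⟩
  have huu : u ≠ u' := fun h => by rw [h] at hu; omega
  have hker : kern R N (N + 1) (stageP N k) (stageQ N k) = kern R N (N + 1)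
      (fun i j => moveP N k (N - 1) i j ∨ (i = a ∧ j = u'))
      fun i j => (moveQ N k (N - 1) i j ∨ (i = a ∧ j = u)) ∨ (i = a ∧ j = u') := by
    refine kern_congr (fun i j hi hj => ?_) (fun i j hi hj => ?_)
    · unfold stageP moveP; omega
    · unfold stageQ moveQ; omega
  have hvec : (fun j : Fin (N + 1) => vecStage l N k j) =
      vecTau u u' (vecSwap u u' fun j : Fin (N + 1) => vecMove l N k (N - 1) j) := by
    ext j
    unfold vecTau
    rw [vecSwap_left, vecSwap_right]
    split_ifs with h1 h2
    · rw [h1, hu, vecMove_at l (by omega)]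
      unfold vecStage
      rw [if_neg (by omega), if_pos (by omega), show N + k - 1 - (N - 1) = k by omega]
    · rw [h2, hu']
      unfold vecStage vecMove
      rw [if_neg (by omega), if_neg (by omega), if_neg (by omega), if_neg (by omega),
        if_neg (by omega), if_neg (by omega), neg_zero]
    · have h3 : (j : ℕ) ≠ N - 1 := fun h => h1 (Fin.ext (h.trans hu.symm))
      have h4 : (j : ℕ) ≠ N := fun h => h2 (Fin.ext (h.trans hu'.symm))
      have h5 : (j : ℕ) < N := by have := j.2; omega
      have h6 : (j : ℕ) < N - 1 := by omega
      rw [vecSwap_of_ne h1 h2]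
      unfold vecStage vecMove
      simp only [h5, h6, if_true]
  rw [hker, hvec, pairing_kern_step_D huu
    (P₀ := fun i j => moveP N k (N - 1) i j ∧ ¬(i = a ∧ j = u))
    (P₁ := moveP N k (N - 1)) (Q := moveQ N k (N - 1))
    (Q₁ := fun i j => moveQ N k (N - 1) i j ∨ (i = a ∧ j = u)),
    pairing_kern_step_left huu (P₀ := fun i j => moveP N k (N - 1) i j ∧ ¬(i = a ∧ j = u))
      (P := moveP N k (N - 1)) (a := a)]
  rotate_left
  · intro i; unfold moveP; omega
  · intro i; unfold moveQ; omega
  · omega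
  · intro i j; unfold moveP; omega
  · intro i j; rfl
  · intro i; unfold moveP moveQ; omega
  · intro i; unfold moveP moveQ; omega
  · omega
  · unfold moveP; omega
  · intro i j; unfold moveP; omega
  · intro i j; rfl
  · intro i j; rfl
  · intro i j; rfl
  -- If `l k = 0`, the vector is still `l` itself, which the reflection fixes: the step is not one of the
  -- recursion, but the operator fixes the monomial too.
  by_cases hlk : l k = 0
  · have e : (fun j : Fin (N + 1) => vecMove l N k (N - 1) j) =
        fun j : Fin (N + 1) => ((l j : ℕ) : ℤ) := by
      ext j
      exact vecMove_of_eq_zero hl hlk (by omega) j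
    have hz : ∀ i, k ≤ i → l i = 0 := fun i hi => Nat.le_zero.1 (hlk ▸ hl hi)
    rw [e] at h0 ⊢
    have hlant : Antitone fun j : Fin (N + 1) => l j := fun i j hij => hl hij
    have hfix : vecSwap u u' (fun j : Fin (N + 1) => ((l j : ℕ) : ℤ)) =
        fun j : Fin (N + 1) => ((l j : ℕ) : ℤ) := by
      rw [vecSwap_eq_add huu, hu, hu', hz (N - 1) (by omega), hz N (by omega), sub_self, zero_smul,
        add_zero]
    have hfix' : vecTau u u' (fun j : Fin (N + 1) => ((l j : ℕ) : ℤ)) =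
        fun j : Fin (N + 1) => ((l j : ℕ) : ℤ) := by
      rw [vecTau_eq_add huu, hu, hu', hz (N - 1) (by omega), hz N (by omega), Nat.cast_zero, add_zero,
        zero_smul, add_zero]
    rw [isKeySystem_isKeyD.eq_mono hlant h0, hfix, hfix', piA_eq_self huu (actHom_mono_fixed hfix),
      piD_eq_self huu (actHom_mono_fixed hfix')]
    exact .dominant _ hlant
  · have e1 : vecMove l N k (N - 1) u = l k := by rw [hu, vecMove_at l (by omega)]
    have e2 : vecMove l N k (N - 1) u' = 0 := by
      rw [hu']
      unfold vecMove
      rw [if_neg (by omega), if_neg (by omega), if_neg (by omega), if_neg (by omega)]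
    refine .last _ _ u u' (by omega) (by omega) ?_ (.step _ _ u u' (by omega) ?_ h0)
    · rw [vecSwap_left, vecSwap_right, e1, e2]
      omega
    · rw [e1, e2]
      omega

end LastSteps

/-! ### The coefficients of the kernels of types `BC` and `D` -/

section Final

variable {R : Type*} [CommRing R] {N n : ℕ}

/-- The numerator of the kernel that the chain of operators produces. -/
def numer (last : Fin N → MvPowerSeries (Fin N) R) : MvPowerSeries (Fin N) R :=
  (∏ p : Fin N × Fin N with p.1 < p.2, (1 - MvPowerSeries.X p.1 * MvPowerSeries.X p.2)) * ∏ a, last a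

theorem prod_rowNum (last : Fin N → MvPowerSeries (Fin N) R) :
    ∏ a : Fin N with a.val < N, rowNum last a = numer last := by
  classical
  have hset : (Finset.univ.filter fun b : Fin N => b.val < N) = Finset.univ := by
    ext b; simp
  rw [hset, numer]
  unfold rowNum
  rw [Finset.prod_mul_distrib]
  congr 1
  rw [Finset.prod_filter, Fintype.prod_prod_type_right]
  refine Finset.prod_congr rfl fun a _ => ?_
  rw [Finset.prod_filter]
  refine Finset.prod_congr rfl fun b _ => ?_
  rw [mul_comm (MvPowerSeries.X a)]
  rfl

theorem rename_numer {last : Fin N → MvPowerSeries (Fin N) R} {i j : Fin N} (hij : (i : ℕ) + 1 = j)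
    (hlast : ∀ a, MvPowerSeries.rename (Equiv.swap i j) (last a) = last (Equiv.swap i j a)) :
    MvPowerSeries.rename (Equiv.swap i j) (numer last) = numer last := by
  unfold numer
  rw [map_mul, map_prod, map_prod]
  congr 1
  · rw [prod_lt_split hij, prod_lt_split hij fun p : Fin N × Fin N =>
      (1 - MvPowerSeries.X p.1 * MvPowerSeries.X p.2 : MvPowerSeries (Fin N) R)]
    congr 1
    · dsimp only
      rw [map_sub, map_one, map_mul, MvPowerSeries.rename_X, MvPowerSeries.rename_X,
        Equiv.swap_apply_left, Equiv.swap_apply_right, mul_comm]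
    · refine prod_lt_swap hij _ _ fun p => ?_
      rw [map_sub, map_one, map_mul, MvPowerSeries.rename_X, MvPowerSeries.rename_X]
  · rw [← Equiv.prod_comp (Equiv.swap i j) last]
    exact Finset.prod_congr rfl fun a _ => hlast a

/-- The divided differences in `x` and in `y` act in the same way on the kernels. -/
theorem pairing_kern_piA (hN : N ≤ n) {i j : Fin N} (hij : (i : ℕ) + 1 = j)
    {c : MvPowerSeries (Fin N) R} (hc : MvPowerSeries.rename (Equiv.swap i j) c = c)
    (g : Laurent R N) :
    pairing (const n c * kern R N n (stageP N 0) (stageQ N 0)) (piA i j g * weylDen R N) =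
      piA (Fin.castLE hN i) (Fin.castLE hN j)
        (pairing (const n c * kern R N n (stageP N 0) (stageQ N 0)) (g * weylDen R N)) := by
  have nij := fin_ne_of_succ hij
  have hi := i.2
  have hj := j.2
  obtain ⟨u, hu, hu'⟩ : ∃ u : Fin n, (u : ℕ) = i ∧ u = Fin.castLE hN i := ⟨_, rfl, rfl⟩
  obtain ⟨w, hw, hw'⟩ : ∃ w : Fin n, (w : ℕ) = j ∧ w = Fin.castLE hN j := ⟨_, rfl, rfl⟩
  rw [← hu', ← hw']
  have huw : u ≠ w := fun h => by rw [h] at hu; omega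
  have hy := pairing_kern_step_right (R := R) (N := N) huw (P := stageP N 0)
    (Q₀ := fun r s => stageQ N 0 r s ∧ ¬(r = j ∧ s = w)) (Q := stageQ N 0)
    (Q' := fun r s => stageQ N 0 r s ∨ (r = j ∧ s = u)) (a := j)
    (by intro r; unfold stageP; omega) (by intro r; unfold stageQ; omega)
    (by unfold stageQ; omega) (by intro r s; unfold stageQ; omega) (by intro r s; rfl) c
    (g * weylDen R N)
  rw [← hy]
  refine pairing_piA hij ?_ g
  have e1 : kern R N n (stageP N 0) (fun r s => stageQ N 0 r s ∨ (r = j ∧ s = u)) =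
      kern R N n (stageP N 0) (stageQ N 0) * geom j (varInv u) :=
    kern_insert_right j u (by intro r s; rfl) (by unfold stageQ; omega)
  have e2 : kern R N n (stageP N 0) (stageQ N 0) =
      kern R N n (stageP N 0) (fun r s => stageQ N 0 r s ∧ ¬(r = i ∧ s = u)) * geom i (varInv u) :=
    kern_insert_right i u (by intro r s; unfold stageQ; omega) (by omega)
  have e3 : MvPowerSeries.rename (Equiv.swap i j)
      (kern R N n (stageP N 0) (fun r s => stageQ N 0 r s ∧ ¬(r = i ∧ s = u))) =
      kern R N n (stageP N 0) (fun r s => stageQ N 0 r s ∧ ¬(r = i ∧ s = u)) :=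
    rename_kern_swap (by intro s; unfold stageP; omega) (by intro s; unfold stageQ; omega)
  have e4 : MvPowerSeries.rename (Equiv.swap i j) (const n c) = const n c := by
    rw [MvPowerSeries.rename_map, hc]
  rw [e1, e2, map_mul, map_mul, e3, e4, rename_geom, Equiv.swap_apply_left]
  have g1 := one_sub_mul_geom i (varInv u : Laurent R n)
  have g2 := one_sub_mul_geom j (varInv u : Laurent R n)
  set x : MvPowerSeries (Fin N) (Laurent R n) := MvPowerSeries.X i
  set x' : MvPowerSeries (Fin N) (Laurent R n) := MvPowerSeries.X j
  set g₁ : MvPowerSeries (Fin N) (Laurent R n) := geom i (varInv u)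
  set g₂ : MvPowerSeries (Fin N) (Laurent R n) := geom j (varInv u)
  set S := const n c * kern R N n (stageP N 0) (fun r s => stageQ N 0 r s ∧ ¬(r = i ∧ s = u))
  linear_combination S * x * g₁ * g2 - S * x' * g₂ * g1

/-- A vector of length `N`, completed by zeros. -/
def extendZero {A : Type*} [Zero A] (n : ℕ) (v : Fin N → A) : Fin n → A :=
  fun j => if h : (j : ℕ) < N then v ⟨j, h⟩ else 0

theorem extendZero_castLE {A : Type*} [Zero A] (hN : N ≤ n) (v : Fin N → A) (i : Fin N) :
    extendZero n v (Fin.castLE hN i) = v i := by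
  unfold extendZero
  rw [dif_pos (by simp)]
  rfl

theorem extendZero_vecSwap {A : Type*} [Zero A] (hN : N ≤ n) (v : Fin N → A) (i j : Fin N) :
    extendZero n (vecSwap i j v) =
      vecSwap (Fin.castLE hN i) (Fin.castLE hN j) (extendZero n v) := by
  ext k
  by_cases hk : (k : ℕ) < N
  · obtain ⟨k, rfl⟩ : ∃ k' : Fin N, Fin.castLE hN k' = k := ⟨⟨k, hk⟩, rfl⟩
    rw [extendZero_castLE, vecSwap, vecSwap, (Fin.castLE_injective hN).swap_apply,
      extendZero_castLE]
  · rw [vecSwap_of_ne]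
    · unfold extendZero
      rw [dif_neg hk, dif_neg hk]
    · rintro rfl; simp at hk
    · rintro rfl; simp at hk

/-- The pairings of a kernel with the dual basis satisfy the recursion of the key polynomials. -/
theorem key_pairing {K : (Fin n → ℤ) → Laurent R n → Prop} (hK : IsKeySystem K) (hN : N ≤ n)
    (last : Fin N → MvPowerSeries (Fin N) R)
    (hsymm : ∀ (e : Equiv.Perm (Fin N)) (a : Fin N), MvPowerSeries.rename e (last a) = last (e a))
    (hlast : ∀ (l : ℕ → ℕ), Antitone l → ∀ (a : Fin N) (k : ℕ), (a : ℕ) + k + 1 = N →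
      ∀ (c : MvPowerSeries (Fin N) R) (h : Laurent R N),
      K (fun j : Fin n => vecMove l N k (N - 1) j)
        (pairing (const n c * kern R N n (moveP N k (N - 1)) (moveQ N k (N - 1))) h) →
      K (fun j : Fin n => vecStage l N k j)
        (pairing (const n (c * last a) * kern R N n (stageP N k) (stageQ N k)) h))
    (v : Fin N → ℕ) : K (extendZero n fun i => -(v i : ℤ))
      (pairing (const n (numer last) * kern R N n (stageP N 0) (stageQ N 0))
        (keyA R (fun i => -(v i : ℤ)) * weylDen R N)) := by
  refine keyA_induction (p := fun w f => ∀ v : Fin N → ℕ, w = (fun i => -(v i : ℤ)) →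
    K (extendZero n w) (pairing (const n (numer last) * kern R N n (stageP N 0) (stageQ N 0))
      (f * weylDen R N))) ?_ ?_ _ v rfl
  · rintro w hw v rfl
    let l : ℕ → ℕ := fun j => if h : j < N then v (Fin.rev ⟨j, h⟩) else 0
    have hv : Monotone v := fun i j hij => by
      have := hw hij
      dsimp only at this
      omega
    have hl : Antitone l := by
      intro i j hij
      simp only [l]
      split_ifs with h1 h2
      · exact hv (Fin.rev_le_rev.2 hij)
      · omega
      · omega
      · exact le_rfl
    have h := key_stage hK hN hl (fun j hj => dif_neg (by omega)) last
      (fun a k hk c => hlast l hl a k hk c _) N 0 (by omega)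
    have e1 : (fun j : Fin n => vecStage l N 0 j) = extendZero n fun i => -(v i : ℤ) := by
      ext j
      unfold vecStage extendZero
      rw [if_neg (by omega)]
      split_ifs with h1
      · simp only [l]
        rw [dif_pos (by omega)]
        congr 3
        ext
        simp only [Fin.val_rev]
        omega
      · rfl
    have e2 : startVec R N l = mono (fun i => -(v i : ℤ)) * weylDen R N := by
      unfold startVec
      congr 3
      ext i
      simp only [l]
      rw [dif_pos (Fin.rev i).2, Fin.rev_rev]
    rw [e1, e2, prod_rowNum] at h
    exact h
  · rintro w f i j hij hw ih v hv
    rw [extendZero_vecSwap hN, pairing_kern_piA hN hij (rename_numer hij (hsymm _))]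
    refine hK.step _ _ _ _ hij (by rwa [extendZero_castLE, extendZero_castLE])
      (ih (vecSwap i j v) ?_)
    rw [← vecSwap_vecSwap i j w, hv]
    rfl

theorem keyBC_eq_pairing (β : R) (v : Fin N → ℕ) : keyBC β (fun i => -(v i : ℤ)) =
    pairing (const N (numer fun a => 1 + MvPowerSeries.C β * MvPowerSeries.X a)
      * kern R N N (stageP N 0) (stageQ N 0)) (keyA R (fun i => -(v i : ℤ)) * weylDen R N) := by
  have h := key_pairing (isKeySystem_isKeyBC β) le_rfl
    (fun a : Fin N => 1 + MvPowerSeries.C β * MvPowerSeries.X a)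
    (fun e a => by
      rw [map_add, map_one, map_mul, MvPowerSeries.rename_C, MvPowerSeries.rename_X])
    (fun l hl a k hk c h => key_last_BC β hl a k hk c h) v
  have e : extendZero N (fun i => -(v i : ℤ)) = fun i => -(v i : ℤ) := by
    ext i
    simp [extendZero]
  rw [e] at h
  exact h.keyBC_eq

theorem keyD_eq_pairing (hN : N = n - 1) (v : Fin N → ℕ) :
    keyD R (extendZero n fun i => -(v i : ℤ)) =
    pairing (const n (numer fun a : Fin N =>
        (1 - MvPowerSeries.X a * MvPowerSeries.X a : MvPowerSeries (Fin N) R))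
      * kern R N n (stageP N 0) (stageQ N 0))
      (keyA R (fun i => -(v i : ℤ)) * weylDen R N) := by
  have h := key_pairing (R := R) isKeySystem_isKeyD (show N ≤ n by omega)
    (fun a : Fin N => (1 - MvPowerSeries.X a * MvPowerSeries.X a : MvPowerSeries (Fin N) R))
    (fun e a => by
      rw [map_sub, map_one, map_mul, MvPowerSeries.rename_X])
    (fun l hl a k hk c h => by
      obtain rfl : n = N + 1 := by omega
      exact key_last_D hl a k hk c h) v
  exact h.keyD_eq

end Final

/-! ### The kernels in the ring of formal power series -/

section Kernels

variable {R : Type*} [CommRing R] {N n : ℕ}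

/-- The indeterminates `x_i`, with those after the first `N` specialized to `0`. -/
def xsTrunc (R : Type*) [CommRing R] (N n : ℕ) : Fin n → Series R n :=
  fun i => if (i : ℕ) < N then MvPowerSeries.X i else 0

theorem xsTrunc_castLE (hN : N ≤ n) (i : Fin N) :
    xsTrunc R N n (Fin.castLE hN i) = MvPowerSeries.X (Fin.castLE hN i) :=
  if_pos i.2

theorem xsTrunc_of_notMem (hN : N ≤ n) {i : Fin n} (hi : i ∉ Set.range (Fin.castLE hN)) :
    xsTrunc R N n i = 0 :=
  if_neg fun h => hi ⟨⟨i, h⟩, rfl⟩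

theorem xsTrunc_self : xsTrunc R n n = xs R n :=
  funext fun i => if_pos i.2

theorem xsTrunc_pred : xsTrunc R (n - 1) n = xsZero R n := by
  ext1 i
  unfold xsTrunc xsZero
  by_cases h : (i : ℕ) + 1 = n
  · rw [if_pos h, if_neg (by omega)]
  · rw [if_neg h, if_pos (by omega)]

theorem omegaDen_eq {S : Type*} [CommRing S] (x y y' : Fin n → S) :
    omegaDen x y y' = ∏ i, ∏ j, (1 - x i * y j) * (if i ≤ j then 1 - x i * y' j else 1) := by
  simp only [omegaDen, Finset.prod_filter, Fintype.prod_prod_type, Finset.prod_mul_distrib]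

theorem omegaDen_mul_rename_kern (hN : N ≤ n) :
    omegaDen (xsTrunc R N n) (ys R n) (ysInv R n) *
      MvPowerSeries.rename (Fin.castLE hN) (kern R N n (stageP N 0) (stageQ N 0)) = 1 := by
  classical
  have h1 : omegaDen (xsTrunc R N n) (ys R n) (ysInv R n) = ∏ i : Fin N, ∏ j : Fin n,
      (1 - MvPowerSeries.X (Fin.castLE hN i) * MvPowerSeries.C (var j)) *
        (if (i : ℕ) ≤ j then 1 - MvPowerSeries.X (Fin.castLE hN i) * MvPowerSeries.C (varInv j)
          else 1) := by
    rw [omegaDen_eq]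
    symm
    refine Fintype.prod_of_injective (Fin.castLE hN) (Fin.castLE_injective hN) _ _ ?_ ?_
    · intro i hi
      simp only [xsTrunc_of_notMem hN hi, zero_mul, sub_zero, ite_self, mul_one,
        Finset.prod_const_one]
    · intro i
      simp only [xsTrunc_castLE hN]
      rfl
  rw [h1, kern, map_prod, ← Finset.prod_mul_distrib]
  refine Finset.prod_eq_one fun i _ => ?_
  rw [map_prod, ← Finset.prod_mul_distrib]
  refine Finset.prod_eq_one fun j _ => ?_
  have hi := i.2
  have g1 := congrArg (MvPowerSeries.rename (Fin.castLE hN)) (one_sub_mul_geom i (var j : Laurent R n))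
  have g2 := congrArg (MvPowerSeries.rename (Fin.castLE hN))
    (one_sub_mul_geom i (varInv j : Laurent R n))
  rw [map_mul, map_sub, map_one, map_mul, MvPowerSeries.rename_X, MvPowerSeries.rename_C] at g1 g2
  rw [if_pos (show stageP N 0 i j by unfold stageP; omega), map_mul, mul_mul_mul_comm, g1, one_mul]
  by_cases h : (i : ℕ) ≤ j
  · rw [if_pos h, if_pos (show stageQ N 0 i j by unfold stageQ; omega), g2]
  · rw [if_neg h, if_neg (show ¬ stageQ N 0 i j by unfold stageQ; omega), map_one, mul_one]

/-- The common denominator of the kernels of types `BC` and `D`. -/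
theorem inverse_omegaDen (hN : N ≤ n) :
    Ring.inverse (omegaDen (xsTrunc R N n) (ys R n) (ysInv R n)) =
      MvPowerSeries.rename (Fin.castLE hN) (kern R N n (stageP N 0) (stageQ N 0)) :=
  ring_inverse_eq (omegaDen_mul_rename_kern hN)

theorem prod_lt_xsTrunc (hN : N ≤ n) :
    ∏ p : Fin n × Fin n with p.1 < p.2, (1 - xsTrunc R N n p.1 * xsTrunc R N n p.2) =
      MvPowerSeries.rename (Fin.castLE hN) (const n
        (∏ p : Fin N × Fin N with p.1 < p.2, (1 - MvPowerSeries.X p.1 * MvPowerSeries.X p.2))) := by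
  rw [map_prod, map_prod, Finset.prod_filter, Finset.prod_filter]
  symm
  refine Fintype.prod_of_injective (Prod.map (Fin.castLE hN) (Fin.castLE hN))
    ((Fin.castLE_injective hN).prodMap (Fin.castLE_injective hN)) _ _ ?_ ?_
  · rintro ⟨i, j⟩ hp
    have h : xsTrunc R N n i * xsTrunc R N n j = 0 := by
      by_cases hi : i ∈ Set.range (Fin.castLE hN)
      · by_cases hj : j ∈ Set.range (Fin.castLE hN)
        · obtain ⟨i, rfl⟩ := hi
          obtain ⟨j, rfl⟩ := hj
          exact absurd ⟨(i, j), rfl⟩ hp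
        · rw [xsTrunc_of_notMem hN hj, mul_zero]
      · rw [xsTrunc_of_notMem hN hi, zero_mul]
    simp only [h, sub_zero, ite_self]
  · rintro ⟨i, j⟩
    simp only [Prod.map_apply, xsTrunc_castLE hN, map_sub, map_one, map_mul, MvPowerSeries.map_X,
      MvPowerSeries.rename_X, Fin.lt_def, Fin.val_castLE]

theorem rename_castLE_self (Ω : Series R n) :
    MvPowerSeries.rename (Fin.castLE le_rfl : Fin n → Fin n) Ω = Ω :=
  DFunLike.congr_fun (MvPowerSeries.rename_id (R := Laurent R n) (σ := Fin n)) Ω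

theorem prod_one_add_xs (β : R) : ∏ i, (1 + algebraMap R (Series R n) β * xs R n i) =
    const n (∏ a : Fin n, (1 + MvPowerSeries.C β * MvPowerSeries.X a)) := by
  rw [map_prod]
  refine Finset.prod_congr rfl fun a _ => ?_
  rw [map_add, map_one, map_mul, MvPowerSeries.map_X, MvPowerSeries.map_C,
    MvPowerSeries.algebraMap_apply]
  rfl

theorem omegaBC_eq (β : R) : omegaBC (algebraMap R (Series R n) β) (xs R n) (ys R n) (ysInv R n) =
    const n (numer fun a => 1 + MvPowerSeries.C β * MvPowerSeries.X a)
      * kern R n n (stageP n 0) (stageQ n 0) := by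
  have h1 := inverse_omegaDen (R := R) (le_refl n)
  have h2 := prod_lt_xsTrunc (R := R) (le_refl n)
  rw [rename_castLE_self, xsTrunc_self] at h1 h2
  rw [omegaBC, h1, h2, numer, map_mul, prod_one_add_xs]

theorem prod_le_eq {S : Type*} [CommMonoid S] (F : Fin n × Fin n → S) :
    ∏ p : Fin n × Fin n with p.1 ≤ p.2, F p =
      (∏ p : Fin n × Fin n with p.1 < p.2, F p) * ∏ a, F (a, a) := by
  classical
  have hset : (Finset.univ.filter fun p : Fin n × Fin n => p.1 ≤ p.2) =
      (Finset.univ.filter fun p : Fin n × Fin n => p.1 < p.2) ∪ Finset.univ.diag := by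
    ext p
    simp [le_iff_lt_or_eq]
  rw [hset, Finset.prod_union, Finset.prod_diag]
  rw [Finset.disjoint_left]
  intro p hp hp'
  simp only [Finset.mem_filter, Finset.mem_diag, Finset.mem_univ, true_and] at hp hp'
  exact hp.ne hp'

theorem omegaD_xsTrunc (hN : N ≤ n) : omegaD (xsTrunc R N n) (ys R n) (ysInv R n) =
    MvPowerSeries.rename (Fin.castLE hN) (const n (numer fun a : Fin N =>
        (1 - MvPowerSeries.X a * MvPowerSeries.X a : MvPowerSeries (Fin N) R))
      * kern R N n (stageP N 0) (stageQ N 0)) := by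
  rw [omegaD, inverse_omegaDen hN, prod_le_eq, prod_lt_xsTrunc hN, numer, map_mul, map_mul, map_mul]
  congr 2
  rw [map_prod, map_prod]
  symm
  refine Fintype.prod_of_injective (Fin.castLE hN) (Fin.castLE_injective hN) _ _ ?_ ?_
  · intro i hi
    simp only [xsTrunc_of_notMem hN hi, zero_mul, sub_zero]
  · intro i
    simp only [xsTrunc_castLE hN, map_sub, map_one, map_mul, MvPowerSeries.map_X,
      MvPowerSeries.rename_X]

end Kernels

/-! ### Fewer indeterminates, and the expansions -/

section Extend

variable {R : Type*} [CommRing R] {N n : ℕ}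

theorem toLaurent_injective :
    Function.Injective (toLaurent : MvPolynomial (Fin N) R → Laurent R N) := by
  intro f g h
  ext e
  obtain ⟨a, rfl⟩ : ∃ a : Fin N → ℕ, e = toExp a := ⟨e, by ext; simp⟩
  rw [← MvPolynomial.coeff_coe f, ← MvPolynomial.coeff_coe g, ← coeffZ_natCast, ← coeffZ_natCast,
    ← coeff_toLaurent, ← coeff_toLaurent, h]

theorem piPoly_eq {i j : Fin N} (hij : i ≠ j) {f g : MvPolynomial (Fin N) R}
    (h : g * (MvPolynomial.X i - MvPolynomial.X j) =
      MvPolynomial.X i * f - MvPolynomial.X j * swapPoly i j f) : piPoly i j f = g := by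
  refine toLaurent_injective ?_
  rw [toLaurent_piPoly hij]
  refine piA_eq' hij ?_
  have := congrArg toLaurent h
  rw [map_mul, map_sub, map_sub, map_mul, map_mul, toLaurent_X, toLaurent_X, toLaurent_swapPoly]
    at this
  rw [← this, mul_comm]

theorem swapPoly_rename (hN : N ≤ n) (i j : Fin N) (f : MvPolynomial (Fin N) R) :
    swapPoly (Fin.castLE hN i) (Fin.castLE hN j) (MvPolynomial.rename (Fin.castLE hN) f) =
      MvPolynomial.rename (Fin.castLE hN) (swapPoly i j f) := by
  rw [swapPoly, swapPoly, MvPolynomial.rename_rename, MvPolynomial.rename_rename]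
  congr 2
  ext1 k
  exact (Fin.castLE_injective hN).swap_apply i j k

theorem piHatPoly_rename (hN : N ≤ n) {i j : Fin N} (hij : i ≠ j) (f : MvPolynomial (Fin N) R) :
    piHatPoly (Fin.castLE hN i) (Fin.castLE hN j) (MvPolynomial.rename (Fin.castLE hN) f) =
      MvPolynomial.rename (Fin.castLE hN) (piHatPoly i j f) := by
  rw [piHatPoly, piHatPoly, map_sub]
  congr 1
  refine piPoly_eq ((Fin.castLE_injective hN).ne hij) ?_
  have h := congrArg (MvPolynomial.rename (Fin.castLE hN)) (piPoly_spec i j f)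
  rw [map_mul, map_sub, map_sub, map_mul, map_mul, MvPolynomial.rename_X, MvPolynomial.rename_X] at h
  rw [swapPoly_rename, h]

/-- Completing `v` by zeros does not change the polynomial `K̂_v`. -/
theorem isKeyPoly_rename (hN : N ≤ n) {v : Fin N → ℕ} {f : MvPolynomial (Fin N) R}
    (hf : IsKeyPoly piHatPoly v f) :
    IsKeyPoly piHatPoly (extendZero n v) (MvPolynomial.rename (Fin.castLE hN) f) := by
  induction hf with
  | dominant l hl =>
    have e : MvPolynomial.rename (Fin.castLE hN) (∏ i, MvPolynomial.X i ^ l i) =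
        ∏ i, (MvPolynomial.X i : MvPolynomial (Fin n) R) ^ extendZero n l i := by
      rw [map_prod]
      refine Fintype.prod_of_injective (Fin.castLE hN) (Fin.castLE_injective hN) _ _ ?_ ?_
      · intro i hi
        rw [extendZero, dif_neg fun h => hi ⟨⟨i, h⟩, rfl⟩, pow_zero]
      · intro i
        rw [map_pow, MvPolynomial.rename_X, extendZero_castLE]
    rw [e]
    refine .dominant _ fun i j hij => ?_
    unfold extendZero
    split_ifs with h1 h2
    · exact hl hij
    · exact absurd (lt_of_le_of_lt (Fin.le_def.1 hij) h1) h2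
    · exact Nat.zero_le _
    · exact le_rfl
  | step v f i j hij hv _ ih =>
    rw [extendZero_vecSwap hN, ← piHatPoly_rename hN (fin_ne_of_succ hij)]
    exact .step _ _ _ _ hij (by rwa [extendZero_castLE, extendZero_castLE]) ih

theorem keyHat_extendZero (hN : N ≤ n) (v : Fin N → ℕ) :
    keyHat R (extendZero n v) = MvPolynomial.rename (Fin.castLE hN) (keyHat R v) :=
  isKeyPoly_piHatPoly_unique (isKeyPoly_keyHat _) (isKeyPoly_rename hN (isKeyPoly_keyHat v))

theorem aeval_xsTrunc_keyHat (hN : N ≤ n) (v : Fin N → ℕ) :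
    MvPolynomial.aeval (xsTrunc R N n) (keyHat R (extendZero n v)) =
      MvPowerSeries.rename (Fin.castLE hN) (MvPolynomial.aeval
        (fun i => (MvPowerSeries.X i : MvPowerSeries (Fin N) (Laurent R n))) (keyHat R v)) := by
  rw [keyHat_extendZero hN, MvPolynomial.aeval_rename]
  have e : MvPolynomial.aeval (xsTrunc R N n ∘ Fin.castLE hN) =
      ((MvPowerSeries.rename (Fin.castLE hN) :
        MvPowerSeries (Fin N) (Laurent R n) →ₐ[_] _).restrictScalars R).comp (MvPolynomial.aeval
        (fun i => (MvPowerSeries.X i : MvPowerSeries (Fin N) (Laurent R n)))) := by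
    refine MvPolynomial.algHom_ext fun i => ?_
    rw [MvPolynomial.aeval_X, AlgHom.comp_apply, MvPolynomial.aeval_X, Function.comp_apply,
      xsTrunc_castLE hN]
    exact (MvPowerSeries.rename_X _ i).symm
  rw [e]
  rfl

theorem IsFormalSum.rename {σ τ A ι : Type*} [CommRing A] (e : σ ↪ τ)
    {a : ι → MvPowerSeries σ A} {s : MvPowerSeries σ A} (h : IsFormalSum a s) :
    IsFormalSum (fun v => MvPowerSeries.rename e (a v)) (MvPowerSeries.rename e s) := by
  intro x
  by_cases hx : x ∈ Set.range (Finsupp.mapDomain e)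
  · obtain ⟨x, rfl⟩ := hx
    rw [← Finsupp.embDomain_eq_mapDomain]
    simp only [MvPowerSeries.coeff_embDomain_rename]
    exact h x
  · simp only [MvPowerSeries.coeff_rename_eq_zero _ _ hx]
    simp

theorem IsFormalSum.comp_equiv {σ A ι κ : Type*} [CommRing A] (e : κ ≃ ι)
    {a : ι → MvPowerSeries σ A} {s : MvPowerSeries σ A} (h : IsFormalSum (a ∘ e) s) :
    IsFormalSum a s := by
  intro x
  obtain ⟨h1, h2⟩ := h x
  refine ⟨?_, ?_⟩
  · exact Set.Finite.of_preimage h1 e.surjective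
  · rw [h2]
    exact finsum_comp_equiv e (f := fun v => MvPowerSeries.coeff x (a v))

/-- Completion by a zero, as a bijection onto the vectors whose last component is zero. -/
def extendZeroEquiv (n : ℕ) :
    (Fin (n - 1) → ℕ) ≃ {v : Fin n → ℕ // ∀ i : Fin n, (i : ℕ) + 1 = n → v i = 0} where
  toFun v := ⟨extendZero n v, fun i hi => dif_neg (by omega)⟩
  invFun v i := v.1 (Fin.castLE (n.sub_le 1) i)
  left_inv v := funext fun i => extendZero_castLE (n.sub_le 1) v i
  right_inv v := by
    ext i
    simp only [extendZero]
    split_ifs with h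
    · rfl
    · exact (v.2 i (by omega)).symm

/-- The expansion of the kernel of type `BC`. -/
theorem isFormalSum_omegaBC (β : R) : IsFormalSum
    (fun v : Fin n → ℕ =>
      MvPolynomial.aeval (xs R n) (keyHat R v) * inY (keyBC β (fun i => -(v i : ℤ))))
    (omegaBC (algebraMap R (Series R n) β) (xs R n) (ys R n) (ysInv R n)) := by
  simp only [omegaBC_eq, keyBC_eq_pairing]
  exact isFormalSum_keyHat _

/-- The expansion of the kernel of type `D`. -/
theorem isFormalSum_omegaD : IsFormalSum
    (fun v : {v : Fin n → ℕ // ∀ i : Fin n, (i : ℕ) + 1 = n → v i = 0} =>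
      MvPolynomial.aeval (xsZero R n) (keyHat R v.1) * inY (keyD R (fun i => -(v.1 i : ℤ))))
    (omegaD (xsZero R n) (ys R n) (ysInv R n)) := by
  refine IsFormalSum.comp_equiv (extendZeroEquiv n) ?_
  rw [← xsTrunc_pred, omegaD_xsTrunc (n.sub_le 1)]
  have h := (isFormalSum_keyHat (R := R) (const n (numer fun a : Fin (n - 1) =>
        (1 - MvPowerSeries.X a * MvPowerSeries.X a : MvPowerSeries (Fin (n - 1)) R))
      * kern R (n - 1) n (stageP (n - 1) 0) (stageQ (n - 1) 0))).rename (Fin.castLEEmb (n.sub_le 1))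
  refine Eq.subst (motive := fun a => IsFormalSum a _) (funext fun v => ?_) h
  have e : (fun i => -((extendZero n v i : ℕ) : ℤ)) = extendZero n fun i => -(v i : ℤ) := by
    ext i
    unfold extendZero
    split_ifs
    · rfl
    · simp
  simp only [Function.comp_apply, extendZeroEquiv, Equiv.coe_fn_mk, e]
  rw [map_mul, aeval_xsTrunc_keyHat (n.sub_le 1), keyD_eq_pairing rfl, MvPowerSeries.rename_C]
  rfl

end Extend

end CauchyKernels

end

open CauchyKernels in
theorem theorem6 (R : Type*) [CommRing R] (n : ℕ) (β : R) :
    IsFormalSum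
      (fun v : Fin n → ℕ =>
        MvPolynomial.aeval (xs R n) (keyHat R v)
          * MvPolynomial.aeval (ys R n) (key R (fun i => v (Fin.rev i))))
      (omegaA (xs R n) (ys R n)) ∧
    IsFormalSum
      (fun v : Fin n → ℕ =>
        MvPolynomial.aeval (xs R n) (keyHat R v) * inY (keyBC β (fun i => -(v i : ℤ))))
      (omegaBC (algebraMap R (Series R n) β) (xs R n) (ys R n) (ysInv R n)) ∧
    IsFormalSum
      (fun v : {v : Fin n → ℕ // ∀ i : Fin n, (i : ℕ) + 1 = n → v i = 0} =>
        MvPolynomial.aeval (xsZero R n) (keyHat R v.1) * inY (keyD R (fun i => -(v.1 i : ℤ))))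
      (omegaD (xsZero R n) (ys R n) (ysInv R n)) := by
  exact ⟨isFormalSum_omegaA R n, isFormalSum_omegaBC β, isFormalSum_omegaD⟩
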